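/- Let $k$ be a field. An algebraic $k$-scheme is a separated scheme of finite type over $k$. A connected, geometrically reduced algebraic $k$-scheme $X$ is a \emph{normal crossing variety} of dimension $n-1$ if for every closed point $x\in X$ there are an integer $1\le l_x\le n$ (the multiplicity at $x$) and an isomorphism of $k$-algebras $\widehat{\mathcal O}_{X,x}\cong k(x)[[T_1,\dots,T_n]]/(T_1\cdots T_{l_x})$. Let $D\subset X$ be the closure of the set of closed points of multiplicity $>1$, with its reduced scheme structure, and let $\mathcal T^1_X$ be the sheaf of $\mathcal O_X$-modules obtained by gluing the modules $T^1_A$ of the affine pieces $\operatorname{Spec} A$ of $X$; here, for a presentation $A=P/I$ with $P$ a polynomial ring over $k$, $T^1_A=\operatorname{Coker}\big(\operatorname{Hom}_A(\Omega^1_{P/k}\otimes_P A,A)\to \operatorname{Hom}_A(I/I^2,A)\big)$. Suppose that $j\colon X\hookrightarrow V$ is a closed embedding over $k$ of a normal crossing variety $X$ of dimension $n-1$ into a smooth $k$-variety $V$ of dimension $n$ as a normal crossing divisor, i.e. $X$ is a divisor on $V$. Then there exists a line bundle $\mathcal L_X$ on $X$ such that $$\mathcal L_X\otimes_{\mathcal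 O_X}\mathcal O_D\;\cong\;\mathcal T^1_X ,$$ and one may take for $\mathcal L_X$ the normal bundle $\mathcal N_{X|V}=\mathcal Hom_{\mathcal O_X}(\mathcal I/\mathcal I^2,\mathcal O_X)$, where $\mathcal I$ is the ideal sheaf of $X$ in $V$. -/

import Mathlib

open CategoryTheory AlgebraicGeometry TopologicalSpace

universe u v w

noncomputable section

/-! ### The first cotangent functor `T¹` of an algebra -/

namespace TangentCohomology

open Algebra

variable (k : Type u) (A : Type v) [CommRing k] [CommRing A] [Algebra k A]

/-- The tautological presentation `k[x_a : a ∈ A] → A`. -/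
abbrev pres : Algebra.Extension k A := (Generators.self k A).toExtension

/-- `T¹(A/k, M)`: the first cohomology of `Hom_A(L, M)`, where `L : I/I² → Ω_{P/k} ⊗ A` is the
(naive) cotangent complex of `A = P/I`, `P` a polynomial ring. So
`T¹(A/k, M) = Coker (Hom_A(Ω_{P/k} ⊗ A, M) → Hom_A(I/I², M))`. -/
def T1 (M : Type w) [AddCommGroup M] [Module A M] : Type _ :=
  ((pres k A).Cotangent →ₗ[A] M) ⧸
    LinearMap.range (LinearMap.lcomp A M (pres k A).cotangentComplex)

instance (M : Type w) [AddCommGroup M] [Module A M] : AddCommGroup (T1 k A M) :=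
  inferInstanceAs (AddCommGroup (_ ⧸ _))

instance (M : Type w) [AddCommGroup M] [Module A M] : Module A (T1 k A M) :=
  inferInstanceAs (Module A (_ ⧸ _))

variable {A}

/-- The class in `T¹(A/k, M)` of a homomorphism `I/I² → M`. -/
def T1.mk {M : Type w} [AddCommGroup M] [Module A M] :
    ((pres k A).Cotangent →ₗ[A] M) →ₗ[A] T1 k A M :=
  Submodule.mkQ _

lemma T1.mk_surjective {M : Type w} [AddCommGroup M] [Module A M] :
    Function.Surjective (T1.mk k : _ →ₗ[A] T1 k A M) :=
  Submodule.mkQ_surjective _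

/-- Functoriality of `T¹(A/k, M)` in the module `M`. -/
def T1.push {M : Type*} {N : Type*} [AddCommGroup M] [Module A M] [AddCommGroup N] [Module A N]
    (g : M →ₗ[A] N) : T1 k A M →ₗ[A] T1 k A N :=
  Submodule.mapQ _ _ (g.compRight A) (by
    rintro _ ⟨h, rfl⟩
    exact ⟨g ∘ₗ h, rfl⟩)

/-- Functoriality of `T¹(A/k, B)` in the algebra: the map `T¹(B/k, B) → T¹(A/k, B)`
for an `A`-algebra `B`. -/
def T1.pull (B : Type*) [CommRing B] [Algebra k B] [Algebra A B] [IsScalarTower k A B] :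
    T1 k B B →+ T1 k A B :=
  let h := ((Generators.self k A).defaultHom (Generators.self k B)).toExtensionHom
  QuotientAddGroup.lift _
    ((T1.mk k (A := A) (M := B)).toAddMonoidHom.comp
      (AddMonoidHom.mk' (fun φ : (pres k B).Cotangent →ₗ[B] B =>
        (φ.restrictScalars A).comp (Extension.Cotangent.map h)) (fun _ _ => rfl)))
    (by
      rintro _ ⟨ψ, rfl⟩
      refine (Submodule.Quotient.mk_eq_zero _).2
        ⟨(ψ.restrictScalars A).comp (Extension.CotangentSpace.map h), ?_⟩
      ext x
      exact congrArg ψ (Extension.CotangentSpace.map_cotangentComplex h x))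

lemma T1.pull_smul (B : Type*) [CommRing B] [Algebra k B] [Algebra A B] [IsScalarTower k A B]
    (a : A) (t : T1 k B B) : (T1.pull k B (algebraMap A B a • t) : T1 k A B) = a • (T1.pull k B t : T1 k A B) := by
  obtain ⟨t, rfl⟩ := T1.mk_surjective k t
  rw [← map_smul, algebraMap_smul]
  exact map_smul (T1.mk k (A := A) (M := B)) a
    ((t.restrictScalars A).comp (Extension.Cotangent.map _))

variable {k}

/-- Let `φ : A → B` be a homomorphism of `k`-algebras. The classes `s ∈ T¹(A/k, A)` and
`t ∈ T¹(B/k, B)` are compatible if they have the same image in `T¹(A/k, B)`. -/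
def T1.Compatible {B : Type*} [CommRing B] [Algebra k B] (φ : A →ₐ[k] B)
    (s : T1 k A A) (t : T1 k B B) : Prop :=
  letI := φ.toRingHom.toAlgebra
  haveI : IsScalarTower k A B := IsScalarTower.of_algebraMap_eq fun x => (φ.commutes x).symm
  T1.push k (Algebra.linearMap A B) s = T1.pull k B t

variable {B : Type*} [CommRing B] [Algebra k B] {φ : A →ₐ[k] B}

lemma T1.Compatible.zero : T1.Compatible φ (0 : T1 k A A) 0 := by
  simp only [T1.Compatible, map_zero]

lemma T1.Compatible.add {s s' : T1 k A A} {t t' : T1 k B B} (h : T1.Compatible φ s t)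
    (h' : T1.Compatible φ s' t') : T1.Compatible φ (s + s') (t + t') := by
  simp only [T1.Compatible, map_add] at *
  rw [h, h']

lemma T1.Compatible.neg {s : T1 k A A} {t : T1 k B B} (h : T1.Compatible φ s t) :
    T1.Compatible φ (-s) (-t) := by
  simp only [T1.Compatible, map_neg] at *
  rw [h]

lemma T1.Compatible.smul (a : A) {s : T1 k A A} {t : T1 k B B} (h : T1.Compatible φ s t) :
    T1.Compatible φ (a • s) (φ a • t) := by
  let := φ.toRingHom.toAlgebra
  have : IsScalarTower k A B := IsScalarTower.of_algebraMap_eq fun x => (φ.commutes x).symm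
  simp only [T1.Compatible] at *
  rw [map_smul, h]
  exact (T1.pull_smul k B a t).symm

end TangentCohomology

namespace NormalCrossing

open TangentCohomology AlgebraicGeometry.Scheme

variable {k : Type u} [Field k] {X V : Scheme.{u}}

/-! ### Sections of a `k`-scheme as `k`-algebras -/

/-- The homomorphism `k → Γ(X, U)` given by the structure morphism of `X`. -/
def toSections (f : X ⟶ Spec (.of k)) (U : X.Opens) : k →+* Γ(X, U) :=
  ((ΓSpecIso (.of k)).inv ≫ f.appTop ≫ X.presheaf.map (homOfLE le_top).op).hom

/-- `Γ(X, U)` as a `k`-algebra. -/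
def Sec (_f : X ⟶ Spec (.of k)) (U : X.Opens) : Type u := Γ(X, U)

instance (f : X ⟶ Spec (.of k)) (U : X.Opens) : CommRing (Sec f U) :=
  inferInstanceAs (CommRing Γ(X, U))

instance (f : X ⟶ Spec (.of k)) (U : X.Opens) : Algebra k (Sec f U) :=
  (toSections f U).toAlgebra

/-- The restriction of sections. -/
def resHom {U W : X.Opens} (h : W ≤ U) : Γ(X, U) →+* Γ(X, W) :=
  (X.presheaf.map (homOfLE h).op).hom

lemma resHom_resHom {U W T : X.Opens} (h : W ≤ U) (h' : T ≤ W) (a : Γ(X, U)) :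
    resHom h' (resHom h a) = resHom (h'.trans h) a := by
  simp only [resHom, ← CommRingCat.comp_apply, ← Functor.map_comp]
  rfl

/-- The restriction of sections, as a homomorphism of `k`-algebras. -/
def Sec.res (f : X ⟶ Spec (.of k)) {U W : X.Opens} (h : W ≤ U) : Sec f U →ₐ[k] Sec f W where
  __ := (resHom h : Γ(X, U) →+* Γ(X, W))
  commutes' c := resHom_resHom le_top h ((((ΓSpecIso (.of k)).inv ≫ f.appTop).hom c))

/-- The restriction `Γ(X, U) → Γ(X, W)`. -/
def toSec (f : X ⟶ Spec (.of k)) {U W : X.Opens} (h : W ≤ U) : Γ(X, U) →+* Sec f W :=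
  resHom h

/-! ### The sheaf `T¹` of a `k`-scheme -/

/-- The affine open subsets of `U`. -/
abbrev AffineIn (U : X.Opens) : Type u := {W : X.affineOpens // W.1 ≤ U}

/-- The families `(t_W)`, `t_W ∈ T¹(Γ(X, W)/k, Γ(X, W))`, indexed by the affine open subsets
`W` of `U`, which are compatible with restriction. -/
def T1Family (f : X ⟶ Spec (.of k)) (U : X.Opens) :
    AddSubgroup (∀ W : AffineIn U, T1 k (Sec f W.1) (Sec f W.1)) where
  carrier := {t | ∀ (W W' : AffineIn U) (h : W'.1.1 ≤ W.1.1),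
    T1.Compatible (Sec.res f h) (t W) (t W')}
  zero_mem' _ _ _ := T1.Compatible.zero
  add_mem' ht ht' W W' h := (ht W W' h).add (ht' W W' h)
  neg_mem' ht W W' h := (ht W W' h).neg

namespace T1Family

variable (f : X ⟶ Spec (.of k)) {U : X.Opens}

instance : SMul Γ(X, U) (T1Family f U) where
  smul a t := ⟨fun W => toSec f W.2 a • t.1 W, fun W W' h => by
    have := (t.2 W W' h).smul (toSec f W.2 a)
    rwa [show Sec.res f h (toSec f W.2 a) = toSec f W'.2 a from resHom_resHom _ _ _] at this⟩

lemma smul_val (a : Γ(X, U)) (t : T1Family f U) (W : AffineIn U) :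
    (a • t).1 W = toSec f W.2 a • t.1 W := rfl

instance : Module Γ(X, U) (T1Family f U) where
  one_smul t := Subtype.ext (funext fun W => by rw [smul_val, map_one, one_smul])
  mul_smul a b t := Subtype.ext (funext fun W => by simp only [smul_val, map_mul, mul_smul])
  smul_zero a := Subtype.ext (funext fun W => smul_zero (toSec f W.2 a))
  smul_add a s t := Subtype.ext (funext fun W => smul_add (toSec f W.2 a) _ _)
  add_smul a b t := Subtype.ext (funext fun W => by
    rw [smul_val, map_add, add_smul]
    rfl)
  zero_smul t := Subtype.ext (funext fun W => by
    rw [smul_val, map_zero, zero_smul]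
    rfl)

/-- Restriction of families to a smaller open subset. -/
def restrict {U U' : X.Opens} (h : U' ≤ U) : T1Family f U →+ T1Family f U' where
  toFun t := ⟨fun W => t.1 ⟨W.1, W.2.trans h⟩, fun W W' h' =>
    t.2 ⟨W.1, W.2.trans h⟩ ⟨W'.1, W'.2.trans h⟩ h'⟩
  map_zero' := rfl
  map_add' _ _ := rfl

end T1Family

/-- The presheaf of modules `U ↦ T1Family f U`; on an affine open subset `W` its sections
are given by `T¹(Γ(X, W)/k, Γ(X, W))`. -/
def T1Presheaf (f : X ⟶ Spec (.of k)) : X.PresheafOfModules :=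
  letI F : X.Opensᵒᵖ ⥤ Ab.{u} :=
    { obj := fun U => AddCommGrpCat.of (T1Family f U.unop)
      map := fun i => AddCommGrpCat.ofHom (T1Family.restrict f i.unop.le) }
  letI : ∀ U, Module (X.ringCatSheaf.obj.obj U) (F.obj U) := fun U =>
    inferInstanceAs (Module Γ(X, U.unop) (T1Family f U.unop))
  PresheafOfModules.ofPresheaf F (fun U U' i a t => by
    refine Subtype.ext (funext fun W => ?_)
    exact congrArg (fun c : Sec f W.1 => c • t.1 ⟨W.1, W.2.trans i.unop.le⟩)
      (resHom_resHom i.unop.le W.2 a).symm)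

/-- The sheaf of modules associated with a presheaf of modules. -/
def sheafify (M : X.PresheafOfModules) : X.Modules :=
  (PresheafOfModules.sheafification (𝟙 X.ringCatSheaf.obj)).obj M

/-- The sheaf `𝒯¹_X`, obtained by gluing the modules `T¹(A/k, A)` of the affine pieces
`Spec A` of `X`. -/
def T1Sheaf (f : X ⟶ Spec (.of k)) : X.Modules := sheafify (T1Presheaf f)

/-! ### The normal sheaf of a closed immersion -/

/-- `Hom_{Γ(V, W)}(I(W)/I(W)², Γ(X, j⁻¹ W))`, for an affine open subset `W` of `V`, where `I` is
the ideal sheaf of `j : X ⟶ V`. -/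
abbrev NormalModule (j : X ⟶ V) (W : V.affineOpens) : Type u :=
  (j.ker.ideal W).Cotangent →ₛₗ[(j.app W.1).hom] Γ(X, j ⁻¹ᵁ W.1)

/-- The affine open subsets of `V` whose preimage lies in `U`. -/
abbrev AffineOver (j : X ⟶ V) (U : X.Opens) : Type u := {W : V.affineOpens // j ⁻¹ᵁ W.1 ≤ U}

/-- The families of homomorphisms `φ_W : I(W)/I(W)² → Γ(X, j⁻¹ W)`, indexed by the affine open
subsets `W` of `V` with `j⁻¹ W ⊆ U`, which are compatible with restriction. -/
def NormalFamily (j : X ⟶ V) (U : X.Opens) :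
    AddSubgroup (∀ W : AffineOver j U, NormalModule j W.1) where
  carrier := {t | ∀ (W W' : AffineOver j U) (h : W'.1 ≤ W.1) (x : j.ker.ideal W.1),
    resHom (j.preimage_mono h) (t W (Ideal.toCotangent _ x)) =
      t W' (Ideal.toCotangent _ ⟨resHom (X := V) h x.1, j.ker.ideal_le_comap_ideal h x.2⟩)}
  zero_mem' _ _ _ _ := map_zero _
  add_mem' ht ht' W W' h x := by
    simp only [Pi.add_apply, LinearMap.add_apply, map_add, ht W W' h x, ht' W W' h x]
  neg_mem' ht W W' h x := by
    simp only [Pi.neg_apply, LinearMap.neg_apply, map_neg, ht W W' h x]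

namespace NormalFamily

variable (j : X ⟶ V) {U : X.Opens}

instance : SMul Γ(X, U) (NormalFamily j U) where
  smul a t := ⟨fun W => resHom W.2 a • t.1 W, fun W W' h x => by
    simp only [LinearMap.smul_apply, smul_eq_mul, map_mul, resHom_resHom, t.2 W W' h x]⟩

lemma smul_val (a : Γ(X, U)) (t : NormalFamily j U) (W : AffineOver j U) :
    (a • t).1 W = resHom W.2 a • t.1 W := rfl

instance : Module Γ(X, U) (NormalFamily j U) where
  one_smul t := Subtype.ext (funext fun W => by rw [smul_val, map_one, one_smul])
  mul_smul a b t := Subtype.ext (funext fun W => by simp only [smul_val, map_mul, mul_smul])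
  smul_zero a := Subtype.ext (funext fun W => smul_zero (resHom W.2 a))
  smul_add a s t := Subtype.ext (funext fun W => smul_add (resHom W.2 a) _ _)
  add_smul a b t := Subtype.ext (funext fun W => by
    rw [smul_val, map_add, add_smul]
    rfl)
  zero_smul t := Subtype.ext (funext fun W => by
    rw [smul_val, map_zero, zero_smul]
    rfl)

/-- Restriction of families to a smaller open subset. -/
def restrict {U U' : X.Opens} (h : U' ≤ U) : NormalFamily j U →+ NormalFamily j U' where
  toFun t := ⟨fun W => t.1 ⟨W.1, W.2.trans h⟩, fun W W' h' =>
    t.2 ⟨W.1, W.2.trans h⟩ ⟨W'.1, W'.2.trans h⟩ h'⟩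
  map_zero' := rfl
  map_add' _ _ := rfl

end NormalFamily

/-- The presheaf of modules `U ↦ NormalFamily j U`. -/
def normalPresheaf (j : X ⟶ V) : X.PresheafOfModules :=
  letI F : X.Opensᵒᵖ ⥤ Ab.{u} :=
    { obj := fun U => AddCommGrpCat.of (NormalFamily j U.unop)
      map := fun i => AddCommGrpCat.ofHom (NormalFamily.restrict j i.unop.le) }
  letI : ∀ U, Module (X.ringCatSheaf.obj.obj U) (F.obj U) := fun U =>
    inferInstanceAs (Module Γ(X, U.unop) (NormalFamily j U.unop))
  PresheafOfModules.ofPresheaf F (fun U U' i a t => by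
    refine Subtype.ext (funext fun W => ?_)
    exact congrArg (fun c => c • t.1 ⟨W.1, W.2.trans i.unop.le⟩)
      (resHom_resHom i.unop.le W.2 a).symm)

/-- The normal sheaf `𝒩_{X|V} = ℋom(I/I², 𝒪_X)` of a closed immersion `j : X ⟶ V` with
ideal sheaf `I`. -/
def normalSheaf (j : X ⟶ V) : X.Modules := sheafify (normalPresheaf j)

/-! ### Line bundles and tensor products -/

/-- The structure sheaf, as a sheaf of modules. -/
def structureSheaf (X : Scheme.{u}) : X.Modules := SheafOfModules.unit X.ringCatSheaf

/-- A line bundle is a sheaf of modules which is locally isomorphic to the structure sheaf. -/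
def IsLineBundle (L : X.Modules) : Prop :=
  ∀ x : X, ∃ U : X.Opens, x ∈ U ∧ Nonempty (L.restrict U.ι ≅ structureSheaf (U : Scheme.{u}))

/-- The tensor product over `𝒪_X`: the sheaf associated with `U ↦ M(U) ⊗ N(U)`. -/
def tensor (M N : X.Modules) : X.Modules :=
  sheafify (PresheafOfModules.Monoidal.tensorObj (R := X.presheaf) M.val N.val)

/-! ### Normal crossing varieties -/

/-- The homomorphism `k → 𝒪_{X, x}`. -/
def toStalk (f : X ⟶ Spec (.of k)) (x : X) : k →+* X.presheaf.stalk x :=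
  (X.presheaf.germ ⊤ x trivial).hom.comp (toSections f ⊤)

/-- The ring `K[[T_1, …, T_n]]/(T_1 ⋯ T_l)`. -/
abbrev NCRing (K : Type u) [Field K] (n l : ℕ) : Type u :=
  MvPowerSeries (Fin n) K ⧸
    Ideal.span {∏ i : Fin n with i.val < l, (MvPowerSeries.X i : MvPowerSeries (Fin n) K)}

/-- `1 ≤ l ≤ n`, and the completion of `𝒪_{X, x}` along its maximal ideal is isomorphic, as a
`k`-algebra, to `k(x)[[T_1, …, T_n]]/(T_1 ⋯ T_l)`. -/
def HasMultiplicity (f : X ⟶ Spec (.of k)) (n : ℕ) (x : X) (l : ℕ) : Prop :=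
  1 ≤ l ∧ l ≤ n ∧
    ∃ e : AdicCompletion (IsLocalRing.maximalIdeal (X.presheaf.stalk x)) (X.presheaf.stalk x) ≃+*
        NCRing (X.residueField x) n l,
      ∀ c : k, e (algebraMap (X.presheaf.stalk x) _ (toStalk f x c)) =
        Ideal.Quotient.mk _ (MvPowerSeries.C ((X.residue x).hom (toStalk f x c)))

/-- Normal crossing varieties over `k` of dimension `d`. -/
structure IsNormalCrossingVariety (f : X ⟶ Spec (.of k)) (d : ℕ) : Prop where
  isSeparated : IsSeparated f
  locallyOfFiniteType : LocallyOfFiniteType f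
  quasiCompact : QuasiCompact f
  connected : ConnectedSpace X
  geometricallyReduced : GeometricallyReduced f
  hasMultiplicity : ∀ x : X, IsClosed {x} → ∃ l, HasMultiplicity f (d + 1) x l

/-- The singular locus of a normal crossing variety of dimension `d`: the closure of the set of
closed points of multiplicity greater than one. -/
def singularLocus (f : X ⟶ Spec (.of k)) (d : ℕ) : Closeds X :=
  Closeds.closure {x : X | IsClosed {x} ∧ ∃ l, 1 < l ∧ HasMultiplicity f (d + 1) x l}

/-- `𝒪_D` as an `𝒪_X`-module, where `D` is the singular locus with its reduced structure. -/
def singularStructureSheaf (f : X ⟶ Spec (.of k)) (d : ℕ) : X.Modules :=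
  (Modules.pushforward (IdealSheafData.vanishingIdeal (singularLocus f d)).subschemeι).obj
    (structureSheaf (IdealSheafData.vanishingIdeal (singularLocus f d)).subscheme)

/-- `j : X ⟶ V` is an embedding of the normal crossing variety `X` of dimension `d`, as a
normal crossing divisor, into the smooth `k`-variety `V` of dimension `d + 1`: a closed immersion
over `k` whose image is an (effective Cartier) divisor, i.e. its ideal sheaf is locally generated
by one nonzerodivisor. Connectedness of `V` is not needed. -/
structure IsNCDEmbedding (f : X ⟶ Spec (.of k)) (g : V ⟶ Spec (.of k)) (j : X ⟶ V) (d : ℕ) :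
    Prop where
  isNormalCrossingVariety : IsNormalCrossingVariety f d
  isSeparated : IsSeparated g
  quasiCompact : QuasiCompact g
  smooth : SmoothOfRelativeDimension (d + 1) g
  comp_eq : j ≫ g = f
  isClosedImmersion : IsClosedImmersion j
  isDivisor : ∀ x : V, ∃ W : V.affineOpens, x ∈ W.1 ∧
    ∃ a ∈ nonZeroDivisors Γ(V, W.1), j.ker.ideal W = Ideal.span {a}

end NormalCrossing

end

/-!
The line bundle is the normal sheaf `𝒩` of `X` in `V`. Families of homomorphisms `I/I² → 𝒪_X`
already form a sheaf, and on a chart on which `X` is cut out by a nonzerodivisor `a` this sheaf is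
freely generated by the homomorphism with `a ↦ 1` (`NormalCrossing.isLineBundle_normalModules`).

**The local computation.** Let `A = B/(a)` be a chart, with `B` smooth over `k`. For the
computation of `T¹(A)`, the polynomial ring in its definition may be replaced by `B`: every class
comes from a homomorphism `I/I² → A`, and it vanishes if and only if this homomorphism is the
restriction of a derivation `B → A` (`TangentCohomology.T1.ofNormal_surjective`,
`TangentCohomology.T1.exists_derivation_of_ofNormal_eq_zero`). Hence `T¹(A)` is generated by the
class of `a ↦ 1`, and the annihilator of this class is the ideal of all values `δ a` of
derivations `δ : B → A`. The theorem amounts to the fact that this ideal is the ideal of the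
reduced subscheme `D` of points of multiplicity greater than one
(`NormalCrossing.mem_singularIdeal_iff_exists_derivation`). There are two points to it.

* The ideal is radical (`NormalCrossing.isRadical_derivIdeal`). By Krull's intersection theorem
  this can be checked modulo the powers of each maximal ideal `M` of `B`. The description of the
  completed local ring of `X` determines the quotients `B/(a, Mᴺ)` only. But since `B` is smooth,
  at a point of multiplicity `l > 1` such an identification lifts to one of `B/Mᴺ` with
  `K[T₁, …, Tₙ]/(T₁, …, Tₙ)ᴺ`, under which `a` is a unit times `T₁ ⋯ T_l`
  (`NormalCrossing.IsTruncation.exists_lift`). It remains to see that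
  the ideal generated by the partial derivatives of `T₁ ⋯ T_l` is radical. It is generated by
  squarefree monomials (`NormalCrossing.mem_coordJacobian_sup_of_sq_mem`).
* Its zeros are the points of multiplicity greater than one. This uses derivations with values in
  the residue fields, and so requires these fields to be étale over `k`. At a point of
  multiplicity greater than one, the derivations `∂/∂T_i` already exhaust the `n`-dimensional
  space of derivations into the residue field. At a point of multiplicity one, the claim is not
  local: it rests on the hypothesis that `X` is geometrically reduced
  (`NormalCrossing.IsCrossing.formallyEtale`).

**Globalization.** For an étale `A`-algebra `A'`, a class in `T¹(A)` determines a unique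
compatible class in `T¹(A')` (`TangentCohomology.T1.Compatible.existsUnique`, by
`TangentCohomology.T1.bijective_pullModule`). In particular a compatible family of classes over
the affine open subsets of an affine `U` is given by its member at `U`, and `𝒯¹_X` can be computed
from the charts above (`NormalCrossing.sheafifyChartPresheafIso`). On these charts a section
`n ⊗ s` of `𝒩 ⊗ 𝒪_D` is sent to `s` times the class of `n`. This is well defined because the
ideal of `D` annihilates `T¹`, and it is bijective on each chart by the local computation
(`NormalCrossing.IsGoodChart.bijective_chartFamilyOfTensor`). Therefore it induces an isomorphism
of the associated sheaves (`NormalCrossing.tensorNormalIso`).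
-/

noncomputable section

/-! ### Computing `T¹` from a formally smooth extension -/

namespace TangentCohomology

open Algebra

section ofExtension

variable {k : Type u} {A : Type v} [CommRing k] [CommRing A] [Algebra k A]

/-- A homomorphism from the tautological presentation to an arbitrary extension. -/
def presHom (Q : Algebra.Extension.{w} k A) : (pres k A).Hom Q where
  toRingHom := (MvPolynomial.aeval (R := k) Q.σ : MvPolynomial A k →ₐ[k] Q.Ring).toRingHom
  toRingHom_algebraMap x := (MvPolynomial.aeval (R := k) Q.σ).commutes x
  algebraMap_toRingHom x := by
    change ((IsScalarTower.toAlgHom k Q.Ring A).comp (MvPolynomial.aeval (R := k) Q.σ)) x =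
      (MvPolynomial.aeval (R := k) (fun a : A => a)) x
    congr 1
    ext a
    simp

variable {B : Type*} [CommRing B] [Algebra k B] [Algebra A B] [IsScalarTower k A B]

/-- Two homomorphisms of extensions are homotopic, so they induce the same classes. -/
lemma T1.mk_comp_map_eq {Q : Algebra.Extension.{w} k B} (f g : (pres k A).Hom Q)
    {M : Type*} [AddCommGroup M] [Module B M] [Module A M] [IsScalarTower A B M]
    (φ : Q.Cotangent →ₗ[B] M) :
    T1.mk k ((φ.restrictScalars A).comp (Extension.Cotangent.map f)) =
      T1.mk k ((φ.restrictScalars A).comp (Extension.Cotangent.map g)) := by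
  rw [← sub_eq_zero, ← map_sub, ← LinearMap.comp_sub, Extension.Cotangent.map_sub_map]
  exact (Submodule.Quotient.mk_eq_zero _).2
    ⟨(φ.restrictScalars A).comp (f.sub g), rfl⟩

variable (Q : Algebra.Extension.{w} k A) {M : Type*} [AddCommGroup M] [Module A M]

/-- The class in `T¹(A/k, M)` of a homomorphism `I/I² → M`, where `I` is the kernel of an
arbitrary surjection `Q → A` of `k`-algebras. -/
def T1.ofExtension : (Q.Cotangent →ₗ[A] M) →ₗ[A] T1 k A M :=
  T1.mk k ∘ₗ LinearMap.lcomp A M (Extension.Cotangent.map (presHom Q))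

/-- Homomorphisms `I/I² → M` which extend to derivations have trivial class. -/
lemma T1.ofExtension_comp_cotangentComplex (δ : Q.CotangentSpace →ₗ[A] M) :
    T1.ofExtension Q (δ ∘ₗ Q.cotangentComplex) = 0 := by
  refine (Submodule.Quotient.mk_eq_zero _).2
    ⟨δ.comp (Extension.CotangentSpace.map (presHom Q)), ?_⟩
  ext x
  exact congrArg δ (Extension.CotangentSpace.map_cotangentComplex (presHom Q) x)

end ofExtension

section formallySmooth

variable {k : Type u} {A : Type v} [CommRing k] [CommRing A] [Algebra k A]
  {Q : Algebra.Extension.{w} k A} {M : Type*} [AddCommGroup M] [Module A M]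

instance : Algebra.FormallySmooth k (pres k A).Ring :=
  inferInstanceAs (Algebra.FormallySmooth k (MvPolynomial A k))

/-- The inverse, up to homotopy, of `presHom Q`, with values in `k[A]/I²`. -/
def toPresInfinitesimal (Q : Algebra.Extension.{w} k A) [Algebra.FormallySmooth k Q.Ring] :
    Q.Hom (pres k A).infinitesimal :=
  (Extension.homInfinitesimal Q (pres k A)).comp Q.toInfinitesimal

/-- The cotangent module of an extension agrees with that of its infinitesimal quotient. -/
def cotangentEquivInfinitesimal (P : Algebra.Extension.{w} k A) :
    P.Cotangent ≃ₗ[A] P.infinitesimal.Cotangent :=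
  .ofBijective _ (Extension.Cotangent.map_toInfinitesimal_bijective P)

/-- The cotangent space of an extension agrees with that of its infinitesimal quotient. -/
def cotangentSpaceEquivInfinitesimal (P : Algebra.Extension.{w} k A) :
    P.CotangentSpace ≃ₗ[A] P.infinitesimal.CotangentSpace :=
  .ofBijective _ (Extension.CotangentSpace.map_toInfinitesimal_bijective P)

/-- If `Q` maps to `k[A]/I²` over `A`, then all classes come from `Q`. The map need not be induced
by formal smoothness of `Q`, so this applies to nilpotent extensions, too. -/
lemma T1.ofExtension_surjective_of_hom (u : Q.Hom (pres k A).infinitesimal) :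
    Function.Surjective (T1.ofExtension Q : _ →ₗ[A] T1 k A M) := by
  intro t
  obtain ⟨φ, rfl⟩ := T1.mk_surjective k t
  let φ' := φ ∘ₗ (cotangentEquivInfinitesimal (pres k A)).symm.toLinearMap
  refine ⟨φ'.comp (Extension.Cotangent.map u), ?_⟩
  have h := T1.mk_comp_map_eq (A := A) (u.comp (presHom Q)) (pres k A).toInfinitesimal φ'
  rw [Extension.Cotangent.map_comp] at h
  refine Eq.trans ?_ (h.trans ?_)
  · rfl
  · congr 1
    ext x
    exact congrArg φ ((cotangentEquivInfinitesimal (pres k A)).symm_apply_apply x)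

/-- If `Q` maps to `k[A]/I²` over `A`, then the homomorphisms `I/I² → M` with trivial class are
those which extend to derivations. -/
lemma T1.ofExtension_eq_zero_iff_of_hom (u : Q.Hom (pres k A).infinitesimal)
    (φ : Q.Cotangent →ₗ[A] M) :
    T1.ofExtension Q φ = 0 ↔ ∃ δ : Q.CotangentSpace →ₗ[A] M, φ = δ ∘ₗ Q.cotangentComplex := by
  refine ⟨fun h => ?_, by rintro ⟨δ, rfl⟩; exact T1.ofExtension_comp_cotangentComplex Q δ⟩
  obtain ⟨δ, hδ⟩ := (Submodule.Quotient.mk_eq_zero _).1 h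
  let φ' := φ ∘ₗ (cotangentEquivInfinitesimal Q).symm.toLinearMap
  let F : (pres k A).infinitesimal.Hom Q.infinitesimal := Extension.homInfinitesimal _ _
  have hφ : φ = φ'.comp (Extension.Cotangent.map Q.toInfinitesimal) := by
    ext x
    exact congrArg φ ((cotangentEquivInfinitesimal Q).symm_apply_apply x).symm
  -- `F ∘ u` and the quotient map `Q → Q/I²` are homotopic, and so are the two maps from the
  -- tautological presentation to `Q/I²`
  have h1 := Extension.Cotangent.map_sub_map Q.toInfinitesimal (F.comp u)
  have h2 := Extension.Cotangent.map_sub_map (F.comp (pres k A).toInfinitesimal)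
    (Q.toInfinitesimal.comp (presHom Q))
  rw [sub_eq_iff_eq_add] at h1 h2
  let δ₁ := φ'.comp ((F.comp (pres k A).toInfinitesimal).sub
    (Q.toInfinitesimal.comp (presHom Q))) + δ
  let δ₂ := δ₁ ∘ₗ (cotangentSpaceEquivInfinitesimal (pres k A)).symm.toLinearMap
  have h3 : φ'.comp (Extension.Cotangent.map F) =
      δ₂ ∘ₗ (pres k A).infinitesimal.cotangentComplex := by
    ext x
    obtain ⟨x, rfl⟩ := (cotangentEquivInfinitesimal (pres k A)).surjective x
    have hx : (pres k A).infinitesimal.cotangentComplex (cotangentEquivInfinitesimal (pres k A) x) =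
        cotangentSpaceEquivInfinitesimal (pres k A) ((pres k A).cotangentComplex x) :=
      (Extension.CotangentSpace.map_cotangentComplex _ x).symm
    simp only [LinearMap.comp_apply, hx, δ₂, LinearEquiv.coe_coe, LinearEquiv.symm_apply_apply]
    have hx2 : φ' (Extension.Cotangent.map F (cotangentEquivInfinitesimal (pres k A) x)) =
        φ' (Extension.Cotangent.map (F.comp (pres k A).toInfinitesimal) x) := by
      rw [Extension.Cotangent.map_comp]; rfl
    refine hx2.trans ?_
    rw [h2, LinearMap.add_apply, map_add]
    simp only [δ₁, LinearMap.add_apply, LinearMap.comp_apply]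
    congr 1
    rw [Extension.Cotangent.map_comp]
    refine Eq.trans ?_ (LinearMap.congr_fun hδ x).symm
    exact (LinearMap.congr_fun hφ (Extension.Cotangent.map (presHom Q) x)).symm
  refine ⟨φ'.comp (Q.toInfinitesimal.sub (F.comp u)) +
    δ₂.comp (Extension.CotangentSpace.map u), ?_⟩
  ext x
  rw [hφ, h1, LinearMap.comp_apply, LinearMap.add_apply, map_add]
  simp only [LinearMap.add_apply, LinearMap.comp_apply]
  congr 1
  rw [Extension.Cotangent.map_comp]
  refine (LinearMap.congr_fun h3 (Extension.Cotangent.map u x)).trans ?_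
  exact congrArg δ₂ (Extension.CotangentSpace.map_cotangentComplex u x).symm

variable (Q) [Algebra.FormallySmooth k Q.Ring]

lemma T1.ofExtension_surjective :
    Function.Surjective (T1.ofExtension Q : _ →ₗ[A] T1 k A M) :=
  T1.ofExtension_surjective_of_hom (toPresInfinitesimal Q)

lemma T1.ofExtension_eq_zero_iff (φ : Q.Cotangent →ₗ[A] M) :
    T1.ofExtension Q φ = 0 ↔ ∃ δ : Q.CotangentSpace →ₗ[A] M, φ = δ ∘ₗ Q.cotangentComplex :=
  T1.ofExtension_eq_zero_iff_of_hom (toPresInfinitesimal Q) φ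

end formallySmooth
end TangentCohomology

/-! ### Étale algebras lift along square-zero extensions -/

/-- An étale algebra lifts along a surjection with square-zero kernel: lift the equations of a
presentation with invertible Jacobian determinant. -/
lemma exists_etale_lift {E : Type u} {A A' : Type*} [CommRing E] [CommRing A] [CommRing A']
    [Algebra E A] [Algebra A A'] (hsurj : Function.Surjective (algebraMap E A))
    (hsq : RingHom.ker (algebraMap E A) ^ 2 = ⊥) [Algebra.Etale A A'] :
    ∃ (E' : Type u) (_ : CommRing E') (_ : Algebra E E') (π : E' →+* A'),
      Algebra.Etale E E' ∧ Function.Surjective π ∧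
      π.comp (algebraMap E E') = (algebraMap A A').comp (algebraMap E A) ∧
      RingHom.ker π = (RingHom.ker (algebraMap E A)).map (algebraMap E E') := by
  obtain ⟨ι, σ, _, _, P, hP⟩ :=
    (Algebra.Etale.iff_isStandardSmoothOfRelativeDimension_zero.1 ‹Algebra.Etale A A'›).out
  let : Algebra E A' := ((algebraMap A A').comp (algebraMap E A)).toAlgebra
  have : IsScalarTower E A A' := .of_algebraMap_eq' rfl
  -- the model of the presentation over `E` depends on a choice of lifts of the coefficients
  have : P.HasCoeffs E := ⟨fun x _ => hsurj x⟩
  let E' := P.ModelOfHasCoeffs E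
  let π : E' →+* A' := Ideal.Quotient.lift _
    (MvPolynomial.aeval P.val : MvPolynomial ι E →ₐ[E] A').toRingHom (by
      change Ideal.span _ ≤ RingHom.ker _
      rw [Ideal.span_le]
      rintro _ ⟨i, rfl⟩
      exact P.aeval_val_relationOfHasCoeffs E i)
  have hπ : ∀ y : MvPolynomial ι E, π (Ideal.Quotient.mk _ y) = MvPolynomial.aeval P.val y :=
    fun y => rfl
  have hmapsurj : Function.Surjective (MvPolynomial.map (σ := ι) (algebraMap E A)) :=
    MvPolynomial.map_surjective _ hsurj
  have hπ_surj : Function.Surjective π := by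
    intro x
    obtain ⟨y, rfl⟩ := P.aeval_val_surjective x
    obtain ⟨y, rfl⟩ := hmapsurj y
    exact ⟨Ideal.Quotient.mk _ y, by rw [hπ, MvPolynomial.aeval_map_algebraMap]⟩
  have hker : RingHom.ker π = (RingHom.ker (algebraMap E A)).map (algebraMap E E') := by
    refine le_antisymm (fun x hx => ?_) ?_
    · obtain ⟨y, rfl⟩ := Ideal.Quotient.mk_surjective x
      have hy : MvPolynomial.map (algebraMap E A) y ∈ P.ker := by
        rw [P.ker_eq_ker_aeval_val, RingHom.mem_ker, MvPolynomial.aeval_map_algebraMap]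
        exact hx
      rw [← P.span_range_relation_eq_ker] at hy
      have h1 : P.relation =
          fun i => MvPolynomial.map (algebraMap E A) (P.relationOfHasCoeffs E i) :=
        funext fun i => (P.map_relationOfHasCoeffs E i).symm
      have h2 : Ideal.span (Set.range P.relation) =
          (Ideal.span (Set.range (P.relationOfHasCoeffs E))).map
            (MvPolynomial.map (algebraMap E A)) := by
        rw [Ideal.map_span, h1, ← Set.range_comp]
        rfl
      rw [h2, Ideal.mem_map_iff_of_surjective _ hmapsurj] at hy
      obtain ⟨z, hz, hzy⟩ := hy
      have h3 : y - z ∈ RingHom.ker (MvPolynomial.map (σ := ι) (algebraMap E A)) := by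
        rw [RingHom.mem_ker, map_sub, hzy, sub_self]
      rw [MvPolynomial.ker_map] at h3
      have h4 := Ideal.mem_map_of_mem
        (Ideal.Quotient.mk (Ideal.span (Set.range (P.relationOfHasCoeffs E)))) h3
      rw [map_sub, Ideal.Quotient.eq_zero_iff_mem.2 hz, sub_zero, Ideal.map_map] at h4
      exact h4
    · rw [Ideal.map_le_iff_le_comap]
      intro x hx
      change π (Ideal.Quotient.mk _ (MvPolynomial.C x)) = 0
      rw [hπ, MvPolynomial.aeval_C, IsScalarTower.algebraMap_apply E A A', hx, map_zero]
  have hsq' : RingHom.ker π ^ 2 = ⊥ := by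
    rw [hker, ← Ideal.map_pow, hsq, Ideal.map_bot]
  refine ⟨E', inferInstance, inferInstance, π, ?_, hπ_surj, ?_, hker⟩
  · have hjac : IsUnit (P.toPreSubmersivePresentation.ofHasCoeffs E).jacobian := by
      -- `π` has a nilpotent kernel, so it reflects units
      suffices h : IsUnit (π (P.toPreSubmersivePresentation.ofHasCoeffs E).jacobian) by
        obtain ⟨y, hy⟩ := hπ_surj (h.unit⁻¹ : A'ˣ)
        refine isUnit_of_mul_isUnit_left (y := y) ?_
        have h1 : (P.toPreSubmersivePresentation.ofHasCoeffs E).jacobian * y - 1 ∈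
            RingHom.ker π := by
          rw [RingHom.mem_ker, map_sub, map_mul, hy, map_one, h.mul_val_inv, sub_self]
        have h2 : IsNilpotent ((P.toPreSubmersivePresentation.ofHasCoeffs E).jacobian * y - 1) :=
          ⟨2, by simpa [hsq'] using Ideal.pow_mem_pow h1 2⟩
        simpa using h2.isUnit_add_one
      have := P.jacobian_isUnit
      convert this
      classical
      let := Fintype.ofFinite σ
      rw [Algebra.PreSubmersivePresentation.jacobian_eq_jacobiMatrix_det,
        Algebra.PreSubmersivePresentation.jacobian_eq_jacobiMatrix_det]
      have h1 : ∀ y : MvPolynomial ι E, π (algebraMap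
          (P.toPreSubmersivePresentation.ofHasCoeffs E).Ring E' y) = MvPolynomial.aeval P.val y :=
        fun y => by
          rw [Algebra.Generators.algebraMap_eq]
          refine Eq.trans ?_ (hπ y)
          congr 1
          exact DFunLike.congr_fun (f := MvPolynomial.aeval _)
            (g := Ideal.Quotient.mkₐ E
              (Ideal.span (Set.range (P.relationOfHasCoeffs E)))) (by ext i; simp) y
      refine (h1 _).trans ?_
      rw [Algebra.Generators.algebraMap_eq]
      change _ = MvPolynomial.aeval (R := A) P.val _
      rw [← MvPolynomial.aeval_map_algebraMap (R := E) A (B := A') P.val, RingHom.map_det]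
      congr 2
      ext1 i j
      simp only [RingHom.mapMatrix_apply, Matrix.map_apply,
        Algebra.PreSubmersivePresentation.jacobiMatrix_apply, ← MvPolynomial.pderiv_map]
      congr 1
      exact P.map_relationOfHasCoeffs E j
    let Q : Algebra.SubmersivePresentation E E' ι σ :=
      { P.toPreSubmersivePresentation.ofHasCoeffs E with jacobian_isUnit := hjac }
    rw [Algebra.Etale.iff_isStandardSmoothOfRelativeDimension_zero]
    exact Q.isStandardSmoothOfRelativeDimension hP
  · ext x
    change π (Ideal.Quotient.mk _ (MvPolynomial.C x)) = _
    rw [hπ, MvPolynomial.aeval_C]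
    rfl

/-! ### `T¹` and étale homomorphisms -/

namespace TangentCohomology

open Algebra TensorProduct

section pullM

variable (k : Type u) {A : Type v} [CommRing k] [CommRing A] [Algebra k A]
  {B : Type*} [CommRing B] [Algebra k B] [Algebra A B] [IsScalarTower k A B]
  (M : Type*) [AddCommGroup M] [Module B M] [Module A M] [IsScalarTower A B M]

/-- The map `T¹(B/k, M) → T¹(A/k, M)` for an `A`-algebra `B` and a `B`-module `M`. -/
def T1.pullModule : T1 k B M →+ T1 k A M :=
  let h := ((Generators.self k A).defaultHom (Generators.self k B)).toExtensionHom
  QuotientAddGroup.lift _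
    ((T1.mk k (A := A) (M := M)).toAddMonoidHom.comp
      (AddMonoidHom.mk' (fun φ : (pres k B).Cotangent →ₗ[B] M =>
        (φ.restrictScalars A).comp (Extension.Cotangent.map h)) (fun _ _ => rfl)))
    (by
      rintro _ ⟨ψ, rfl⟩
      refine (Submodule.Quotient.mk_eq_zero _).2
        ⟨(ψ.restrictScalars A).comp (Extension.CotangentSpace.map h), ?_⟩
      ext x
      exact congrArg ψ (Extension.CotangentSpace.map_cotangentComplex h x))

lemma T1.pullModule_mk (φ : (pres k B).Cotangent →ₗ[B] M) (h : (pres k A).Hom (pres k B)) :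
    (T1.pullModule k M (T1.mk k φ) : T1 k A M) =
      T1.mk k ((φ.restrictScalars A).comp (Extension.Cotangent.map h)) :=
  T1.mk_comp_map_eq _ _ φ

variable {k M}

lemma T1.pullModule_ofExtension {P : Extension.{w} k A} {Q : Extension.{w} k B} (f : P.Hom Q)
    (φ : Q.Cotangent →ₗ[B] M) :
    (T1.pullModule k M (T1.ofExtension Q φ) : T1 k A M) =
      T1.ofExtension P ((φ.restrictScalars A).comp (Extension.Cotangent.map f)) := by
  let h := ((Generators.self k A).defaultHom (Generators.self k B)).toExtensionHom
  have := T1.mk_comp_map_eq ((presHom Q).comp h) (f.comp (presHom P)) φ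
  rw [Extension.Cotangent.map_comp, Extension.Cotangent.map_comp] at this
  exact this

lemma T1.pullModule_pullModule {C : Type*} [CommRing C] [Algebra k C] [Algebra A C] [Algebra B C]
    [IsScalarTower k A C] [IsScalarTower k B C] [IsScalarTower A B C] (M : Type*) [AddCommGroup M]
    [Module A M] [Module B M] [Module C M] [IsScalarTower A B M] [IsScalarTower B C M]
    [IsScalarTower A C M] (t : T1 k C M) :
    (T1.pullModule k M (T1.pullModule k M t : T1 k B M) : T1 k A M) = T1.pullModule k M t := by
  obtain ⟨φ, rfl⟩ := T1.mk_surjective k t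
  let h := ((Generators.self k A).defaultHom (Generators.self k B)).toExtensionHom
  let h' := ((Generators.self k B).defaultHom (Generators.self k C)).toExtensionHom
  rw [T1.pullModule_mk k M φ (h'.comp h), Extension.Cotangent.map_comp]
  rfl

lemma T1.push_pullModule {N : Type*} [AddCommGroup N] [Module B N] [Module A N]
    [IsScalarTower A B N] (g : M →ₗ[B] N) (t : T1 k B M) :
    T1.push k (g.restrictScalars A) (T1.pullModule k M t : T1 k A M) =
      T1.pullModule k N (T1.push k g t) := by
  obtain ⟨φ, rfl⟩ := T1.mk_surjective k t
  rfl

end pullM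

section etale

/-- Along a flat homomorphism of extensions, the base change of the kernel is the ideal generated by
it. -/
lemma bijective_liftBaseChange_mapKer {k A B : Type*} [CommRing k] [CommRing A] [Algebra k A]
    [CommRing B] [Algebra k B] [Algebra A B] {P : Extension.{w} k A} {Q : Extension.{w} k B}
    (f : P.Hom Q) [Algebra P.Ring Q.Ring] (halg : algebraMap P.Ring Q.Ring = f.toRingHom)
    [Module.Flat P.Ring Q.Ring] (hker : Q.ker = P.ker.map (algebraMap P.Ring Q.Ring)) :
    Function.Bijective ((f.mapKer halg).liftBaseChange Q.Ring) := by
  have h : Q.ker.subtype ∘ₗ (f.mapKer halg).liftBaseChange Q.Ring =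
      (Algebra.linearMap P.Ring Q.Ring ∘ₗ P.ker.subtype).liftBaseChange Q.Ring := by
    ext x
    simp [← halg]
  constructor
  · suffices h' : Function.Injective
        ((Algebra.linearMap P.Ring Q.Ring ∘ₗ P.ker.subtype).liftBaseChange Q.Ring) by
      rw [← h] at h'
      rw [LinearMap.coe_comp] at h'
      exact h'.of_comp
    have := Module.Flat.lTensor_preserves_injective_linearMap (M := Q.Ring) P.ker.subtype
      Subtype.val_injective
    have h2 : ((Algebra.linearMap P.Ring Q.Ring ∘ₗ P.ker.subtype).liftBaseChange Q.Ring) =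
      (Algebra.TensorProduct.rid P.Ring Q.Ring Q.Ring).toLinearMap ∘ₗ
        P.ker.subtype.baseChange Q.Ring := by
      ext x
      simp [Algebra.smul_def]
    rw [h2]
    exact (Algebra.TensorProduct.rid P.Ring Q.Ring Q.Ring).injective.comp this
  · intro ⟨x, hx⟩
    rw [hker] at hx
    suffices x ∈ LinearMap.range
        ((Algebra.linearMap P.Ring Q.Ring ∘ₗ P.ker.subtype).liftBaseChange Q.Ring) by
      obtain ⟨y, hy⟩ := this
      rw [← h] at hy
      exact ⟨y, Subtype.ext hy⟩
    refine (Ideal.span_le (I := LinearMap.range _)).2 ?_ hx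
    rintro _ ⟨y, hy, rfl⟩
    exact ⟨1 ⊗ₜ ⟨y, hy⟩, by simp⟩

variable {k A B : Type u} [CommRing k] [CommRing A] [Algebra k A]
  [CommRing B] [Algebra k B] [Algebra A B] [IsScalarTower k A B]
  {M : Type*} [AddCommGroup M] [Module B M] [Module A M] [IsScalarTower A B M]

/-- An étale algebra over `A` has an extension which is étale over `k[A]/I²`. -/
lemma exists_etale_extension [Algebra.Etale A B] :
    ∃ (Q : Extension.{u} k B) (f : (pres k A).infinitesimal.Hom Q),
      f.toRingHom.Etale ∧ Q.ker = ((pres k A).infinitesimal.ker).map f.toRingHom := by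
  let P := (pres k A).infinitesimal
  have hsq : RingHom.ker (algebraMap P.Ring A) ^ 2 = ⊥ := by
    change P.ker ^ 2 = ⊥
    rw [Extension.ker_infinitesimal]
    exact Ideal.cotangentIdeal_square _
  obtain ⟨E, _, _, π, hE, hπ, hπ', hker⟩ := exists_etale_lift (A' := B) P.algebraMap_surjective hsq
  let : Algebra k E := ((algebraMap P.Ring E).comp (algebraMap k P.Ring)).toAlgebra
  let π' : E →ₐ[k] B := { π with
    commutes' := fun r => by
      refine (RingHom.congr_fun hπ' (algebraMap k P.Ring r)).trans ?_
      simp [← IsScalarTower.algebraMap_apply] }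
  exact ⟨Extension.ofSurjective π' hπ, ⟨algebraMap P.Ring E, fun x => rfl,
    fun x => RingHom.congr_fun hπ' x⟩, (RingHom.etale_algebraMap (R := P.Ring) (S := E)).2 hE, hker⟩

/-- An extension of `B` which is étale over `k[A]/I²` maps to `k[B]/I²`, because étale algebras
lift along the square-zero extension `k[B]/I² → B`. -/
lemma nonempty_hom_presInfinitesimal {Q : Extension.{u} k B} (f : (pres k A).infinitesimal.Hom Q)
    (hf : f.toRingHom.Etale) : Nonempty (Q.Hom (pres k B).infinitesimal) := by
  let P := (pres k A).infinitesimal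
  let C := (pres k B).infinitesimal
  let h := (pres k B).toInfinitesimal.comp
    ((Generators.self k A).defaultHom (Generators.self k B)).toExtensionHom
  have hC : C.ker ^ 2 = ⊥ := by
    rw [Extension.ker_infinitesimal]
    exact Ideal.cotangentIdeal_square _
  let g : P.Ring →+* C.Ring := Ideal.Quotient.lift _ h.toRingHom fun a ha => by
    have h1 : (pres k A).ker ≤ C.ker.comap h.toRingHom := fun x hx => by
      rw [Ideal.mem_comap, RingHom.mem_ker, h.algebraMap_toRingHom,
        show algebraMap _ A x = 0 from hx, map_zero]
    have h2 := (Ideal.pow_right_mono h1 2).trans (Ideal.le_comap_pow _ 2) ha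
    rwa [hC] at h2
  have hg (x : P.Ring) : algebraMap C.Ring B (g x) = algebraMap A B (algebraMap P.Ring A x) := by
    obtain ⟨x, rfl⟩ := Ideal.Quotient.mk_surjective x
    exact h.algebraMap_toRingHom x
  let := f.toRingHom.toAlgebra
  have : Algebra.Etale P.Ring Q.Ring := hf
  let : Algebra P.Ring C.Ring := g.toAlgebra
  let : Algebra P.Ring B := ((algebraMap A B).comp (algebraMap P.Ring A)).toAlgebra
  have : IsScalarTower P.Ring Q.Ring B := .of_algebraMap_eq fun x => (f.algebraMap_toRingHom x).symm
  have : IsScalarTower P.Ring C.Ring B := .of_algebraMap_eq fun x => (hg x).symm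
  let v : Q.Ring →ₐ[P.Ring] C.Ring := FormallySmooth.liftOfSurjective
    (IsScalarTower.toAlgHom P.Ring Q.Ring B) (IsScalarTower.toAlgHom P.Ring C.Ring B)
    C.algebraMap_surjective ⟨2, hC⟩
  refine ⟨⟨v.toRingHom, fun x => ?_, fun x => ?_⟩⟩
  · have h1 : algebraMap k Q.Ring x = algebraMap P.Ring Q.Ring (algebraMap k P.Ring x) :=
      (f.toRingHom_algebraMap x).symm
    refine (congrArg v h1).trans ((v.commutes (algebraMap k P.Ring x)).trans ?_)
    exact h.toRingHom_algebraMap x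
  · exact FormallySmooth.liftOfSurjective_apply (IsScalarTower.toAlgHom P.Ring Q.Ring B)
      (IsScalarTower.toAlgHom P.Ring C.Ring B) C.algebraMap_surjective ⟨2, hC⟩ x

/-- For an étale `A`-algebra `B`, the map `T¹(B/k, M) → T¹(A/k, M)` is bijective: the cotangent
complex of an étale extension of `k[A]/I²` is the base change of that of `k[A]/I²`. -/
lemma T1.bijective_pullModule [Algebra.Etale A B] :
    Function.Bijective (T1.pullModule k M : T1 k B M →+ T1 k A M) := by
  obtain ⟨Q, f, hf, hker⟩ := exists_etale_extension (k := k) (A := A) (B := B)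
  let P := (pres k A).infinitesimal
  let := f.toRingHom.toAlgebra
  have : Algebra.Etale P.Ring Q.Ring := hf
  have hbij := bijective_liftBaseChange_mapKer f rfl hker
  let e := Extension.tensorCotangent f rfl hbij
  let e' := Extension.tensorCotangentSpaceOfFormallyEtale f
    (inferInstanceAs (Algebra.FormallyEtale P.Ring Q.Ring))
  have he (x : P.Cotangent) : e (1 ⊗ₜ x) = Extension.Cotangent.map f x := by
    change (Extension.Cotangent.map f).liftBaseChange B (1 ⊗ₜ x) = _
    simp
  have he' (x : P.CotangentSpace) : e' (1 ⊗ₜ x) = Extension.CotangentSpace.map f x := by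
    change (Extension.CotangentSpace.map f).liftBaseChange B (1 ⊗ₜ x) = _
    simp
  -- `Q` maps to `k[B]/I²` because it is étale over `k[A]/I²`
  obtain ⟨u⟩ := nonempty_hom_presInfinitesimal f hf
  constructor
  · rw [injective_iff_map_eq_zero]
    intro t ht
    obtain ⟨φ, rfl⟩ := T1.ofExtension_surjective_of_hom u t
    rw [T1.pullModule_ofExtension f] at ht
    obtain ⟨δ, hδ⟩ := (T1.ofExtension_eq_zero_iff_of_hom (.id _) _).1 ht
    refine (T1.ofExtension_eq_zero_iff_of_hom u _).2 ⟨δ.liftBaseChange B ∘ₗ e'.symm.toLinearMap, ?_⟩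
    have : φ ∘ₗ e.toLinearMap =
        ((δ.liftBaseChange B ∘ₗ e'.symm.toLinearMap) ∘ₗ Q.cotangentComplex) ∘ₗ e.toLinearMap := by
      ext x
      have := LinearMap.congr_fun hδ x
      have h1 : e'.symm (Q.cotangentComplex (e (1 ⊗ₜ x))) = 1 ⊗ₜ P.cotangentComplex x := by
        rw [LinearEquiv.symm_apply_eq, he, he', Extension.CotangentSpace.map_cotangentComplex]
      change φ (e (1 ⊗ₜ x)) = δ.liftBaseChange B (e'.symm (Q.cotangentComplex (e (1 ⊗ₜ x))))
      rw [h1, he]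
      simpa using this
    exact (LinearMap.cancel_right e.surjective).1 this
  · intro t
    obtain ⟨φ, rfl⟩ := T1.ofExtension_surjective_of_hom (.id _) t
    refine ⟨T1.ofExtension Q (φ.liftBaseChange B ∘ₗ e.symm.toLinearMap), ?_⟩
    rw [T1.pullModule_ofExtension f]
    congr 1
    ext x
    simp [← he]

end etale
end TangentCohomology

/-! ### Compatible classes along étale homomorphisms -/

namespace TangentCohomology

open Algebra TensorProduct

section compatible

variable {k A B C : Type u} [CommRing k] [CommRing A] [Algebra k A] [CommRing B] [Algebra k B]
  [CommRing C] [Algebra k C] {φ : A →ₐ[k] B} {ψ : B →ₐ[k] C}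

/-- Along an étale homomorphism, a class determines a compatible class. -/
lemma T1.Compatible.existsUnique (hφ : φ.toRingHom.Etale) (s : T1 k A A) :
    ∃! t : T1 k B B, T1.Compatible φ s t := by
  let := φ.toRingHom.toAlgebra
  have : IsScalarTower k A B := IsScalarTower.of_algebraMap_eq fun x => (φ.commutes x).symm
  have : Algebra.Etale A B := hφ
  obtain ⟨t, ht, h⟩ := (T1.bijective_pullModule (k := k) (A := A) (B := B) (M := B)).existsUnique
    (T1.push k (Algebra.linearMap A B) s)
  exact ⟨t, ht.symm, fun t' ht' => h t' ht'.symm⟩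

lemma T1.compatible_iff_of_comp {χ : A →ₐ[k] C} (hχ : χ = ψ.comp φ) {s : T1 k A A} {t : T1 k B B}
    (h : T1.Compatible φ s t) (r : T1 k C C) :
    letI := φ.toRingHom.toAlgebra
    letI := ψ.toRingHom.toAlgebra
    letI := χ.toRingHom.toAlgebra
    haveI : IsScalarTower k A B := IsScalarTower.of_algebraMap_eq fun x => (φ.commutes x).symm
    haveI : IsScalarTower k B C := IsScalarTower.of_algebraMap_eq fun x => (ψ.commutes x).symm
    haveI : IsScalarTower A B C := IsScalarTower.of_algebraMap_eq fun x => DFunLike.congr_fun hχ x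
    T1.Compatible χ s r ↔ (T1.pullModule k C (T1.push k (Algebra.linearMap B C) t) : T1 k A C) =
      T1.pullModule k C (T1.pullModule k C r : T1 k B C) := by
  let := φ.toRingHom.toAlgebra
  let := ψ.toRingHom.toAlgebra
  let := χ.toRingHom.toAlgebra
  have : IsScalarTower k A B := IsScalarTower.of_algebraMap_eq fun x => (φ.commutes x).symm
  have : IsScalarTower k B C := IsScalarTower.of_algebraMap_eq fun x => (ψ.commutes x).symm
  have : IsScalarTower k A C := IsScalarTower.of_algebraMap_eq fun x => (χ.commutes x).symm
  have : IsScalarTower A B C := IsScalarTower.of_algebraMap_eq fun x => DFunLike.congr_fun hχ x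
  have h1 : T1.push k (Algebra.linearMap A C) s =
      T1.push k ((Algebra.linearMap B C).restrictScalars A)
        (T1.push k (Algebra.linearMap A B) s) := by
    obtain ⟨s, rfl⟩ := T1.mk_surjective k s
    refine congrArg (T1.mk k) ?_
    ext x
    exact IsScalarTower.algebraMap_apply A B C _
  have h2 : T1.push k (Algebra.linearMap A B) s = T1.pullModule k B t := h
  rw [h2, T1.push_pullModule] at h1
  rw [T1.pullModule_pullModule, ← h1]
  rfl

lemma T1.Compatible.trans {χ : A →ₐ[k] C} (hχ : χ = ψ.comp φ) {s : T1 k A A} {t : T1 k B B}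
    {r : T1 k C C} (h : T1.Compatible φ s t) (h' : T1.Compatible ψ t r) :
    T1.Compatible χ s r := by
  rw [T1.compatible_iff_of_comp hχ h]
  exact congrArg _ h'

lemma T1.Compatible.cancel (hφ : φ.toRingHom.Etale) {χ : A →ₐ[k] C} (hχ : χ = ψ.comp φ)
    {s : T1 k A A} {t : T1 k B B} {r : T1 k C C} (h : T1.Compatible φ s t)
    (h' : T1.Compatible χ s r) : T1.Compatible ψ t r := by
  rw [T1.compatible_iff_of_comp hχ h] at h'
  let := φ.toRingHom.toAlgebra
  let := ψ.toRingHom.toAlgebra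
  let := χ.toRingHom.toAlgebra
  have : IsScalarTower k A B := IsScalarTower.of_algebraMap_eq fun x => (φ.commutes x).symm
  have : IsScalarTower k B C := IsScalarTower.of_algebraMap_eq fun x => (ψ.commutes x).symm
  have : IsScalarTower A B C := IsScalarTower.of_algebraMap_eq fun x => DFunLike.congr_fun hχ x
  have : Algebra.Etale A B := hφ
  exact T1.bijective_pullModule.1 h'

end compatible

/-! ### The class of a homomorphism on the conormal module -/

section ofNormal

variable {k A B : Type u} [CommRing k] [CommRing A] [Algebra k A] [CommRing B] [Algebra k B]
  (f : B →ₐ[k] A) (hf : Function.Surjective f) {I : Ideal B} (hI : RingHom.ker f = I)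

/-- A semilinear map on `I/I²`, for `I` the kernel of a surjection `f : B → A`, as a linear map on
the cotangent module of the extension `f`. -/
def cotangentHom (l : I.Cotangent →ₛₗ[f.toRingHom] A) :
    (Extension.ofSurjective f hf).Cotangent →ₗ[A] A :=
  let Q := Extension.ofSurjective f hf
  have hI' : Q.ker = I := hI
  let l₁ : Q.ker →ₗ[Q.Ring] A :=
    { toFun := fun x => l (I.toCotangent ⟨x.1, hI' ▸ x.2⟩)
      map_add' := fun x y => by rw [← map_add, ← map_add]; rfl
      map_smul' := fun (b : B) x =>
        (congrArg l (map_smul I.toCotangent b ⟨x.1, hI' ▸ x.2⟩)).trans (map_smulₛₗ l _ _) }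
  let l₂ : Q.ker.Cotangent →ₗ[Q.Ring] A := Ideal.Cotangent.lift l₁ fun x y => by
    have h : l₁ (x.1 • y) = x.1 • l₁ y := map_smul _ _ _
    refine h.trans ?_
    rw [Algebra.smul_def, show algebraMap Q.Ring A x.1 = 0 from x.2, zero_mul]
  { toFun := fun x => l₂ x.val
    map_add' := fun x y => map_add l₂ _ _
    map_smul' := fun a x => by
      rw [Extension.Cotangent.val_smul, map_smul, Extension.σ_smul]
      rfl }

lemma cotangentHom_mk (l : I.Cotangent →ₛₗ[f.toRingHom] A)
    (x : (Extension.ofSurjective f hf).ker) :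
    cotangentHom f hf hI l (.mk x) = l (I.toCotangent ⟨x.1, hI ▸ x.2⟩) := rfl

lemma cotangentHom_surjective : Function.Surjective (cotangentHom f hf hI) := by
  intro φ
  let Q := Extension.ofSurjective f hf
  have hI' : Q.ker = I := hI
  have key (b : Q.Ring) (x : Q.ker) : φ (.mk (b • x)) = algebraMap Q.Ring A b * φ (.mk x) := by
    rw [map_smul, ← algebraMap_smul A b, map_smul, smul_eq_mul]
  let : Algebra B A := f.toRingHom.toAlgebra
  let l₁ : I →ₗ[B] A :=
    { toFun := fun x => φ (.mk (P := Q) ⟨x.1, hI'.symm ▸ x.2⟩)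
      map_add' := fun x y => by rw [← map_add, ← map_add]; rfl
      map_smul' := fun b x => key b ⟨x.1, hI'.symm ▸ x.2⟩ }
  let l₂ : I.Cotangent →ₗ[B] A := Ideal.Cotangent.lift l₁ fun x y => by
    refine (key x.1 ⟨y.1, hI'.symm ▸ y.2⟩).trans ?_
    rw [show algebraMap Q.Ring A x.1 = 0 from hI'.symm ▸ x.2, zero_mul]
  refine ⟨⟨l₂.toAddHom, fun b x => map_smul l₂ b x⟩, ?_⟩
  ext x
  obtain ⟨x, rfl⟩ := Extension.Cotangent.mk_surjective x
  rfl

/-- The class in `T¹(A/k, A)` of a semilinear map `I/I² → A`, for `I` the kernel of a surjection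
`f : B → A` of `k`-algebras. -/
def T1.ofNormal : (I.Cotangent →ₛₗ[f.toRingHom] A) →ₗ[A] T1 k A A :=
  T1.ofExtension (Extension.ofSurjective f hf) ∘ₗ
    { toFun := cotangentHom f hf hI
      map_add' := fun l m => by
        ext x
        obtain ⟨x, rfl⟩ := Extension.Cotangent.mk_surjective x
        rfl
      map_smul' := fun a l => by
        ext x
        obtain ⟨x, rfl⟩ := Extension.Cotangent.mk_surjective x
        rfl }

lemma T1.ofNormal_surjective [Algebra.FormallySmooth k B] :
    Function.Surjective (T1.ofNormal f hf hI) := by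
  have : Algebra.FormallySmooth k (Extension.ofSurjective f hf).Ring :=
    inferInstanceAs (Algebra.FormallySmooth k B)
  exact (T1.ofExtension_surjective (Extension.ofSurjective f hf)).comp
    (cotangentHom_surjective f hf hI)

/-- `D : B → A` is a `k`-derivation, where `B` acts on `A` through `f : B → A`. -/
def IsDerivationAlong (D : B →ₗ[k] A) : Prop :=
  ∀ x y, D (x * y) = f x * D y + f y * D x

lemma T1.ofNormal_eq_zero_of_derivation {l : I.Cotangent →ₛₗ[f.toRingHom] A} {D : B →ₗ[k] A}
    (hD : IsDerivationAlong f D) (h : ∀ x : I, l (I.toCotangent x) = D x) :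
    T1.ofNormal f hf hI l = 0 := by
  let Q := Extension.ofSurjective f hf
  let D' : Derivation k Q.Ring A := Derivation.mk' D fun x y => by
    rw [Algebra.smul_def, Algebra.smul_def]
    exact hD x y
  have : cotangentHom f hf hI l = D'.liftKaehlerDifferential.liftBaseChange A ∘ₗ
      Q.cotangentComplex := by
    ext x
    obtain ⟨x, rfl⟩ := Extension.Cotangent.mk_surjective x
    rw [LinearMap.comp_apply, Extension.cotangentComplex_mk, LinearMap.liftBaseChange_tmul,
      Derivation.liftKaehlerDifferential_comp_D, one_smul, cotangentHom_mk, h]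
    rfl
  change T1.ofExtension Q (cotangentHom f hf hI l) = 0
  rw [this]
  exact T1.ofExtension_comp_cotangentComplex Q _

lemma T1.exists_derivation_of_ofNormal_eq_zero [Algebra.FormallySmooth k B]
    {l : I.Cotangent →ₛₗ[f.toRingHom] A} (hl : T1.ofNormal f hf hI l = 0) :
    ∃ D : B →ₗ[k] A, IsDerivationAlong f D ∧ ∀ x : I, l (I.toCotangent x) = D x := by
  let Q := Extension.ofSurjective f hf
  have : Algebra.FormallySmooth k Q.Ring := inferInstanceAs (Algebra.FormallySmooth k B)
  obtain ⟨δ, hδ⟩ := (T1.ofExtension_eq_zero_iff Q (cotangentHom f hf hI l)).1 hl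
  let D : Derivation k Q.Ring A :=
    ((δ.restrictScalars Q.Ring).comp (TensorProduct.mk Q.Ring A _ 1)).compDer
      (KaehlerDifferential.D k Q.Ring)
  refine ⟨D.toLinearMap, fun x y => ?_, fun x => ?_⟩
  · have h (b : Q.Ring) (c : A) : b • c = algebraMap Q.Ring A b * c := Algebra.smul_def b c
    exact (D.leibniz x y).trans (congrArg₂ (· + ·) (h x _) (h y _))
  · have := LinearMap.congr_fun hδ (.mk ⟨x.1, hI.symm ▸ x.2⟩)
    rw [cotangentHom_mk, LinearMap.comp_apply, Extension.cotangentComplex_mk] at this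
    exact this

/-- The formation of the class of `I/I² → A` is compatible with morphisms of presentations. -/
lemma T1.Compatible.ofNormal {A₁ B₁ : Type u} [CommRing A₁] [Algebra k A₁] [CommRing B₁]
    [Algebra k B₁] {f₁ : B₁ →ₐ[k] A₁} (hf₁ : Function.Surjective f₁) {I₁ : Ideal B₁}
    (hI₁ : RingHom.ker f₁ = I₁) {g : B →ₐ[k] B₁} {φ : A →ₐ[k] A₁} (hg : ∀ x, φ (f x) = f₁ (g x))
    {l : I.Cotangent →ₛₗ[f.toRingHom] A} {l₁ : I₁.Cotangent →ₛₗ[f₁.toRingHom] A₁}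
    (h : ∀ (x : I) (hx : g x ∈ I₁), l₁ (I₁.toCotangent ⟨g x, hx⟩) = φ (l (I.toCotangent x))) :
    T1.Compatible φ (T1.ofNormal f hf hI l) (T1.ofNormal f₁ hf₁ hI₁ l₁) := by
  let := φ.toRingHom.toAlgebra
  have : IsScalarTower k A A₁ := IsScalarTower.of_algebraMap_eq fun x => (φ.commutes x).symm
  let Q := Extension.ofSurjective f hf
  let Q₁ := Extension.ofSurjective f₁ hf₁
  let q : Q.Hom Q₁ := ⟨g.toRingHom, g.commutes, fun x => (hg x).symm⟩
  refine Eq.trans ?_ (T1.pullModule_ofExtension q (cotangentHom f₁ hf₁ hI₁ l₁)).symm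
  change T1.ofExtension Q (Algebra.linearMap A A₁ ∘ₗ cotangentHom f hf hI l) = _
  congr 1
  ext x
  obtain ⟨x, rfl⟩ := Extension.Cotangent.mk_surjective x
  have hx : g x.1 ∈ I₁ := (q.mapKer (alg := q.toRingHom.toAlgebra) rfl x).2 |> (hI₁ ▸ ·)
  refine Eq.trans ?_ (congrArg (cotangentHom f₁ hf₁ hI₁ l₁) (Extension.Cotangent.map_mk q x)).symm
  exact (h ⟨x.1, hI ▸ x.2⟩ hx).symm

end ofNormal
end TangentCohomology

/-! ### The polynomial `T₁ ⋯ T_l` and its Jacobian ideal -/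

namespace NormalCrossing

open MvPolynomial

section coordProd

variable (K : Type*) [Field K] (n l : ℕ)

/-- The product `T₁ ⋯ T_l` in `K[T₁, …, Tₙ]`. -/
def coordProd : MvPolynomial (Fin n) K := ∏ i : Fin n with i.val < l, X i

/-- The partial derivative `T₁ ⋯ T_l / T_i`, for `i ≤ l`. -/
def coordPartial (i : Fin n) : MvPolynomial (Fin n) K := ∏ j : Fin n with j.val < l ∧ j ≠ i, X j

/-- The ideal generated by the partial derivatives of `T₁ ⋯ T_l`. -/
def coordJacobian : Ideal (MvPolynomial (Fin n) K) :=
  Ideal.span (coordPartial K n l '' {i | i.val < l})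

variable {K n l}

lemma coordProd_eq_mul {i : Fin n} (hi : i.val < l) :
    coordProd K n l = X i * coordPartial K n l i := by
  rw [coordProd, coordPartial, ← Finset.mul_prod_erase _ _ (a := i) (by simpa using hi)]
  congr 2
  ext j
  simp [and_comm]

lemma coordPartial_mem {i : Fin n} (hi : i.val < l) : coordPartial K n l i ∈ coordJacobian K n l :=
  Ideal.subset_span ⟨i, hi, rfl⟩

lemma coordProd_mem_coordJacobian (h1 : 1 ≤ l) (hn : l ≤ n) :
    coordProd K n l ∈ coordJacobian K n l := by
  have h0 : 0 < n := by omega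
  rw [coordProd_eq_mul (i := ⟨0, h0⟩) h1]
  exact Ideal.mul_mem_left _ _ (coordPartial_mem h1)

lemma card_filter_lt (hn : l ≤ n) : (Finset.univ.filter fun i : Fin n => i.val < l).card = l := by
  rw [Fin.card_filter_val_lt, min_eq_right hn]

lemma prod_X_eq_monomial (s : Finset (Fin n)) :
    (∏ i ∈ s, X i : MvPolynomial (Fin n) K) = monomial (∑ i ∈ s, Finsupp.single i 1) 1 := by
  rw [monomial_sum_one]
  rfl

lemma coordProd_mem_pow (hn : l ≤ n) : coordProd K n l ∈ idealOfVars (Fin n) K ^ l := by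
  have h := Ideal.prod_mem_prod (s := Finset.univ.filter fun i : Fin n => i.val < l)
    (I := fun _ => idealOfVars (Fin n) K) (x := X) fun i _ => Ideal.subset_span ⟨i, rfl⟩
  rwa [Finset.prod_const, card_filter_lt hn] at h

lemma coordProd_notMem_pow (hn : l ≤ n) : coordProd K n l ∉ idealOfVars (Fin n) K ^ (l + 1) := by
  rw [coordProd, prod_X_eq_monomial, monomial_mem_pow_idealOfVars_iff _ _ one_ne_zero, map_sum]
  simp [Finsupp.degree_single, card_filter_lt hn]

lemma coordJacobian_le (h2 : 2 ≤ l) (hn : l ≤ n) : coordJacobian K n l ≤ idealOfVars (Fin n) K := by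
  refine Ideal.span_le.2 ?_
  rintro _ ⟨i, hi, rfl⟩
  obtain ⟨j, hj, hji⟩ : ∃ j : Fin n, j.val < l ∧ j ≠ i := by
    by_cases h : i.val = 0
    · exact ⟨⟨1, by omega⟩, by simp; omega, by simp [Fin.ext_iff, h]⟩
    · exact ⟨⟨0, by omega⟩, by simp; omega, by simp [Fin.ext_iff]; omega⟩
  refine Ideal.mem_of_dvd _ (Finset.dvd_prod_of_mem X (a := j) ?_) (Ideal.subset_span ⟨j, rfl⟩)
  simpa using ⟨hj, hji⟩

lemma derivation_prod {R : Type*} [CommRing R] {k : Type*} [CommRing k] [Algebra k R]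
    {M : Type*} [AddCommGroup M] [Module k M] [Module R M] (D : Derivation k R M)
    {ι : Type*} [DecidableEq ι] (s : Finset ι) (x : ι → R) :
    D (∏ i ∈ s, x i) = ∑ i ∈ s, (∏ j ∈ s.erase i, x j) • D (x i) := by
  induction s using Finset.induction_on with
  | empty => simp
  | insert a s ha ih =>
    rw [Finset.prod_insert ha, D.leibniz, ih, Finset.sum_insert ha, Finset.erase_insert ha,
      Finset.smul_sum, add_comm]
    congr 1
    refine Finset.sum_congr rfl fun i hi => ?_
    rw [Finset.erase_insert_of_ne (by rintro rfl; exact ha hi), Finset.prod_insert (by simp [ha]),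
      smul_smul]

/-- A derivation takes `T₁ ⋯ T_l` to a combination of the partial derivatives. -/
lemma derivation_coordProd {k : Type*} [CommRing k] [Algebra k K]
    {M : Type*} [AddCommGroup M] [Module k M] [Module (MvPolynomial (Fin n) K) M]
    (D : Derivation k (MvPolynomial (Fin n) K) M) :
    D (coordProd K n l) = ∑ i : Fin n with i.val < l, coordPartial K n l i • D (X i) := by
  rw [coordProd, derivation_prod]
  refine Finset.sum_congr rfl fun i hi => ?_
  congr 1
  rw [coordPartial]
  congr 1
  ext j
  simp [and_comm]

lemma pderiv_coordProd {i : Fin n} (hi : i.val < l) :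
    pderiv i (coordProd K n l) = coordPartial K n l i := by
  rw [derivation_coordProd (k := K), Finset.sum_eq_single_of_mem i (by simpa using hi)]
  · simp
  · intro j _ hj
    simp [pderiv_X_of_ne hj]

lemma sub_aeval_mem (i j : Fin n) (g : MvPolynomial (Fin n) K) :
    g - aeval (fun s => if s = i ∨ s = j then 0 else X s) g ∈
      Ideal.span (X '' {i, j} : Set (MvPolynomial (Fin n) K)) := by
  rw [← Ideal.Quotient.eq]
  refine DFunLike.congr_fun (f := Ideal.Quotient.mkₐ K _)
    (g := (Ideal.Quotient.mkₐ K _).comp (aeval _)) ?_ g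
  ext s
  simp only [AlgHom.comp_apply, aeval_X]
  refine Ideal.Quotient.eq.2 ?_
  split_ifs with h
  · rw [sub_zero]
    refine Ideal.subset_span ⟨s, by simpa using h, rfl⟩
  · simp

/-- The Jacobian ideal of `T₁ ⋯ T_l` is radical, with a bound on the orders: it is the
intersection of the prime ideals `(T_i, T_j)` for `i < j ≤ l`. -/
lemma mem_coordJacobian_sup_of_sq_mem (h1 : 1 ≤ l) (hn : l ≤ n) {t : ℕ} {g : MvPolynomial (Fin n) K}
    (hg : g ^ 2 ∈ coordJacobian K n l ⊔ idealOfVars (Fin n) K ^ (2 * t)) :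
    g ∈ coordJacobian K n l ⊔ idealOfVars (Fin n) K ^ t := by
  rw [g.as_sum]
  refine Ideal.sum_mem _ fun m hm => ?_
  rw [mem_support_iff] at hm
  by_cases hmt : t ≤ m.degree
  · exact Ideal.mem_sup_right ((monomial_mem_pow_idealOfVars_iff t m hm).2 hmt)
  refine Ideal.mem_sup_left ?_
  -- the ideal contains exactly the monomials divisible by some partial derivative
  by_cases h : ∃ i : Fin n, i.val < l ∧ ∀ j : Fin n, j.val < l ∧ j ≠ i → m j ≠ 0
  · obtain ⟨i, hi, h⟩ := h
    refine Ideal.mem_of_dvd _ ?_ (coordPartial_mem hi)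
    rw [coordPartial, prod_X_eq_monomial, monomial_dvd_monomial]
    refine ⟨Or.inr fun s => ?_, one_dvd _⟩
    rw [Finsupp.finsetSum_apply]
    simp only [Finsupp.single_apply, Finset.sum_ite_eq', Finset.mem_filter_univ]
    split_ifs with hs
    · exact Nat.one_le_iff_ne_zero.2 (h s hs)
    · exact Nat.zero_le _
  exfalso
  push Not at h
  obtain ⟨i, ⟨hi, -⟩, hmi⟩ := h ⟨0, by omega⟩ h1
  obtain ⟨j, ⟨hj, hji⟩, hmj⟩ := h i hi
  -- the monomial `m` survives in the quotient by `(T_i, T_j)`, where orders are additive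
  let ev : MvPolynomial (Fin n) K →ₐ[K] MvPolynomial (Fin n) K :=
    aeval (fun s => if s = i ∨ s = j then 0 else X s)
  have hcoeff : coeff m (ev g) ≠ 0 := by
    have h2 := mem_ideal_span_X_image.1 (sub_aeval_mem i j g) m
    rw [mem_support_iff] at h2
    contrapose! h2
    refine ⟨by rw [coeff_sub]; change _ - coeff m (ev g) ≠ 0; rwa [h2, sub_zero], ?_⟩
    simp [hmi, hmj]
  have hP : coordJacobian K n l ≤ RingHom.ker ev := by
    refine Ideal.span_le.2 ?_
    rintro _ ⟨r, hr, rfl⟩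
    obtain ⟨s, hs, hsr, h3⟩ : ∃ s : Fin n, (s = i ∨ s = j) ∧ s ≠ r ∧ s.val < l := by
      by_cases h : i = r
      · exact ⟨j, Or.inr rfl, h ▸ hji, hj⟩
      · exact ⟨i, Or.inl rfl, h, hi⟩
    refine Ideal.mem_of_dvd _ (Finset.dvd_prod_of_mem X (a := s) (by simpa using ⟨h3, hsr⟩)) ?_
    simp [ev, hs, RingHom.mem_ker]
  have hN : idealOfVars (Fin n) K ≤ (idealOfVars (Fin n) K).comap ev := by
    refine Ideal.span_le.2 ?_
    rintro _ ⟨s, rfl⟩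
    simp only [ev, SetLike.mem_coe, Ideal.mem_comap, aeval_X]
    split_ifs
    · exact zero_mem _
    · exact Ideal.subset_span ⟨s, rfl⟩
  have hsq : ev g ^ 2 ∈ idealOfVars (Fin n) K ^ (2 * t) := by
    rw [← map_pow]
    obtain ⟨p, hp, q, hq, hpq⟩ := Submodule.mem_sup.1 hg
    rw [← hpq, map_add, show ev p = 0 from hP hp, zero_add]
    exact (Ideal.pow_right_mono hN _).trans (Ideal.le_comap_pow _ _) hq
  rw [mem_pow_idealOfVars_iff'] at hsq
  have h5 : ((2 * t : ℕ) : ℕ∞) ≤ ((ev g : MvPowerSeries (Fin n) K) ^ 2).order := by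
    refine MvPowerSeries.nat_le_order fun d hd => ?_
    rw [← coe_pow, coeff_coe]
    exact hsq d hd
  have h6 : (ev g : MvPowerSeries (Fin n) K).order ≤ m.degree :=
    MvPowerSeries.order_le (by rwa [coeff_coe])
  rw [pow_two, MvPowerSeries.order_mul] at h5
  have h7 := h5.trans (add_le_add h6 h6)
  norm_cast at h7
  omega

end coordProd
end NormalCrossing

/-! ### Derivations into the residue field at a normal crossing point -/

namespace NormalCrossing

open MvPolynomial

section derivation

variable {k K B : Type*} [Field k] [Field K] [Algebra k K] [CommRing B] [Algebra k B] {n : ℕ}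
  {I : Ideal (MvPolynomial (Fin n) K)} {ψ : B →ₐ[k] MvPolynomial (Fin n) K ⧸ I}
  [Algebra B K]

/-- If `B` maps to `K[T]/I` over `K` and `∂/∂T_i` maps `I` to polynomials without constant term,
then `∂/∂T_i` at the origin induces a derivation `B → K`. -/
lemma exists_coordDerivation
    (hB : ∀ b g, ψ b = Ideal.Quotient.mk I g → algebraMap B K b = constantCoeff g) (i : Fin n)
    (hi : ∀ g ∈ I, constantCoeff (pderiv i g) = 0) :
    ∃ D : Derivation k B K,
      ∀ b g, ψ b = Ideal.Quotient.mk I g → D b = constantCoeff (pderiv i g) := by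
  have key (g g' : MvPolynomial (Fin n) K) (h : Ideal.Quotient.mk I g = Ideal.Quotient.mk I g') :
      constantCoeff (pderiv i g) = constantCoeff (pderiv i g') := by
    rw [← sub_eq_zero, ← map_sub, ← map_sub]
    exact hi _ (Ideal.Quotient.eq.1 h)
  choose r hr using fun b => Ideal.Quotient.mk_surjective (ψ b)
  refine ⟨Derivation.mk' ⟨⟨fun b => constantCoeff (pderiv i (r b)), ?_⟩, ?_⟩ ?_, ?_⟩
  · intro x y
    rw [← map_add, ← map_add]
    exact key _ _ (by rw [map_add, hr, hr, hr, map_add])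
  · intro c x
    change constantCoeff (pderiv i (r (c • x))) = c • constantCoeff (pderiv i (r x))
    rw [key (r (c • x)) (c • r x) (by
      rw [hr, map_smul, ← hr]
      exact (map_smul (Ideal.Quotient.mkₐ k I) c (r x)).symm)]
    rw [show pderiv i (c • r x) = c • pderiv i (r x) from
      (pderiv i).toLinearMap.map_smul_of_tower c (r x)]
    simp [constantCoeff_eq]
  · intro x y
    change constantCoeff (pderiv i (r (x * y))) = x • constantCoeff (pderiv i (r y)) +
      y • constantCoeff (pderiv i (r x))
    rw [key (r (x * y)) (r x * r y) (by rw [hr, map_mul, map_mul, hr, hr]), (pderiv i).leibniz,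
      Algebra.smul_def x (constantCoeff _), Algebra.smul_def y (constantCoeff _),
      hB x _ (hr x).symm, hB y _ (hr y).symm]
    simp
  · intro b g h
    exact key _ _ ((hr b).trans h)

/-- The derivations `B → K` form a vector space of dimension `n` if `Ω` is free of rank `n`. -/
lemma finrank_derivation [IsScalarTower k B K] (b : Module.Basis (Fin n) B (Ω[B⁄k])) :
    Module.Finite K (Derivation k B K) ∧ Module.finrank K (Derivation k B K) = n := by
  let e : Derivation k B K ≃ₗ[K] (Fin n → K) :=
    { toFun := fun D i => D.liftKaehlerDifferential (b i)
      map_add' := fun D D' => by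
        have : (D + D').liftKaehlerDifferential =
            D.liftKaehlerDifferential + D'.liftKaehlerDifferential := by ext; simp
        simp only [this]
        rfl
      map_smul' := fun c D => by
        have : (c • D).liftKaehlerDifferential = c • D.liftKaehlerDifferential := by ext; simp
        simp only [this]
        rfl
      invFun := fun v => (b.constr ℕ v).compDer (KaehlerDifferential.D k B)
      left_inv := fun D => by
        ext x
        have : b.constr ℕ (fun i => D.liftKaehlerDifferential (b i)) =
            D.liftKaehlerDifferential := b.ext fun i => by simp
        simp [this]
      right_inv := fun v => by
        ext i
        have : ((b.constr ℕ v).compDer (KaehlerDifferential.D k B)).liftKaehlerDifferential =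
            b.constr ℕ v := by ext; simp
        simp [this] }
  exact ⟨Module.Finite.equiv e.symm, by rw [e.finrank_eq]; simp⟩

variable (hψ : Function.Surjective ψ)
  (hB : ∀ b g, ψ b = Ideal.Quotient.mk I g → algebraMap B K b = constantCoeff g)
  (T : Finset (Fin n)) (hT : ∀ i ∈ T, ∀ g ∈ I, constantCoeff (pderiv i g) = 0)

include hψ hB hT in
/-- The derivations `∂/∂T_i`, for `i ∈ T`, form a dual basis to lifts of the coordinates `T_i`. -/
lemma exists_dual_derivations : ∃ (D : T → Derivation k B K) (s : T → B),
    (∀ i, ψ (s i) = Ideal.Quotient.mk I (X i)) ∧ (∀ i, algebraMap B K (s i) = 0) ∧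
    (∀ i j, D i (s j) = if i = j then 1 else 0) ∧ ∀ i b, ψ b = 0 → D i b = 0 := by
  choose D hD using fun i : T => exists_coordDerivation hB i.1 (hT i.1 i.2)
  choose s hs using fun i : T => hψ (Ideal.Quotient.mk I (X i.1))
  refine ⟨D, s, hs, fun i => ?_, fun i j => ?_, fun i b hb => ?_⟩
  · simpa using hB _ _ (hs i)
  · rw [hD i _ _ (hs j)]
    by_cases h : i = j
    · subst h
      simp
    · rw [pderiv_X_of_ne (fun h' => h (Subtype.ext h'.symm)), map_zero, if_neg h]
  · simpa using hD i b 0 (by simpa using hb)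

section dual

variable {T : Finset (Fin n)} {D : T → Derivation k B K} {s : T → B}
  (hs : ∀ i, algebraMap B K (s i) = 0) (hDs : ∀ i j, D i (s j) = if i = j then 1 else 0)

/-- The values of a derivation at the elements `s i`. -/
def evalDerivation (k K : Type*) [Field k] [Field K] [Algebra k K] {B : Type*} [CommRing B]
    [Algebra k B] [Algebra B K] {n : ℕ} {T : Finset (Fin n)} (s : T → B) :
    Derivation k B K →ₗ[K] (T → K) where
  toFun Z i := Z (s i)
  map_add' _ _ := rfl
  map_smul' _ _ := rfl

lemma sum_smul_derivation_apply (D : T → Derivation k B K) (v : T → K) (b : B) :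
    (∑ i, v i • D i) b = ∑ i, v i * D i b := by
  rw [← Derivation.coeFnAddMonoidHom_apply, map_sum, Finset.sum_apply]
  rfl

include hDs in
lemma evalDerivation_sub (Z : Derivation k B K) :
    evalDerivation k K s (Z - ∑ i, Z (s i) • D i) = 0 := by
  ext j
  change Z (s j) - (∑ i, Z (s i) • D i) (s j) = 0
  rw [sum_smul_derivation_apply]
  simp [hDs]

include hDs in
lemma evalDerivation_surjective : Function.Surjective (evalDerivation k K s) := by
  intro v
  refine ⟨∑ i, v i • D i, ?_⟩
  ext j
  change (∑ i, v i • D i) (s j) = v j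
  rw [sum_smul_derivation_apply]
  simp [hDs]

lemma derivation_apply_of_sum {b : B} (Z : Derivation k B K) (hD : ∀ i, D i b = 0)
    (h : (Z - ∑ i, Z (s i) • D i) b = 0) : Z b = 0 := by
  rw [Derivation.sub_apply, sum_smul_derivation_apply] at h
  simpa [hD] using h

include hDs in
lemma evalDerivation_injective [Module.Finite K (Derivation k B K)]
    (hn : Module.finrank K (Derivation k B K) = T.card) :
    Function.Injective (evalDerivation k K s) := by
  rw [LinearMap.injective_iff_surjective_of_finrank_eq_finrank (by simp [hn])]
  exact evalDerivation_surjective hDs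

include hDs in
lemma exists_smul_of_evalDerivation_eq_zero [Module.Finite K (Derivation k B K)]
    (hn : Module.finrank K (Derivation k B K) = T.card + 1) {Z₀ Z : Derivation k B K}
    (h₀ : Z₀ ≠ 0) (hZ₀ : evalDerivation k K s Z₀ = 0) (hZ : evalDerivation k K s Z = 0) :
    ∃ c : K, c • Z₀ = Z := by
  have h := LinearMap.finrank_range_add_finrank_ker (evalDerivation k K s)
  rw [LinearMap.range_eq_top.2 (evalDerivation_surjective hDs), finrank_top, hn] at h
  have h1 : Module.finrank K (LinearMap.ker (evalDerivation k K s)) = 1 := by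
    simp at h
    omega
  obtain ⟨c, hc⟩ := (finrank_eq_one_iff_of_nonzero' (⟨Z₀, hZ₀⟩ : LinearMap.ker _)
    (fun h => h₀ (congrArg Subtype.val h))).1 h1 ⟨Z, hZ⟩
  exact ⟨c, congrArg Subtype.val hc⟩

end dual

include hψ hB hT in
/-- At a point of multiplicity one with a residue field `K` which has no derivations over `k`,
some derivation into `K` does not kill the equation of the divisor. -/
lemma exists_derivation_of_one (hn : Module.finrank K (Derivation k B K) = T.card + 1)
    (hTI : idealOfVars (Fin n) K ≤ Ideal.span (X '' (T : Set (Fin n))) ⊔ I)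
    (h₀ : ∀ Z : Derivation k B K, (∀ b, algebraMap B K b = 0 → Z b = 0) → Z = 0) :
    ∃ (Z : Derivation k B K) (b : B), ψ b = 0 ∧ Z b ≠ 0 := by
  -- otherwise the derivations are determined by their values at lifts of the coordinates in `T`
  by_contra! hcon
  obtain ⟨D, s, hψs, hs, hDs, hD⟩ := exists_dual_derivations hψ hB T hT
  have hinj : Function.Injective (evalDerivation k K s) := by
    rw [injective_iff_map_eq_zero]
    intro Z hZ
    refine h₀ Z fun b hb => ?_
    obtain ⟨g, hg⟩ := Ideal.Quotient.mk_surjective (ψ b)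
    have hg' : g ∈ Ideal.span (X '' (T : Set (Fin n))) ⊔ I := by
      refine hTI ?_
      rw [← pow_one (idealOfVars (Fin n) K), mem_pow_idealOfVars_iff']
      intro x hx
      have : x = 0 := (Finsupp.degree_eq_zero_iff x).1 (by simpa using hx)
      rw [this, ← constantCoeff_eq, ← hB b g hg.symm, hb]
    have hb2 : b ∈ Ideal.span (Set.range s) ⊔ RingHom.ker ψ := by
      have h1 : Ideal.map ψ (Ideal.span (Set.range s)) =
          (Ideal.span (X '' (T : Set (Fin n)))).map (Ideal.Quotient.mk I) := by
        rw [Ideal.map_span, Ideal.map_span, ← Set.range_comp, ← Set.image_comp]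
        congr 1
        ext x
        simp [hψs]
      rw [← Ideal.comap_map_of_surjective' ψ hψ, Ideal.mem_comap, h1, ← hg]
      have h2 := Ideal.mem_map_of_mem (Ideal.Quotient.mk I) hg'
      rwa [Ideal.map_sup, Ideal.map_quotient_self, sup_bot_eq] at h2
    obtain ⟨x, hx, y, hy, rfl⟩ := Submodule.mem_sup.1 hb2
    rw [map_add, hcon Z y hy, add_zero]
    refine (Submodule.span_induction (p := fun x _ => algebraMap B K x = 0 ∧ Z x = 0)
      ?_ ?_ ?_ ?_ hx).2
    · rintro _ ⟨i, rfl⟩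
      exact ⟨hs i, congrFun hZ i⟩
    · simp
    · rintro x y - - ⟨hx, hx'⟩ ⟨hy, hy'⟩
      simp [hx, hx', hy, hy']
    · rintro c x - ⟨hx, hx'⟩
      simp [hx, hx', Algebra.smul_def]
  have := LinearMap.finrank_le_finrank_of_injective hinj
  simp [hn] at this

section dimension

variable [Module.Finite K (Derivation k B K)]

include hψ hB in
/-- At a point of multiplicity at least two all derivations into the residue field `K` kill the
equation of the divisor, and `K` has no derivations over `k`. -/
lemma derivation_of_two_le (hn : Module.finrank K (Derivation k B K) = n)
    (hT : ∀ i, ∀ g ∈ I, constantCoeff (pderiv i g) = 0) (Z : Derivation k B K) :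
    (∀ b, ψ b = 0 → Z b = 0) ∧ ((∀ b, algebraMap B K b = 0 → Z b = 0) → Z = 0) := by
  obtain ⟨D, s, -, hs, hDs, hD⟩ := exists_dual_derivations hψ hB Finset.univ fun i _ => hT i
  have hinj := evalDerivation_injective hDs (by simp [hn])
  constructor
  · intro b hb
    refine derivation_apply_of_sum (D := D) (s := s) Z (fun i => hD i b hb) ?_
    rw [hinj ((evalDerivation_sub hDs Z).trans (map_zero _).symm)]
    rfl
  · intro h
    refine hinj ?_
    rw [map_zero]
    ext i
    exact h _ (hs i)

include hψ hB hT in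
/-- At a point of multiplicity one with a residue field `K` which has a nonzero derivation over `k`,
all derivations into `K` kill the equation of the divisor. -/
lemma derivation_of_one_of_ne_zero (hn : Module.finrank K (Derivation k B K) = T.card + 1)
    {Z₀ : Derivation k B K} (h₀ : Z₀ ≠ 0) (hZ₀ : ∀ b, algebraMap B K b = 0 → Z₀ b = 0)
    (Z : Derivation k B K) {b : B} (hb : ψ b = 0) : Z b = 0 := by
  obtain ⟨D, s, -, hs, hDs, hD⟩ := exists_dual_derivations hψ hB T hT
  have h1 : evalDerivation k K s Z₀ = 0 := by
    ext i
    exact hZ₀ _ (hs i)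
  obtain ⟨c, hc⟩ := exists_smul_of_evalDerivation_eq_zero hDs hn h₀ h1 (evalDerivation_sub hDs Z)
  refine derivation_apply_of_sum (D := D) (s := s) Z (fun i => hD i b hb) ?_
  have hb' : algebraMap B K b = 0 := by simpa using hB b 0 (by simpa using hb)
  rw [← hc, Derivation.smul_apply, hZ₀ b hb', smul_zero]

end dimension

end derivation
end NormalCrossing

/-! ### Truncations of the complete local ring at a normal crossing point -/

namespace NormalCrossing

open MvPolynomial

section truncation

lemma mem_idealOfVars_iff {K : Type*} [Field K] {n : ℕ} {g : MvPolynomial (Fin n) K} :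
    g ∈ idealOfVars (Fin n) K ↔ constantCoeff g = 0 := by
  rw [← pow_one (idealOfVars (Fin n) K), mem_pow_idealOfVars_iff']
  refine ⟨fun h => h 0 (by simp), fun h x hx => ?_⟩
  rwa [(Finsupp.degree_eq_zero_iff x).1 (by simpa using hx)]

lemma idealOfVars_eq_ker (K : Type*) [Field K] (n : ℕ) :
    idealOfVars (Fin n) K = RingHom.ker (constantCoeff (R := K) (σ := Fin n)) :=
  Ideal.ext fun _ => mem_idealOfVars_iff

lemma isMaximal_idealOfVars (K : Type*) [Field K] (n : ℕ) : (idealOfVars (Fin n) K).IsMaximal := by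
  rw [idealOfVars_eq_ker]
  exact RingHom.ker_isMaximal_of_surjective _ fun x => ⟨C x, constantCoeff_C _ x⟩

/-- The ideal `(T₁ ⋯ T_l) + (T₁, …, Tₙ)ᴺ`. -/
def truncIdeal (K : Type*) [Field K] (n l N : ℕ) : Ideal (MvPolynomial (Fin n) K) :=
  Ideal.span {coordProd K n l} ⊔ idealOfVars (Fin n) K ^ N

variable {k K B : Type*} [Field k] [Field K] [Algebra k K] [CommRing B] [Algebra k B] {n l N : ℕ}
  {a : B} {M : Ideal B}

lemma truncIdeal_le (h1 : 1 ≤ l) (hn : l ≤ n) (hN : 1 ≤ N) :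
    truncIdeal K n l N ≤ idealOfVars (Fin n) K := by
  refine sup_le ?_ (Ideal.pow_le_self (by omega))
  rw [Ideal.span_singleton_le_iff_mem]
  exact Ideal.pow_le_self (by omega) (coordProd_mem_pow hn)

lemma truncIdeal_anti {N' : ℕ} (h : N' ≤ N) : truncIdeal K n l N ≤ truncIdeal K n l N' :=
  sup_le_sup le_rfl (Ideal.pow_le_pow_right h)

/-- A surjection `ψ` which identifies `B/(a, Mᴺ)` with `K[T₁, …, Tₙ]/(T₁ ⋯ T_l, (T₁, …, Tₙ)ᴺ)`. -/
structure IsTruncation (a : B) (M : Ideal B)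
    (ψ : B →ₐ[k] MvPolynomial (Fin n) K ⧸ truncIdeal K n l N) : Prop where
  surjective : Function.Surjective ψ
  ker_eq : RingHom.ker ψ = Ideal.span {a} ⊔ M ^ N

/-- If `m` is a nilpotent maximal ideal of `S`, then a surjection `R → S` maps every maximal ideal
containing the kernel onto `m`. -/
lemma map_eq_of_pow_eq_bot {R S : Type*} [CommRing R] [CommRing S] (f : R →+* S)
    (hf : Function.Surjective f) {M : Ideal R} [hM : M.IsMaximal] (hk : RingHom.ker f ≤ M)
    {m : Ideal S} [hm : m.IsMaximal] {N : ℕ} (hN : m ^ N = ⊥) : M.map f = m := by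
  have h1 : (M.map f).IsMaximal := by
    refine (Ideal.map_eq_top_or_isMaximal_of_surjective f hf hM).resolve_left fun h => hM.ne_top ?_
    have := Ideal.comap_map_of_surjective' f hf M
    rw [h, Ideal.comap_top, sup_eq_left.2 hk] at this
    exact this.symm
  refine (hm.eq_of_le h1.ne_top ?_).symm
  refine h1.isPrime.le_of_pow_le (n := N) ?_
  rw [hN]
  exact bot_le

variable [M.IsMaximal] {ψ : B →ₐ[k] MvPolynomial (Fin n) K ⧸ truncIdeal K n l N}

lemma isMaximal_map_mk (h1 : 1 ≤ l) (hn : l ≤ n) (hN : 1 ≤ N) :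
    ((idealOfVars (Fin n) K).map (Ideal.Quotient.mk (truncIdeal K n l N))).IsMaximal := by
  have := isMaximal_idealOfVars K n
  refine (Ideal.map_eq_top_or_isMaximal_of_surjective _ Ideal.Quotient.mk_surjective
    this).resolve_left fun h => this.ne_top ?_
  have h2 := Ideal.comap_map_of_surjective' (Ideal.Quotient.mk (truncIdeal K n l N))
    Ideal.Quotient.mk_surjective (idealOfVars (Fin n) K)
  rw [h, Ideal.comap_top, Ideal.mk_ker, sup_eq_left.2 (truncIdeal_le h1 hn hN)] at h2
  exact h2.symm

lemma IsTruncation.map_eq (h : IsTruncation a M ψ) (ha : a ∈ M) (h1 : 1 ≤ l) (hn : l ≤ n)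
    (hN : 1 ≤ N) :
    M.map (ψ : B →+* MvPolynomial (Fin n) K ⧸ truncIdeal K n l N) =
      (idealOfVars (Fin n) K).map (Ideal.Quotient.mk (truncIdeal K n l N)) := by
  have := isMaximal_map_mk (K := K) h1 hn hN
  refine map_eq_of_pow_eq_bot (ψ : B →+* MvPolynomial (Fin n) K ⧸ truncIdeal K n l N) h.surjective
    (N := N) ?_ ?_
  · refine h.ker_eq.trans_le (sup_le ?_ (Ideal.pow_le_self (by omega)))
    rwa [Ideal.span_singleton_le_iff_mem]
  · rw [← Ideal.map_pow, Ideal.map_eq_bot_iff_le_ker, Ideal.mk_ker]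
    exact le_sup_right

/-- Truncations can be truncated further. -/
lemma IsTruncation.factor (h : IsTruncation a M ψ) (ha : a ∈ M) (h1 : 1 ≤ l) (hn : l ≤ n)
    (hN : 1 ≤ N) {t : ℕ} (ht : t ≤ N) :
    IsTruncation a M ((Ideal.Quotient.factorₐ k (truncIdeal_anti ht)).comp ψ) := by
  constructor
  · exact (Ideal.Quotient.factor_surjective (truncIdeal_anti ht)).comp h.surjective
  · have h2 : (truncIdeal K n l t).map (Ideal.Quotient.mk (truncIdeal K n l N)) =
        (M ^ t).map (ψ : B →+* MvPolynomial (Fin n) K ⧸ truncIdeal K n l N) := by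
      rw [Ideal.map_pow, h.map_eq ha h1 hn hN, truncIdeal.eq_1 K n l t, Ideal.map_sup,
        ← Ideal.map_pow, sup_eq_right, Ideal.map_le_iff_le_comap, Ideal.span_singleton_le_iff_mem,
        Ideal.mem_comap]
      rw [show Ideal.Quotient.mk (truncIdeal K n l N) (coordProd K n l) = 0 from
        Ideal.Quotient.eq_zero_iff_mem.2 (Ideal.mem_sup_left (Ideal.mem_span_singleton_self _))]
      exact zero_mem _
    have h3 : RingHom.ker ((Ideal.Quotient.factorₐ k (truncIdeal_anti (K := K) (n := n) (l := l)
        ht)).comp ψ) = ((truncIdeal K n l t).map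
          (Ideal.Quotient.mk (truncIdeal K n l N))).comap
            (ψ : B →+* MvPolynomial (Fin n) K ⧸ truncIdeal K n l N) := by
      ext b
      rw [Ideal.mem_comap, RingHom.mem_ker, AlgHom.comp_apply]
      obtain ⟨g, hg⟩ := Ideal.Quotient.mk_surjective (ψ b)
      rw [RingHom.coe_coe, ← hg]
      refine Ideal.Quotient.eq_zero_iff_mem.trans ?_
      rw [← Ideal.mem_comap, Ideal.comap_map_of_surjective' _ Ideal.Quotient.mk_surjective,
        Ideal.mk_ker, sup_eq_left.2 (truncIdeal_anti ht)]
    have h4 := Ideal.comap_map_of_surjective'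
      (ψ : B →+* MvPolynomial (Fin n) K ⧸ truncIdeal K n l N) h.surjective (M ^ t)
    rw [h3, h2, h4, RingHom.ker_coe_toRingHom, h.ker_eq, sup_left_comm,
      sup_eq_left.2 (show M ^ N ≤ M ^ t from Ideal.pow_le_pow_right ht)]

/-- The residue field homomorphism given by a truncation. -/
def truncResidue (k K : Type*) [Field k] [Field K] [Algebra k K] {n l N : ℕ} (h1 : 1 ≤ l)
    (hn : l ≤ n) (hN : 1 ≤ N) : (MvPolynomial (Fin n) K ⧸ truncIdeal K n l N) →ₐ[k] K :=
  Ideal.Quotient.liftₐ _ ((aeval (R := K) (fun _ : Fin n => (0 : K))).restrictScalars k)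
    fun g hg => by
      have := mem_idealOfVars_iff.1 (truncIdeal_le h1 hn hN hg)
      rw [AlgHom.restrictScalars_apply, aeval_zero', this, map_zero]

lemma truncResidue_mk (h1 : 1 ≤ l) (hn : l ≤ n) (hN : 1 ≤ N) (g : MvPolynomial (Fin n) K) :
    truncResidue k K h1 hn hN (Ideal.Quotient.mk _ g) = constantCoeff g := by
  change aeval (fun _ => (0 : K)) g = _
  rw [aeval_zero']
  rfl

lemma truncResidue_surjective (h1 : 1 ≤ l) (hn : l ≤ n) (hN : 1 ≤ N) :
    Function.Surjective (truncResidue k K h1 hn hN) := fun x =>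
  ⟨Ideal.Quotient.mk _ (C x), by rw [truncResidue_mk, constantCoeff_C]⟩

lemma IsTruncation.ker_residue (h : IsTruncation a M ψ) (h1 : 1 ≤ l) (hn : l ≤ n) (hN : 1 ≤ N) :
    RingHom.ker ((truncResidue k K h1 hn hN).comp ψ) = M := by
  refine (Ideal.IsMaximal.eq_of_le ‹_› (RingHom.ker_ne_top _) fun b hb => ?_).symm
  rw [RingHom.mem_ker]
  refine pow_eq_zero_iff (n := N) (by omega) |>.1 ?_
  have : ψ (b ^ N) = 0 :=
    h.ker_eq.ge (Ideal.mem_sup_right (Ideal.pow_mem_pow hb N))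
  rw [← map_pow, AlgHom.comp_apply, this, map_zero]

end truncation

section étale

variable {k K : Type*} [Field k] [Field K] [Algebra k K]

/-- A field without derivations is formally étale over `k`. -/
lemma formallyEtale_of_derivation [Algebra.EssFiniteType k K]
    (h : ∀ Z : Derivation k K K, Z = 0) : Algebra.FormallyEtale k K := by
  rw [Algebra.FormallyEtale.iff_formallyUnramified_of_field]
  refine ⟨subsingleton_of_forall_eq 0 fun x => ?_⟩
  rw [← Module.forall_dual_apply_eq_zero_iff K]
  intro f
  obtain ⟨Z, rfl⟩ := (KaehlerDifferential.linearMapEquivDerivation k K).symm.surjective f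
  rw [h Z, map_zero, LinearMap.zero_apply]

lemma derivation_eq_zero_of_formallyEtale [Algebra.FormallyUnramified k K]
    (Z : Derivation k K K) : Z = 0 := by
  ext x
  rw [← Z.liftKaehlerDifferential_comp_D, Subsingleton.elim (KaehlerDifferential.D k K x) 0,
    map_zero, Derivation.zero_apply]

variable {B : Type*} [CommRing B] [Algebra k B] [Algebra B K] [IsScalarTower k B K]

/-- If `K` has no derivations over `k`, then every derivation `B → K` killing the kernel of the
surjection `B → K` vanishes. -/
lemma derivation_eq_zero_of_ker (hB : Function.Surjective (algebraMap B K))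
    (h : ∀ Z : Derivation k K K, Z = 0) (Z : Derivation k B K)
    (hZ : ∀ b, algebraMap B K b = 0 → Z b = 0) : Z = 0 := by
  choose r hr using hB
  have key (b c : B) (hbc : algebraMap B K b = algebraMap B K c) : Z b = Z c := by
    rw [← sub_eq_zero, ← map_sub]
    exact hZ _ (by rw [map_sub, hbc, sub_self])
  let Z' : Derivation k K K := Derivation.mk' ⟨⟨fun x => Z (r x), fun x y => by
      rw [← map_add]
      exact key _ _ (by simp [hr])⟩, fun c x => by
      change Z (r (c • x)) = c • Z (r x)
      rw [← Z.map_smul]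
      exact key _ _ (by rw [hr]; simp [Algebra.smul_def, ← IsScalarTower.algebraMap_apply, hr])⟩
    (fun x y => by
      change Z (r (x * y)) = x • Z (r y) + y • Z (r x)
      rw [key (r (x * y)) (r x * r y) (by simp [hr]), Z.leibniz, Algebra.smul_def, Algebra.smul_def,
        hr, hr, smul_eq_mul, smul_eq_mul])
  ext b
  exact (key b (r (algebraMap B K b)) (hr _).symm).trans
    (DFunLike.congr_fun (h Z') (algebraMap B K b))

/-- If the residue field `K` is formally étale over `k`, an element which is killed by all
derivations into `K` lies in the square of the maximal ideal. -/
lemma mem_sq_of_derivation [Algebra.FormallySmooth k K] (hB : Function.Surjective (algebraMap B K))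
    {M : Ideal B} (hM : RingHom.ker (algebraMap B K) = M) {a : B} (ha : a ∈ M)
    (h : ∀ Z : Derivation k B K, Z a = 0) : a ∈ M ^ 2 := by
  by_contra ha2
  subst hM
  set M := RingHom.ker (algebraMap B K) with hM
  -- a section of `B/M² → K`
  let p : (B ⧸ M ^ 2) →ₐ[k] K := Ideal.Quotient.liftₐ (M ^ 2) (IsScalarTower.toAlgHom k B K)
    fun x hx => Ideal.pow_le_self two_ne_zero hx
  have hp : Function.Surjective p := fun x => by
    obtain ⟨b, rfl⟩ := hB x
    exact ⟨Ideal.Quotient.mk _ b, rfl⟩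
  have hpn : IsNilpotent (RingHom.ker (p : (B ⧸ M ^ 2) →+* K)) := by
    have h1 : RingHom.ker (p : (B ⧸ M ^ 2) →+* K) = M.map (Ideal.Quotient.mk (M ^ 2)) := by
      refine le_antisymm (fun x hx => ?_) ?_
      · obtain ⟨b, rfl⟩ := Ideal.Quotient.mk_surjective x
        exact Ideal.mem_map_of_mem _ hx
      · rw [Ideal.map_le_iff_le_comap]
        exact fun b hb => hb
    refine ⟨2, ?_⟩
    rw [h1, ← Ideal.map_pow, Ideal.map_quotient_self]
    rfl
  let σ : K →ₐ[k] B ⧸ M ^ 2 := Algebra.FormallySmooth.liftOfSurjective (AlgHom.id k K) p hp hpn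
  have hσ (x : K) : p (σ x) = x := Algebra.FormallySmooth.liftOfSurjective_apply _ p hp hpn x
  choose r hr using fun b : B => Ideal.Quotient.mk_surjective (σ (algebraMap B K b))
  have hr' (b : B) : algebraMap B K (r b) = algebraMap B K b := by
    have := hσ (algebraMap B K b)
    rwa [← hr] at this
  have hrM (b : B) : b - r b ∈ M := by
    rw [hM, RingHom.mem_ker, map_sub, hr', sub_self]
  -- a functional on `M/M²` which does not vanish at `a`
  have : M.IsMaximal := RingHom.ker_isMaximal_of_surjective _ hB
  let := Ideal.Quotient.field M
  obtain ⟨f, hf⟩ : ∃ f : Module.Dual (B ⧸ M) M.Cotangent, f (M.toCotangent ⟨a, ha⟩) ≠ 0 := by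
    by_contra! hcon
    have h1 := (Module.forall_dual_apply_eq_zero_iff (B ⧸ M) _).1 hcon
    exact ha2 ((M.toCotangent_eq_zero ⟨a, ha⟩).1 h1)
  let e : B ⧸ M →+* K := Ideal.Quotient.lift M (algebraMap B K) fun _ hx => hx
  let L : M → K := fun m => e (f (M.toCotangent m))
  have hL (b : B) (m : M) : L (b • m) = algebraMap B K b * L m := by
    have h1 : f (M.toCotangent (b • m)) = Ideal.Quotient.mk M b * f (M.toCotangent m) := by
      rw [← smul_eq_mul, ← map_smul, map_smul]
      rfl
    change e _ = _
    rw [h1, map_mul]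
    rfl
  have hL_add (m m' : M) : L (m + m') = L m + L m' := by
    simp only [L, map_add]
  have hL2 (m m' : M) (hm : (m : B) - m' ∈ M ^ 2) : L m = L m' := by
    simp only [L]
    rw [(M.toCotangent_eq).2 hm]
  -- the section `σ` and the functional `f` give the derivation `b ↦ f(b - σ(b))`
  let Z : Derivation k B K := Derivation.mk' ⟨⟨fun b => L ⟨b - r b, hrM b⟩, fun x y => by
      rw [← hL_add]
      refine hL2 _ _ ?_
      rw [← Ideal.Quotient.eq]
      simp [hr, map_add, add_sub_add_comm]⟩, fun c x => by
      change L _ = c • L _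
      rw [← algebraMap_smul B c (L _), Algebra.smul_def (algebraMap k B c) (L _), ← hL]
      refine hL2 _ _ ?_
      rw [← Ideal.Quotient.eq]
      have h1 : algebraMap B K (c • x) = c • algebraMap B K x := by
        simp [Algebra.smul_def, ← IsScalarTower.algebraMap_apply]
      simp only [map_sub, hr, h1, map_smul, SetLike.val_smul, smul_eq_mul, map_mul]
      rw [Algebra.smul_def, Algebra.smul_def, map_mul, mul_sub]
      rfl⟩ (fun x y => by
      change L _ = x • L _ + y • L _
      rw [Algebra.smul_def, Algebra.smul_def, ← hr' x, ← hL, ← hL, ← hL_add]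
      refine hL2 _ _ ?_
      rw [← Ideal.Quotient.eq]
      simp only [map_sub, hr, map_mul, SetLike.val_smul, smul_eq_mul, Submodule.coe_add, map_add]
      ring)
  have hra : r a ∈ M ^ 2 := by
    rw [← Ideal.Quotient.eq_zero_iff_mem, hr, show algebraMap B K a = 0 from ha, map_zero]
  have hZ : Z a = L ⟨a, ha⟩ := hL2 _ _ (by simpa using hra)
  rw [h Z] at hZ
  exact hf ((map_eq_zero e).1 hZ.symm)

end étale
end NormalCrossing

/-! ### Lifting a truncation to the ambient smooth algebra -/

namespace NormalCrossing

open MvPolynomial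

/-- A ring homomorphism which is surjective modulo the nilpotent ideal generated by the image of an
ideal is surjective. -/
lemma surjective_of_map_pow_eq_bot {R S : Type*} [CommRing R] [CommRing S] (f : R →+* S)
    (I : Ideal R) {N : ℕ} (hN : I.map f ^ N = ⊥) (h : ∀ s, ∃ r, s - f r ∈ I.map f) :
    Function.Surjective f := by
  have key (j : ℕ) : ∀ s, ∃ r, s - f r ∈ I.map f ^ j := by
    induction j with
    | zero => exact fun s => ⟨0, by simp⟩
    | succ j ih =>
      have h1 : ∀ x ∈ (I ^ j).map f, ∃ r, x - f r ∈ I.map f ^ (j + 1) := by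
        intro x hx
        refine Submodule.span_induction (p := fun x _ => ∃ r, x - f r ∈ I.map f ^ (j + 1))
          ?_ ?_ ?_ ?_ hx
        · rintro _ ⟨r, -, rfl⟩
          exact ⟨r, by simp⟩
        · exact ⟨0, by simp⟩
        · rintro x y - - ⟨r, hr⟩ ⟨r', hr'⟩
          exact ⟨r + r', by rw [map_add, add_sub_add_comm]; exact add_mem hr hr'⟩
        · rintro c x hx ⟨r, hr⟩
          obtain ⟨b, hb⟩ := h c
          refine ⟨b * r, ?_⟩
          have hx' : x ∈ I.map f ^ j := by rw [← Ideal.map_pow]; exact hx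
          have h2 : c • x - f (b * r) = (c - f b) * x + f b * (x - f r) := by
            rw [map_mul, smul_eq_mul]
            ring
          rw [h2]
          refine add_mem ?_ (Ideal.mul_mem_left _ _ hr)
          rw [pow_succ']
          exact Ideal.mul_mem_mul hb hx'
      intro s
      obtain ⟨r, hr⟩ := ih s
      rw [← Ideal.map_pow] at hr
      obtain ⟨r', hr'⟩ := h1 _ hr
      exact ⟨r + r', by rwa [map_add, ← sub_sub]⟩
  intro s
  obtain ⟨r, hr⟩ := key N s
  rw [hN, Ideal.mem_bot, sub_eq_zero] at hr
  exact ⟨r, hr.symm⟩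

/-- Nakayama's lemma for a nilpotent ideal. -/
lemma le_of_le_sup_sq {R : Type*} [CommRing R] [IsNoetherianRing R] {I J : Ideal R} {N : ℕ}
    (hN : J ^ N = ⊥) (h : J ≤ I ⊔ J ^ 2) : J ≤ I := by
  refine Submodule.le_of_le_smul_of_le_jacobson_bot (I := J) (IsNoetherian.noetherian J) ?_ ?_
  · intro x hx
    have h1 : IsNilpotent x := ⟨N, by simpa [hN] using Ideal.pow_mem_pow hx N⟩
    exact Ideal.radical_le_jacobson (mem_nilradical.2 h1)
  · rwa [smul_eq_mul, ← pow_two]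

section lift

variable {k K B : Type*} [Field k] [Field K] [Algebra k K] [CommRing B] [Algebra k B] {n l N : ℕ}
  {a : B} {M : Ideal B} [M.IsMaximal]
  {ψ : B →ₐ[k] MvPolynomial (Fin n) K ⧸ truncIdeal K n l N}

/-- If `K` is formally étale over `k` and `a ∈ M²`, then a surjection `B → K[T]/(T)ᴺ` lifting a
truncation has kernel `Mᴺ`, because it has a section up to `Mᴺ`. -/
lemma ker_eq_pow_of_lift [IsNoetherianRing B] [Algebra.FormallyEtale k K]
    (h : IsTruncation a M ψ) (h1 : 1 ≤ l) (hn : l ≤ n) (hN : 2 ≤ N) (ha2 : a ∈ M ^ 2)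
    (φ : B →ₐ[k] MvPolynomial (Fin n) K ⧸ idealOfVars (Fin n) K ^ N)
    (hφψ : (Ideal.Quotient.factorₐ k (show idealOfVars (Fin n) K ^ N ≤ truncIdeal K n l N from
      le_sup_right)).comp φ = ψ) (hφ : Function.Surjective φ) :
    RingHom.ker φ = M ^ N := by
  have hN1 : 1 ≤ N := by omega
  let ρ := truncResidue k K h1 hn hN1
  have hker : RingHom.ker φ ≤ M ^ 2 := by
    intro b hb
    have : b ∈ RingHom.ker ψ := by
      rw [RingHom.mem_ker, ← hφψ, AlgHom.comp_apply, show φ b = 0 from hb, map_zero]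
    rw [h.ker_eq] at this
    exact (sup_le ((Ideal.span_singleton_le_iff_mem _).2 ha2) (Ideal.pow_le_pow_right hN) :
      Ideal.span {a} ⊔ M ^ N ≤ M ^ 2) this
  have hρ (b : B) (g : MvPolynomial (Fin n) K) (hbg : φ b = Ideal.Quotient.mk _ g) :
      ρ (ψ b) = constantCoeff g := by
    rw [← hφψ, AlgHom.comp_apply, hbg]
    exact truncResidue_mk h1 hn hN1 g
  have hρM (b : B) : b ∈ M ↔ ρ (ψ b) = 0 := by
    rw [← h.ker_residue h1 hn hN1]
    rfl
  have hMN : M ^ N ≤ RingHom.ker φ := by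
    have h3 : M.map (φ : B →+* MvPolynomial (Fin n) K ⧸ idealOfVars (Fin n) K ^ N) ≤
        (idealOfVars (Fin n) K).map (Ideal.Quotient.mk _) := by
      rw [Ideal.map_le_iff_le_comap]
      intro b hb
      obtain ⟨g, hg⟩ := Ideal.Quotient.mk_surjective (φ b)
      rw [Ideal.mem_comap, RingHom.coe_coe, ← hg]
      exact Ideal.mem_map_of_mem _
        (mem_idealOfVars_iff.2 (by rw [← hρ b g hg.symm, ← hρM]; exact hb))
    intro b hb
    have h4 := Ideal.mem_map_of_mem
      (φ : B →+* MvPolynomial (Fin n) K ⧸ idealOfVars (Fin n) K ^ N) hb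
    rw [Ideal.map_pow] at h4
    have h5 := Ideal.pow_right_mono h3 N h4
    rwa [← Ideal.map_pow, Ideal.map_quotient_self] at h5
  let Q := B ⧸ M ^ N
  let φ' : Q →ₐ[k] MvPolynomial (Fin n) K ⧸ idealOfVars (Fin n) K ^ N :=
    Ideal.Quotient.liftₐ (M ^ N) φ fun b hb => hMN hb
  have hφ' (b : B) : φ' (Ideal.Quotient.mk _ b) = φ b := rfl
  let p : Q →ₐ[k] K := ρ.comp ((Ideal.Quotient.factorₐ k
    (show idealOfVars (Fin n) K ^ N ≤ truncIdeal K n l N from le_sup_right)).comp φ')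
  have hp (b : B) : p (Ideal.Quotient.mk _ b) = ρ (ψ b) := by
    rw [← hφψ]
    rfl
  let MQ : Ideal Q := M.map (Ideal.Quotient.mk (M ^ N))
  have hMQ : MQ ^ N = ⊥ := by
    rw [← Ideal.map_pow, Ideal.map_quotient_self]
  have hpM : RingHom.ker (p : Q →+* K) = MQ := by
    refine le_antisymm (fun x hx => ?_) ?_
    · obtain ⟨b, rfl⟩ := Ideal.Quotient.mk_surjective x
      refine Ideal.mem_map_of_mem _ ((hρM b).2 ?_)
      rw [← hp]
      exact hx
    · rw [Ideal.map_le_iff_le_comap]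
      intro b hb
      rw [Ideal.mem_comap, RingHom.mem_ker, RingHom.coe_coe, hp, ← hρM]
      exact hb
  have hps : Function.Surjective p := fun x => by
    obtain ⟨b, hb⟩ := ((truncResidue_surjective (k := k) h1 hn hN1).comp h.surjective) x
    exact ⟨Ideal.Quotient.mk _ b, (hp b).trans hb⟩
  have hpn : IsNilpotent (RingHom.ker (p : Q →+* K)) := ⟨N, by rw [hpM]; exact hMQ⟩
  let σ : K →ₐ[k] Q := Algebra.FormallySmooth.liftOfSurjective (AlgHom.id k K) p hps hpn
  have hσ (x : K) : p (σ x) = x := Algebra.FormallySmooth.liftOfSurjective_apply _ p hps hpn x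
  -- by uniqueness of lifts, `σ` is compatible with the constants of `K[T]/(T)ᴺ`
  have hσφ : φ'.comp σ = IsScalarTower.toAlgHom k K
      (MvPolynomial (Fin n) K ⧸ idealOfVars (Fin n) K ^ N) := by
    refine Algebra.FormallyUnramified.lift_unique
      ((idealOfVars (Fin n) K).map (Ideal.Quotient.mk (idealOfVars (Fin n) K ^ N)))
      ⟨N, by rw [← Ideal.map_pow, Ideal.map_quotient_self]; rfl⟩ _ _ ?_
    ext x
    refine Ideal.Quotient.eq.2 ?_
    obtain ⟨b, hb⟩ := Ideal.Quotient.mk_surjective (σ x)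
    obtain ⟨g, hg⟩ := Ideal.Quotient.mk_surjective (φ b)
    change φ' (σ x) - Ideal.Quotient.mk _ (C x) ∈ _
    rw [← hb, hφ', ← hg, ← map_sub]
    refine Ideal.mem_map_of_mem _ (mem_idealOfVars_iff.2 ?_)
    rw [map_sub, constantCoeff_C, ← hρ b g hg.symm, ← hp, hb, hσ, sub_self]
  choose s hs using fun i : Fin n => hφ (Ideal.Quotient.mk _ (X i))
  -- `θ` is a section of `B/Mᴺ → K[T]/(T)ᴺ`, and it is surjective by Nakayama's lemma
  let θ : MvPolynomial (Fin n) K →+* Q := eval₂Hom σ.toRingHom fun i => Ideal.Quotient.mk _ (s i)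
  have hθ : φ'.toRingHom.comp θ = Ideal.Quotient.mk _ := by
    refine MvPolynomial.ringHom_ext (fun x => ?_) fun i => ?_
    · have := DFunLike.congr_fun hσφ x
      simp only [θ, RingHom.comp_apply, coe_eval₂Hom, eval₂_C]
      exact this
    · simp only [θ, RingHom.comp_apply, coe_eval₂Hom, eval₂_X]
      exact (hφ' _).trans (hs i)
  have hθn : (idealOfVars (Fin n) K).map θ = Ideal.span (Set.range fun i =>
      Ideal.Quotient.mk (M ^ N) (s i)) := by
    rw [Ideal.map_span, ← Set.range_comp]
    congr 2
    ext i
    simp [θ]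
  have hsM : (idealOfVars (Fin n) K).map θ = MQ := by
    refine le_antisymm ?_ ?_
    · rw [hθn, Ideal.span_le]
      rintro _ ⟨i, rfl⟩
      refine Ideal.mem_map_of_mem _ ((hρM _).2 ?_)
      rw [hρ _ _ (hs i), constantCoeff_X]
    · refine le_of_le_sup_sq hMQ ?_
      rw [Ideal.map_le_iff_le_comap]
      intro b hb
      have hb2 : b ∈ Ideal.span (Set.range s) ⊔ RingHom.ker φ := by
        have h3 : (Ideal.span (Set.range s)).map
            (φ : B →+* MvPolynomial (Fin n) K ⧸ idealOfVars (Fin n) K ^ N) =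
            (idealOfVars (Fin n) K).map (Ideal.Quotient.mk _) := by
          rw [Ideal.map_span, Ideal.map_span, ← Set.range_comp, ← Set.range_comp]
          congr 2
          ext i
          exact hs i
        rw [← RingHom.ker_coe_toRingHom, ← Ideal.comap_map_of_surjective' (φ : B →+*
          MvPolynomial (Fin n) K ⧸ idealOfVars (Fin n) K ^ N) hφ, Ideal.mem_comap, h3]
        obtain ⟨g, hg⟩ := Ideal.Quotient.mk_surjective (φ b)
        rw [RingHom.coe_coe, ← hg]
        exact Ideal.mem_map_of_mem _ (mem_idealOfVars_iff.2
          (by rw [← hρ b g hg.symm, ← hρM]; exact hb))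
      have hb3 := Ideal.mem_map_of_mem (Ideal.Quotient.mk (M ^ N)) hb2
      rw [Ideal.map_sup] at hb3
      have h3 : (Ideal.span (Set.range s)).map (Ideal.Quotient.mk (M ^ N)) =
          (idealOfVars (Fin n) K).map θ := by
        rw [hθn, Ideal.map_span, ← Set.range_comp]
        rfl
      have h4 : (RingHom.ker φ).map (Ideal.Quotient.mk (M ^ N)) ≤ MQ ^ 2 := by
        rw [← Ideal.map_pow]
        exact Ideal.map_mono hker
      rw [h3] at hb3
      exact sup_le_sup_left h4 _ hb3
  have hθs : Function.Surjective θ := by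
    refine surjective_of_map_pow_eq_bot θ (idealOfVars (Fin n) K) (by rw [hsM]; exact hMQ)
      fun q => ?_
    refine ⟨C (p q), ?_⟩
    rw [hsM, ← hpM, RingHom.mem_ker, map_sub, RingHom.coe_coe]
    simp only [θ, coe_eval₂Hom, eval₂_C]
    exact sub_eq_zero.2 (hσ (p q)).symm
  refine le_antisymm (fun b hb => ?_) hMN
  obtain ⟨g, hg⟩ := hθs (Ideal.Quotient.mk _ b)
  have h3 : Ideal.Quotient.mk (idealOfVars (Fin n) K ^ N) g = 0 := by
    rw [← hθ, RingHom.comp_apply, hg]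
    exact hb
  rw [Ideal.Quotient.eq_zero_iff_mem] at h3
  rw [← Ideal.Quotient.eq_zero_iff_mem, ← hg, ← Ideal.mem_bot, ← hMQ, ← hsM, ← Ideal.map_pow]
  exact Ideal.mem_map_of_mem _ h3

/-- At a point of multiplicity at least two, `B/Mᴺ` is identified with `K[T]/(T)ᴺ` in such a way
that `a` becomes a unit multiple of `T₁ ⋯ T_l`. -/
lemma IsTruncation.exists_lift [IsNoetherianRing B] [Algebra.FormallySmooth k B]
    [Algebra.FormallyEtale k K] (h : IsTruncation a M ψ) (h2 : 2 ≤ l) (hn : l ≤ n) (hN : l + 1 ≤ N)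
    (ha2 : a ∈ M ^ 2) :
    ∃ φ : B →ₐ[k] MvPolynomial (Fin n) K ⧸ idealOfVars (Fin n) K ^ N, Function.Surjective φ ∧
      RingHom.ker φ = M ^ N ∧
      M.map (φ : B →+* MvPolynomial (Fin n) K ⧸ idealOfVars (Fin n) K ^ N) =
        (idealOfVars (Fin n) K).map (Ideal.Quotient.mk _) ∧
      ∃ w, φ a = Ideal.Quotient.mk _ (w * coordProd K n l) ∧ constantCoeff w ≠ 0 := by
  have h1 : 1 ≤ l := by omega
  have hN1 : 1 ≤ N := by omega
  have ha : a ∈ M := Ideal.pow_le_self two_ne_zero ha2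
  set nv := idealOfVars (Fin n) K with hnv
  have hle : nv ^ N ≤ truncIdeal K n l N := le_sup_right
  let q : (MvPolynomial (Fin n) K ⧸ nv ^ N) →ₐ[k] (MvPolynomial (Fin n) K ⧸ truncIdeal K n l N) :=
    Ideal.Quotient.factorₐ k hle
  have hq : Function.Surjective q := Ideal.Quotient.factor_surjective hle
  have hqk (g : MvPolynomial (Fin n) K) (hg : q (Ideal.Quotient.mk _ g) = 0) :
      g ∈ truncIdeal K n l N := Ideal.Quotient.eq_zero_iff_mem.1 hg
  let m : Ideal (MvPolynomial (Fin n) K ⧸ nv ^ N) := nv.map (Ideal.Quotient.mk _)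
  have hm : m ^ N = ⊥ := by rw [← Ideal.map_pow, Ideal.map_quotient_self]
  have hqn : IsNilpotent (RingHom.ker
      (q : MvPolynomial (Fin n) K ⧸ nv ^ N →+* MvPolynomial (Fin n) K ⧸ truncIdeal K n l N)) := by
    refine ⟨N, ?_⟩
    rw [Ideal.zero_eq_bot, eq_bot_iff, ← hm]
    refine Ideal.pow_right_mono (fun x hx => ?_) N
    obtain ⟨g, rfl⟩ := Ideal.Quotient.mk_surjective x
    exact Ideal.mem_map_of_mem _ (truncIdeal_le h1 hn hN1 (hqk g hx))
  let φ := Algebra.FormallySmooth.liftOfSurjective ψ q hq hqn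
  have hφq (b : B) : q (φ b) = ψ b := Algebra.FormallySmooth.liftOfSurjective_apply ψ q hq hqn b
  have hφψ : q.comp φ = ψ := AlgHom.ext hφq
  -- the maximal ideal of `K[T]/(T)ᴺ` is generated by the image of `M`
  have hmM : m ≤ M.map (φ : B →+* MvPolynomial (Fin n) K ⧸ nv ^ N) := by
    refine le_of_le_sup_sq hm ?_
    rw [Ideal.map_le_iff_le_comap]
    intro g hg
    have h3 := Ideal.mem_map_of_mem (Ideal.Quotient.mk (truncIdeal K n l N)) hg
    rw [← h.map_eq ha h1 hn hN1,
      Ideal.mem_map_iff_of_surjective (ψ : B →+* MvPolynomial (Fin n) K ⧸ truncIdeal K n l N)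
        h.surjective] at h3
    obtain ⟨b, hb, hbg⟩ := h3
    obtain ⟨g', hg'⟩ := Ideal.Quotient.mk_surjective (φ b)
    have h4 : g - g' ∈ truncIdeal K n l N := by
      refine hqk _ ?_
      rw [map_sub, map_sub, hg', hφq]
      exact sub_eq_zero.2 hbg.symm
    rw [Ideal.mem_comap, show g = g' + (g - g') by ring, map_add, hg']
    refine add_mem (Ideal.mem_sup_left (Ideal.mem_map_of_mem _ hb)) (Ideal.mem_sup_right ?_)
    rw [← Ideal.map_pow]
    have h5 : truncIdeal K n l N ≤ nv ^ 2 := by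
      refine sup_le ?_ (Ideal.pow_le_pow_right (by omega))
      rw [Ideal.span_singleton_le_iff_mem]
      exact Ideal.pow_le_pow_right h2 (coordProd_mem_pow hn)
    exact Ideal.mem_map_of_mem _ (h5 h4)
  have hMm : M.map (φ : B →+* MvPolynomial (Fin n) K ⧸ nv ^ N) ≤ m := by
    rw [Ideal.map_le_iff_le_comap]
    intro b hb
    obtain ⟨g, hg⟩ := Ideal.Quotient.mk_surjective (φ b)
    rw [Ideal.mem_comap, RingHom.coe_coe, ← hg]
    refine Ideal.mem_map_of_mem _ (mem_idealOfVars_iff.2 ?_)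
    rw [← h.ker_residue h1 hn hN1, RingHom.mem_ker, AlgHom.comp_apply, ← hφq, ← hg] at hb
    rw [← hb]
    exact (truncResidue_mk (k := k) h1 hn hN1 g).symm
  have hφs : Function.Surjective φ := by
    refine surjective_of_map_pow_eq_bot (φ : B →+* MvPolynomial (Fin n) K ⧸ nv ^ N) M (N := N) ?_
      fun x => ?_
    · rw [eq_bot_iff, ← hm]
      exact Ideal.pow_right_mono hMm N
    · obtain ⟨b, hb⟩ := h.surjective (q x)
      obtain ⟨g, hg⟩ := Ideal.Quotient.mk_surjective (x - φ b)
      refine ⟨b, hmM ?_⟩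
      rw [RingHom.coe_coe, ← hg]
      refine Ideal.mem_map_of_mem _ (truncIdeal_le h1 hn hN1 (hqk _ ?_))
      rw [hg, map_sub, hφq, hb, sub_self]
  refine ⟨φ, hφs, ker_eq_pow_of_lift h h1 hn (by omega) ha2 φ hφψ hφs,
    le_antisymm hMm hmM, ?_⟩
  have hψa : ψ a = 0 := h.ker_eq.ge (Ideal.mem_sup_left (Ideal.mem_span_singleton_self a))
  obtain ⟨g, hg⟩ := Ideal.Quotient.mk_surjective (φ a)
  have hga : g ∈ truncIdeal K n l N := hqk g (by rw [hg, hφq, hψa])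
  obtain ⟨x, hx, y, hy, hxy⟩ := Submodule.mem_sup.1 hga
  obtain ⟨w, rfl⟩ := Ideal.mem_span_singleton'.1 hx
  have hwa : φ a = Ideal.Quotient.mk _ (w * coordProd K n l) := by
    rw [← hg, ← hxy, map_add, Ideal.Quotient.eq_zero_iff_mem.2 hy, add_zero]
  refine ⟨w, hwa, fun hw => ?_⟩
  -- `T₁ ⋯ T_l` is a multiple of the image of `a`, so `w` cannot lie in the maximal ideal
  obtain ⟨s, hs⟩ := hφs (Ideal.Quotient.mk _ (coordProd K n l))
  have hψs : s ∈ RingHom.ker ψ := by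
    rw [RingHom.mem_ker, ← hφq, hs]
    exact Ideal.Quotient.eq_zero_iff_mem.2
      (Ideal.mem_sup_left (Ideal.mem_span_singleton_self _))
  rw [h.ker_eq] at hψs
  obtain ⟨x', hx', y', hy', hxy'⟩ := Submodule.mem_sup.1 hψs
  obtain ⟨c, rfl⟩ := Ideal.mem_span_singleton'.1 hx'
  obtain ⟨c', hc'⟩ := Ideal.Quotient.mk_surjective (φ c)
  have hy0 : φ y' = 0 := by
    rw [← Ideal.mem_bot, ← hm]
    refine Ideal.pow_right_mono hMm N ?_
    rw [← Ideal.map_pow]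
    exact Ideal.mem_map_of_mem _ hy'
  rw [← hxy', map_add, hy0, add_zero, map_mul, hwa, ← hc', ← map_mul, Ideal.Quotient.eq] at hs
  refine coordProd_notMem_pow (K := K) hn ?_
  rw [← hnv]
  have h5 := Ideal.pow_le_pow_right hN hs
  have h6 : c' * (w * coordProd K n l) ∈ nv ^ (l + 1) := by
    rw [pow_succ']
    exact Ideal.mul_mem_left _ _ (Ideal.mul_mem_mul (mem_idealOfVars_iff.2 hw)
      (coordProd_mem_pow hn))
  have h7 := sub_mem h6 h5
  rwa [sub_sub_cancel] at h7

end lift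
end NormalCrossing

/-! ### The ideal generated by the derivatives of the equation -/

namespace NormalCrossing

open MvPolynomial

/-- The ideal generated by `a` and all `D a`, where `D` is a `k`-derivation of `B`. -/
def derivIdeal (k : Type*) {B : Type*} [CommRing k] [CommRing B] [Algebra k B] (a : B) : Ideal B :=
  Ideal.span {a} ⊔ Ideal.span (Set.range fun D : Derivation k B B => D a)

section derivIdeal

variable {k B : Type*} [CommRing k] [CommRing B] [Algebra k B] {a : B}

lemma self_mem_derivIdeal : a ∈ derivIdeal k a :=
  Ideal.mem_sup_left (Ideal.mem_span_singleton_self a)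

lemma derivation_mem_derivIdeal (D : Derivation k B B) : D a ∈ derivIdeal k a :=
  Ideal.mem_sup_right (Ideal.subset_span ⟨D, rfl⟩)

lemma mem_derivIdeal_iff {b : B} :
    b ∈ derivIdeal k a ↔ ∃ D : Derivation k B B, b - D a ∈ Ideal.span {a} := by
  have h : Ideal.span (Set.range fun D : Derivation k B B => D a) =
      LinearMap.range (⟨⟨fun D => D a, fun _ _ => rfl⟩, fun _ _ => rfl⟩ :
        Derivation k B B →ₗ[B] B) := by
    refine le_antisymm (Ideal.span_le.2 ?_) ?_
    · rintro _ ⟨D, rfl⟩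
      exact ⟨D, rfl⟩
    · rintro _ ⟨D, rfl⟩
      exact Ideal.subset_span ⟨D, rfl⟩
  rw [derivIdeal, h, Submodule.mem_sup]
  constructor
  · rintro ⟨x, hx, _, ⟨D, rfl⟩, rfl⟩
    exact ⟨D, by simpa using hx⟩
  · rintro ⟨D, hD⟩
    exact ⟨_, hD, _, ⟨D, rfl⟩, by simp⟩

/-- Derivations lift along surjections of modules if `Ω` is projective. -/
lemma exists_derivation_lift [Module.Projective B (Ω[B⁄k])] {M N : Type*} [AddCommGroup M]
    [Module B M] [Module k M] [IsScalarTower k B M] [AddCommGroup N] [Module B N] [Module k N]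
    [IsScalarTower k B N] (f : M →ₗ[B] N) (hf : Function.Surjective f) (d : Derivation k B N) :
    ∃ D : Derivation k B M, ∀ b, f (D b) = d b := by
  obtain ⟨h, hh⟩ := Module.projective_lifting_property f d.liftKaehlerDifferential hf
  refine ⟨h.compDer (KaehlerDifferential.D k B), fun b => ?_⟩
  exact (LinearMap.congr_fun hh _).trans (d.liftKaehlerDifferential_comp_D b)

end derivIdeal

section truncation

variable {k K B : Type*} [Field k] [Field K] [Algebra k K] [CommRing B] [Algebra k B] {n l N : ℕ}
  {a : B} {M : Ideal B}

lemma derivation_mem_of_mem_pow {R : Type*} [CommRing R] {k : Type*} [CommRing k] [Algebra k R]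
    (D : Derivation k R R) (I : Ideal R) {N : ℕ} {x : R} (hx : x ∈ I ^ N) : D x ∈ I ^ (N - 1) := by
  induction N generalizing x with
  | zero => simp
  | succ N ih =>
    rw [pow_succ] at hx
    refine Submodule.mul_induction_on hx (fun y hy z hz => ?_) fun y z hy hz => ?_
    · rw [D.leibniz, add_tsub_cancel_right]
      refine add_mem (Ideal.mul_mem_right _ _ hy) ?_
      cases N with
      | zero => simp
      | succ N =>
        rw [pow_succ', smul_eq_mul]
        exact Ideal.mul_mem_mul hz (ih hy)
    · rw [map_add]
      exact add_mem hy hz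

/-- Under an identification of `B/Mᴺ⁺¹` with `K[T]/(T)ᴺ⁺¹` which makes `a` a unit multiple of
`T₁ ⋯ T_l`, the ideal generated by `a` and its derivatives is identified with the Jacobian ideal of
`T₁ ⋯ T_l`; derivations lower the order by one, so one order of precision is lost. -/
lemma derivIdeal_sup_pow [Module.Projective B (Ω[B⁄k])] (h1 : 1 ≤ l) (hn : l ≤ n)
    {φ : B →ₐ[k] MvPolynomial (Fin n) K ⧸ idealOfVars (Fin n) K ^ (N + 1)}
    (hφ : Function.Surjective φ) (hker : RingHom.ker φ = M ^ (N + 1))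
    (hM : M.map (φ : B →+* MvPolynomial (Fin n) K ⧸ idealOfVars (Fin n) K ^ (N + 1)) =
      (idealOfVars (Fin n) K).map (Ideal.Quotient.mk _))
    {w : MvPolynomial (Fin n) K} (ha : φ a = Ideal.Quotient.mk _ (w * coordProd K n l))
    (hw : constantCoeff w ≠ 0) (b : B) (g : MvPolynomial (Fin n) K)
    (hbg : φ b = Ideal.Quotient.mk _ g) :
    b ∈ derivIdeal k a ⊔ M ^ N ↔ g ∈ coordJacobian K n l ⊔ idealOfVars (Fin n) K ^ N := by
  let nv := idealOfVars (Fin n) K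
  let S := MvPolynomial (Fin n) K ⧸ nv ^ N
  have hle : nv ^ (N + 1) ≤ nv ^ N := Ideal.pow_le_pow_right (by omega)
  let φ' : B →ₐ[k] S := (Ideal.Quotient.factorₐ k hle).comp φ
  have hφ' : Function.Surjective φ' := (Ideal.Quotient.factor_surjective hle).comp hφ
  have hφ'g (b : B) (g : MvPolynomial (Fin n) K) (h : φ b = Ideal.Quotient.mk _ g) :
      φ' b = Ideal.Quotient.mk _ g := by
    rw [AlgHom.comp_apply, h]
    rfl
  have hker' : RingHom.ker φ' = M ^ N := by
    have h3 : RingHom.ker φ' = ((nv ^ N).map (Ideal.Quotient.mk (nv ^ (N + 1)))).comap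
        (φ : B →+* MvPolynomial (Fin n) K ⧸ nv ^ (N + 1)) := by
      ext b
      obtain ⟨g, hg⟩ := Ideal.Quotient.mk_surjective (φ b)
      rw [RingHom.mem_ker, hφ'g b g hg.symm, Ideal.mem_comap, RingHom.coe_coe, ← hg,
        Ideal.Quotient.eq_zero_iff_mem, ← Ideal.mem_comap,
        Ideal.comap_map_of_surjective' _ Ideal.Quotient.mk_surjective, Ideal.mk_ker,
        sup_eq_left.2 hle]
    have h4 := Ideal.comap_map_of_surjective'
      (φ : B →+* MvPolynomial (Fin n) K ⧸ nv ^ (N + 1)) hφ (M ^ N)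
    rw [h3, Ideal.map_pow, ← hM, ← Ideal.map_pow, h4, RingHom.ker_coe_toRingHom, hker,
      sup_eq_left.2 (Ideal.pow_le_pow_right (by omega))]
  have hPF := coordProd_mem_coordJacobian (K := K) h1 hn
  have hgoal : g ∈ coordJacobian K n l ⊔ nv ^ N ↔
      φ' b ∈ (coordJacobian K n l).map (Ideal.Quotient.mk (nv ^ N)) := by
    rw [hφ'g b g hbg, ← Ideal.mem_comap,
      Ideal.comap_map_of_surjective' _ Ideal.Quotient.mk_surjective, Ideal.mk_ker]
  have hgoal' : b ∈ derivIdeal k a ⊔ M ^ N ↔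
      φ' b ∈ (derivIdeal k a).map (φ' : B →+* S) := by
    rw [← hker', ← RingHom.ker_coe_toRingHom, ← Ideal.comap_map_of_surjective' (φ' : B →+* S) hφ',
      Ideal.mem_comap]
    rfl
  rw [hgoal, hgoal']
  suffices h : (derivIdeal k a).map (φ' : B →+* S) =
      (coordJacobian K n l).map (Ideal.Quotient.mk (nv ^ N)) by rw [h]
  choose r hr using fun b => Ideal.Quotient.mk_surjective (φ b)
  choose s hs using fun g : MvPolynomial (Fin n) K => hφ (Ideal.Quotient.mk _ g)
  have ha' := hφ'g a _ ha
  refine le_antisymm ?_ ?_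
  · rw [derivIdeal, Ideal.map_sup, Ideal.map_span, Ideal.map_span]
    refine sup_le (Ideal.span_le.2 ?_) (Ideal.span_le.2 ?_)
    · rintro _ ⟨_, rfl, rfl⟩
      rw [SetLike.mem_coe, RingHom.coe_coe, ha']
      exact Ideal.mem_map_of_mem _ (Ideal.mul_mem_left _ _ hPF)
    · rintro _ ⟨_, ⟨D, rfl⟩, rfl⟩
      -- `D` induces a derivation from `K[T]` to `K[T]/(T)ᴺ`
      have key (b c : B) (h : φ b = φ c) : φ' (D b) = φ' (D c) := by
        rw [← sub_eq_zero, ← map_sub, ← map_sub]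
        have h3 : b - c ∈ M ^ (N + 1) := by
          rw [← hker, RingHom.mem_ker, map_sub, h, sub_self]
        exact hker'.ge (derivation_mem_of_mem_pow D M h3)
      let D' : Derivation k (MvPolynomial (Fin n) K) S :=
        Derivation.mk' ⟨⟨fun g => φ' (D (s g)), fun x y => by
            rw [← map_add, ← map_add]
            exact key _ _ (by simp only [hs, map_add])⟩, fun c x => by
            change φ' (D (s (c • x))) = c • φ' (D (s x))
            rw [← map_smul, ← D.map_smul]
            refine key _ _ ?_
            rw [hs, map_smul φ, hs]
            exact map_smul (Ideal.Quotient.mkₐ k _) c x⟩ (fun x y => by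
            change φ' (D (s (x * y))) = x • φ' (D (s y)) + y • φ' (D (s x))
            rw [key (s (x * y)) (s x * s y) (by simp only [hs, map_mul]), D.leibniz, map_add,
              smul_eq_mul, smul_eq_mul, map_mul, map_mul, hφ'g _ _ (hs x), hφ'g _ _ (hs y)]
            rfl)
      have h3 : φ' (D a) = D' (w * coordProd K n l) := key _ _ (by rw [hs, ha])
      rw [SetLike.mem_coe, RingHom.coe_coe, h3, D'.leibniz, derivation_coordProd]
      refine add_mem (Submodule.smul_of_tower_mem _ _ (Ideal.sum_mem _ fun i hi => ?_)) ?_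
      · exact Ideal.mul_mem_right _ _
          (Ideal.mem_map_of_mem _ (coordPartial_mem (by simpa using hi)))
      · exact Ideal.mul_mem_right _ _ (Ideal.mem_map_of_mem _ hPF)
  · have hwu : IsUnit (Ideal.Quotient.mk (nv ^ N) w) := by
      have h3 : Ideal.Quotient.mk (nv ^ N) (C (constantCoeff w)⁻¹ * w - 1) ∈
          nilradical (MvPolynomial (Fin n) K ⧸ nv ^ N) := by
        refine mem_nilradical.2 ⟨N, ?_⟩
        rw [← map_pow, Ideal.Quotient.eq_zero_iff_mem]
        refine Ideal.pow_mem_pow (mem_idealOfVars_iff.2 ?_) N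
        simp [hw]
      have h4 := (mem_nilradical.1 h3).isUnit_add_one
      rw [map_sub, map_one, sub_add_cancel, map_mul] at h4
      exact isUnit_of_mul_isUnit_right h4
    have hF : Ideal.Quotient.mk (nv ^ N) (coordProd K n l) ∈
        (derivIdeal k a).map (φ' : B →+* S) := by
      rw [← Ideal.unit_mul_mem_iff_mem _ hwu, ← map_mul, ← ha']
      exact Ideal.mem_map_of_mem _ self_mem_derivIdeal
    rw [Ideal.map_le_iff_le_comap, coordJacobian, Ideal.span_le]
    rintro _ ⟨i, hi, rfl⟩
    rw [SetLike.mem_coe, Ideal.mem_comap, ← Ideal.unit_mul_mem_iff_mem _ hwu]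
    let : Algebra B S := φ'.toRingHom.toAlgebra
    have : IsScalarTower k B S := .of_algebraMap_eq fun x => (φ'.commutes x).symm
    have key (x y : MvPolynomial (Fin n) K) (h : x - y ∈ nv ^ (N + 1)) :
        Ideal.Quotient.mk (nv ^ N) (pderiv i x) = Ideal.Quotient.mk (nv ^ N) (pderiv i y) := by
      rw [Ideal.Quotient.eq, ← map_sub]
      exact derivation_mem_of_mem_pow (pderiv i) nv h
    -- the derivation `∂/∂T_i`, with values in `K[T]/(T)ᴺ`
    let d : Derivation k B S := Derivation.mk'
      ⟨⟨fun b => Ideal.Quotient.mk (nv ^ N) (pderiv i (r b)),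
        fun x y => by
          rw [← map_add, ← map_add]
          exact key _ _ (Ideal.Quotient.eq.1 ((hr (x + y)).trans
            ((map_add φ x y).trans (congrArg₂ (· + ·) (hr x).symm (hr y).symm))))⟩, fun c x => by
        change Ideal.Quotient.mk (nv ^ N) (pderiv i (r (c • x))) =
          c • Ideal.Quotient.mk (nv ^ N) (pderiv i (r x))
        rw [key (r (c • x)) (c • r x) (by
          rw [← Ideal.Quotient.eq, hr, map_smul, ← hr]
          exact (map_smul (Ideal.Quotient.mkₐ k _) c (r x)).symm)]
        rw [show pderiv i (c • r x) = c • pderiv i (r x) from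
          (pderiv i).toLinearMap.map_smul_of_tower c (r x)]
        exact map_smul (Ideal.Quotient.mkₐ k (nv ^ N)) c _⟩ (fun x y => by
        change Ideal.Quotient.mk (nv ^ N) (pderiv i (r (x * y))) =
          φ' x * Ideal.Quotient.mk (nv ^ N) (pderiv i (r y)) +
            φ' y * Ideal.Quotient.mk (nv ^ N) (pderiv i (r x))
        rw [key (r (x * y)) (r x * r y) (Ideal.Quotient.eq.1 ((hr (x * y)).trans
            ((map_mul φ x y).trans (congrArg₂ (· * ·) (hr x).symm (hr y).symm)))),
          (pderiv i).leibniz, hφ'g x _ (hr x).symm, hφ'g y _ (hr y).symm, map_add,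
          smul_eq_mul, smul_eq_mul, map_mul, map_mul])
    obtain ⟨D, hD⟩ := exists_derivation_lift (Algebra.linearMap B S) hφ' d
    have h3 : φ' (D a) = Ideal.Quotient.mk _ (w * coordPartial K n l i) +
        Ideal.Quotient.mk _ (coordProd K n l * pderiv i w) := by
      refine (hD a).trans ?_
      refine (key (r a) (w * coordProd K n l) (by rw [← Ideal.Quotient.eq, hr, ha])).trans ?_
      rw [(pderiv i).leibniz, pderiv_coordProd hi, smul_eq_mul, smul_eq_mul, map_add]
    rw [← map_mul, ← sub_eq_iff_eq_add.2 h3]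
    refine sub_mem (Ideal.mem_map_of_mem (φ' : B →+* S) (derivation_mem_derivIdeal D)) ?_
    rw [map_mul]
    exact Ideal.mul_mem_right _ _ hF

end truncation
end NormalCrossing

/-! ### Derivatives of the equation at points of given multiplicity -/

namespace NormalCrossing

open MvPolynomial

/-- The maximal ideal `M` is a normal crossing point of multiplicity `l` of the divisor `a = 0`: all
quotients `B/(a, Mᴺ)` look like those at the origin of `T₁ ⋯ T_l = 0` in affine `n`-space over
a field `K`. -/
def IsCrossing (k : Type*) [Field k] {B : Type*} [CommRing B] [Algebra k B] (n l : ℕ) (a : B)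
    (M : Ideal B) : Prop :=
  1 ≤ l ∧ l ≤ n ∧ ∃ (K : Type u) (_ : Field K) (_ : Algebra k K), ∀ N,
    ∃ ψ : B →ₐ[k] MvPolynomial (Fin n) K ⧸ truncIdeal K n l N, IsTruncation a M ψ

section

variable {k K B : Type*} [Field k] [Field K] [Algebra k K] [CommRing B] [Algebra k B] {n l N : ℕ}
  {a : B} {M : Ideal B}

lemma constantCoeff_pderiv_of_mem_pow {g : MvPolynomial (Fin n) K}
    (hg : g ∈ idealOfVars (Fin n) K ^ 2) (i : Fin n) : constantCoeff (pderiv i g) = 0 := by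
  have := derivation_mem_of_mem_pow (pderiv i) _ hg
  rwa [pow_one, mem_idealOfVars_iff] at this

lemma coordProd_one (hn : 1 ≤ n) : coordProd K n 1 = X ⟨0, hn⟩ := by
  have h0 : (⟨0, hn⟩ : Fin n) ∈ Finset.univ.filter fun i : Fin n => i.val < 1 :=
    Finset.mem_filter.2 ⟨Finset.mem_univ _, one_pos⟩
  rw [coordProd, Finset.prod_eq_single ⟨0, hn⟩]
  · intro i hi h
    simp only [Finset.mem_filter, Finset.mem_univ, true_and, Nat.lt_one_iff] at hi
    exact absurd (Fin.ext hi) h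
  · exact fun h => absurd h0 h

lemma card_filter_val_ne_zero (hn : 1 ≤ n) :
    n = (Finset.univ.filter fun i : Fin n => i.val ≠ 0).card + 1 := by
  obtain ⟨m, rfl⟩ := Nat.exists_eq_add_of_le' hn
  have h : (Finset.univ.filter fun i : Fin (m + 1) => i.val ≠ 0) = Finset.univ.erase 0 := by
    ext i
    rw [Finset.mem_filter, Finset.mem_erase, ne_eq, ne_eq, Fin.ext_iff, and_comm, Fin.val_zero]
  rw [h, Finset.card_erase_of_mem (Finset.mem_univ _)]
  simp

lemma constantCoeff_pderiv_of_mem_truncIdeal (hn : 1 ≤ n) {i : Fin n} (hi : i.val ≠ 0)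
    {g : MvPolynomial (Fin n) K} (hg : g ∈ truncIdeal K n 1 2) :
    constantCoeff (pderiv i g) = 0 := by
  obtain ⟨x, hx, y, hy, rfl⟩ := Submodule.mem_sup.1 hg
  obtain ⟨c, rfl⟩ := Ideal.mem_span_singleton'.1 hx
  rw [map_add, map_add, constantCoeff_pderiv_of_mem_pow hy, add_zero, coordProd_one hn,
    (pderiv i).leibniz, pderiv_X_of_ne (by rintro rfl; exact hi rfl)]
  simp

lemma truncIdeal_le_sq (h2 : 2 ≤ l) (hn : l ≤ n) :
    truncIdeal K n l 2 ≤ idealOfVars (Fin n) K ^ 2 := by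
  refine sup_le ?_ le_rfl
  rw [Ideal.span_singleton_le_iff_mem]
  exact Ideal.pow_le_pow_right h2 (coordProd_mem_pow hn)

lemma constantCoeff_of_truncResidue (h1 : 1 ≤ l) (hn : l ≤ n) (hN : 1 ≤ N)
    (ψ : B →ₐ[k] MvPolynomial (Fin n) K ⧸ truncIdeal K n l N) (b : B) (g : MvPolynomial (Fin n) K)
    (h : ψ b = Ideal.Quotient.mk _ g) :
    (truncResidue k K h1 hn hN).comp ψ b = constantCoeff g := by
  rw [AlgHom.comp_apply, h, truncResidue_mk]

/-- At a point of multiplicity at least two, the residue field has no derivations over `k`, and all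
derivations into the residue field kill the equation. -/
lemma IsTruncation.derivation_of_two_le {ψ : B →ₐ[k] MvPolynomial (Fin n) K ⧸ truncIdeal K n l 2}
    (h : IsTruncation a M ψ) (h2 : 2 ≤ l) (hn : l ≤ n) (b : Module.Basis (Fin n) B (Ω[B⁄k]))
    [Algebra B K] [IsScalarTower k B K] (h1 : 1 ≤ l)
    (hB : ∀ b, algebraMap B K b = (truncResidue k K h1 hn one_le_two).comp ψ b) :
    (∀ Z : Derivation k K K, Z = 0) ∧ ∀ Z : Derivation k B K, Z a = 0 := by
  obtain ⟨hfin, hrank⟩ := finrank_derivation (K := K) b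
  have key := NormalCrossing.derivation_of_two_le h.surjective (fun b g hbg => (hB b).trans
    (constantCoeff_of_truncResidue h1 hn one_le_two ψ b g hbg)) hrank
    (fun i g hg => constantCoeff_pderiv_of_mem_pow (truncIdeal_le_sq h2 hn hg) i)
  refine ⟨fun Z => ?_, fun Z => (key Z).1 a
    (h.ker_eq.ge (Ideal.mem_sup_left (Ideal.mem_span_singleton_self a)))⟩
  have hs : Function.Surjective (algebraMap B K) := fun x => by
    obtain ⟨y, hy⟩ := ((truncResidue_surjective (k := k) h1 hn one_le_two).comp h.surjective) x
    exact ⟨y, (hB y).trans hy⟩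
  have h3 := (key (Z.compAlgebraMap B)).2 fun c hc => by
    rw [Derivation.compAlgebraMap_apply]
    exact (congrArg Z hc).trans (map_zero Z)
  ext x
  obtain ⟨c, rfl⟩ := hs x
  exact DFunLike.congr_fun h3 c

/-- At a point of multiplicity one whose residue field has no derivations over `k`, some derivation
into the residue field does not kill the equation. -/
lemma IsTruncation.exists_derivation_of_one
    {ψ : B →ₐ[k] MvPolynomial (Fin n) K ⧸ truncIdeal K n 1 2}
    [M.IsMaximal] (h : IsTruncation a M ψ) (ha : a ∈ M) (hn : 1 ≤ n)
    (b : Module.Basis (Fin n) B (Ω[B⁄k]))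
    [Algebra B K] [IsScalarTower k B K]
    (hB : ∀ b, algebraMap B K b = (truncResidue k K le_rfl hn one_le_two).comp ψ b)
    (hK : ∀ Z : Derivation k K K, Z = 0) : ∃ Z : Derivation k B K, Z a ≠ 0 := by
  obtain ⟨hfin, hrank⟩ := finrank_derivation (K := K) b
  have hs : Function.Surjective (algebraMap B K) := fun x => by
    obtain ⟨y, hy⟩ := ((truncResidue_surjective (k := k) le_rfl hn one_le_two).comp h.surjective) x
    exact ⟨y, (hB y).trans hy⟩
  have hM (x : B) (hx : x ∈ M) : algebraMap B K x = 0 := by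
    rw [hB]
    exact (h.ker_residue le_rfl hn one_le_two).ge hx
  obtain ⟨Z, x, hx, hZ⟩ := NormalCrossing.exists_derivation_of_one h.surjective
    (fun b g hbg => (hB b).trans (constantCoeff_of_truncResidue le_rfl hn one_le_two ψ b g hbg))
    (Finset.univ.filter fun i : Fin n => i.val ≠ 0)
    (fun i hi g hg => constantCoeff_pderiv_of_mem_truncIdeal hn (by simpa using hi) hg)
    (hrank.trans (card_filter_val_ne_zero hn))
    (by
      rw [idealOfVars, Ideal.span_le]
      rintro _ ⟨i, rfl⟩
      by_cases hi : i.val = 0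
      · refine Ideal.mem_sup_right (Ideal.mem_sup_left ?_)
        rw [coordProd_one hn, Ideal.mem_span_singleton']
        exact ⟨1, by rw [one_mul]; congr 1; exact Fin.ext hi.symm⟩
      · exact Ideal.mem_sup_left (Ideal.subset_span ⟨i, by simpa using hi, rfl⟩))
    (derivation_eq_zero_of_ker hs hK)
  refine ⟨Z, fun hZa => hZ ?_⟩
  obtain ⟨y, hy, z, hz, rfl⟩ := Submodule.mem_sup.1 (h.ker_eq.le hx)
  obtain ⟨c, rfl⟩ := Ideal.mem_span_singleton'.1 hy
  have hz' : Z z = 0 := by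
    rw [pow_two] at hz
    refine Submodule.mul_induction_on hz (fun s hs t ht => ?_) fun s t hs ht => ?_
    · rw [Z.leibniz, Algebra.smul_def, Algebra.smul_def, hM s hs, hM t ht]
      ring
    · rw [map_add, hs, ht, add_zero]
  rw [map_add, hz', Z.leibniz, hZa, Algebra.smul_def a, hM a ha]
  simp

/-- At a point of multiplicity one whose residue field has a nonzero derivation over `k`, all
derivations into the residue field kill the equation. -/
lemma IsTruncation.derivation_of_one
    {ψ : B →ₐ[k] MvPolynomial (Fin n) K ⧸ truncIdeal K n 1 2}
    (h : IsTruncation a M ψ) (hn : 1 ≤ n) (b : Module.Basis (Fin n) B (Ω[B⁄k]))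
    [Algebra B K] [IsScalarTower k B K]
    (hB : ∀ b, algebraMap B K b = (truncResidue k K le_rfl hn one_le_two).comp ψ b)
    {Z₀ : Derivation k K K} (hZ₀ : Z₀ ≠ 0) (Z : Derivation k B K) : Z a = 0 := by
  obtain ⟨hfin, hrank⟩ := finrank_derivation (K := K) b
  have hs : Function.Surjective (algebraMap B K) := fun x => by
    obtain ⟨y, hy⟩ := ((truncResidue_surjective (k := k) le_rfl hn one_le_two).comp h.surjective) x
    exact ⟨y, (hB y).trans hy⟩
  refine derivation_of_one_of_ne_zero h.surjective
    (fun b g hbg => (hB b).trans (constantCoeff_of_truncResidue le_rfl hn one_le_two ψ b g hbg))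
    (Finset.univ.filter fun i : Fin n => i.val ≠ 0)
    (fun i hi g hg => constantCoeff_pderiv_of_mem_truncIdeal hn (by simpa using hi) hg)
    (hrank.trans (card_filter_val_ne_zero hn)) (Z₀ := Z₀.compAlgebraMap B)
    (fun h0 => hZ₀ ?_) (fun c hc => ?_) Z
    (h.ker_eq.ge (Ideal.mem_sup_left (Ideal.mem_span_singleton_self a)))
  · ext x
    obtain ⟨c, rfl⟩ := hs x
    exact DFunLike.congr_fun h0 c
  · rw [Derivation.compAlgebraMap_apply]
    exact (congrArg Z₀ hc).trans (map_zero Z₀)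

end

section

variable {k B : Type*} [Field k] [CommRing B] [Algebra k B] {n l : ℕ} {a : B} {M : Ideal B}

lemma IsTruncation.exists_algEquiv [M.IsMaximal] {K : Type*} [Field K] [Algebra k K] {N : ℕ}
    {ψ : B →ₐ[k] MvPolynomial (Fin n) K ⧸ truncIdeal K n l N} (h : IsTruncation a M ψ)
    (h1 : 1 ≤ l) (hn : l ≤ n) (hN : 1 ≤ N) :
    ∃ e : (B ⧸ M) ≃ₐ[k] K, ∀ b, e (Ideal.Quotient.mk M b) =
      (truncResidue k K h1 hn hN).comp ψ b :=
  ⟨(Ideal.quotientEquivAlgOfEq k (h.ker_residue h1 hn hN).symm).trans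
    (Ideal.quotientKerAlgEquivOfSurjective
      ((truncResidue_surjective (k := k) h1 hn hN).comp h.surjective)), fun _ => rfl⟩

lemma formallyEtale_of_algEquiv_of_derivation [Algebra.FiniteType k B] {K : Type*} [Field K]
    [Algebra k K] (e : (B ⧸ M) ≃ₐ[k] K) (h : ∀ Z : Derivation k K K, Z = 0) :
    Algebra.FormallyEtale k (B ⧸ M) := by
  have := Algebra.FiniteType.equiv (inferInstanceAs (Algebra.FiniteType k (B ⧸ M))) e
  have := formallyEtale_of_derivation h
  exact Algebra.FormallyEtale.of_equiv e.symm

variable [M.IsMaximal]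

/-- At a point of multiplicity at least two, the residue field is étale over `k`, and all
derivations into it kill the equation. -/
lemma IsCrossing.of_two_le [Algebra.FiniteType k B] (h : IsCrossing.{u} k n l a M)
    (h2 : 2 ≤ l) (b : Module.Basis (Fin n) B (Ω[B⁄k])) :
    Algebra.FormallyEtale k (B ⧸ M) ∧ ∀ Z : Derivation k B (B ⧸ M), Z a = 0 := by
  obtain ⟨h1, hn, K, _, _, h⟩ := h
  obtain ⟨ψ, hψ⟩ := h 2
  obtain ⟨e, he⟩ := hψ.exists_algEquiv h1 hn one_le_two
  let ρ := (truncResidue k K h1 hn one_le_two).comp ψ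
  let := ρ.toRingHom.toAlgebra
  have : IsScalarTower k B K := .of_algebraMap_eq fun x => (ρ.commutes x).symm
  obtain ⟨h3, h4⟩ := hψ.derivation_of_two_le h2 hn b h1 fun _ => rfl
  refine ⟨formallyEtale_of_algEquiv_of_derivation e h3, fun Z => ?_⟩
  let E : (B ⧸ M) →ₗ[B] K := ⟨⟨e, map_add e⟩, fun c x => by
    change e (c • x) = ρ c * e x
    rw [Algebra.smul_def, map_mul, ← he]
    rfl⟩
  exact e.injective ((h4 (E.compDer Z)).trans (map_zero e).symm)

/-- At a normal crossing point, the residue field is étale over `k` if some derivation into it does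
not kill the equation. -/
lemma IsCrossing.formallyEtale_of_derivation_ne_zero [Algebra.FiniteType k B]
    (h : IsCrossing.{u} k n l a M) (b : Module.Basis (Fin n) B (Ω[B⁄k]))
    {Z : Derivation k B (B ⧸ M)} (hZ : Z a ≠ 0) : Algebra.FormallyEtale k (B ⧸ M) := by
  by_cases h2 : 2 ≤ l
  · exact (h.of_two_le h2 b).1
  obtain ⟨h1, hn, K, _, _, h⟩ := h
  obtain rfl : l = 1 := by omega
  obtain ⟨ψ, hψ⟩ := h 2
  obtain ⟨e, he⟩ := hψ.exists_algEquiv h1 hn one_le_two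
  let ρ := (truncResidue k K h1 hn one_le_two).comp ψ
  let := ρ.toRingHom.toAlgebra
  have : IsScalarTower k B K := .of_algebraMap_eq fun x => (ρ.commutes x).symm
  refine formallyEtale_of_algEquiv_of_derivation e fun Z₀ => ?_
  by_contra hZ₀
  let E : (B ⧸ M) →ₗ[B] K := ⟨⟨e, map_add e⟩, fun c x => by
    change e (c • x) = ρ c * e x
    rw [Algebra.smul_def, map_mul, ← he]
    rfl⟩
  exact hZ (e.injective ((hψ.derivation_of_one hn b (fun _ => rfl) hZ₀ (E.compDer Z)).trans
    (map_zero e).symm))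

/-- At a point of multiplicity one whose residue field is étale over `k`, some derivation of `B`
maps the equation to an element which does not vanish. -/
lemma IsCrossing.exists_derivation_notMem (h : IsCrossing.{u} k n 1 a M) (ha : a ∈ M)
    (b : Module.Basis (Fin n) B (Ω[B⁄k])) [Algebra.FormallyEtale k (B ⧸ M)] :
    ∃ D : Derivation k B B, D a ∉ M := by
  obtain ⟨h1, hn, K, _, _, h⟩ := h
  obtain ⟨ψ, hψ⟩ := h 2
  obtain ⟨e, he⟩ := hψ.exists_algEquiv h1 hn one_le_two
  let ρ := (truncResidue k K h1 hn one_le_two).comp ψ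
  let := ρ.toRingHom.toAlgebra
  have : IsScalarTower k B K := .of_algebraMap_eq fun x => (ρ.commutes x).symm
  have : Algebra.FormallyEtale k K := Algebra.FormallyEtale.of_equiv e
  obtain ⟨Z, hZ⟩ := hψ.exists_derivation_of_one ha hn b (fun _ => rfl)
    derivation_eq_zero_of_formallyEtale
  have := Module.Projective.of_basis b
  have hρ : Function.Surjective ρ :=
    (truncResidue_surjective (k := k) h1 hn one_le_two).comp hψ.surjective
  obtain ⟨D, hD⟩ := exists_derivation_lift (Algebra.linearMap B K) hρ Z
  refine ⟨D, fun hDa => hZ ?_⟩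
  rw [← hD]
  exact (hψ.ker_residue h1 hn one_le_two).ge hDa

/-- At a point of multiplicity at least two, the equation lies in the square of the maximal
ideal. -/
lemma IsCrossing.mem_sq [Algebra.FiniteType k B] (h : IsCrossing.{u} k n l a M) (ha : a ∈ M)
    (h2 : 2 ≤ l) (b : Module.Basis (Fin n) B (Ω[B⁄k])) : a ∈ M ^ 2 := by
  have h3 := (h.of_two_le h2 b).1
  obtain ⟨h1, hn, K, _, _, h⟩ := h
  obtain ⟨ψ, hψ⟩ := h 2
  obtain ⟨e, he⟩ := hψ.exists_algEquiv h1 hn one_le_two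
  let ρ := (truncResidue k K h1 hn one_le_two).comp ψ
  let := ρ.toRingHom.toAlgebra
  have : IsScalarTower k B K := .of_algebraMap_eq fun x => (ρ.commutes x).symm
  have : Algebra.FormallyEtale k K := Algebra.FormallyEtale.of_equiv e
  exact mem_sq_of_derivation (k := k) (K := K)
    ((truncResidue_surjective (k := k) h1 hn one_le_two).comp hψ.surjective)
    (hψ.ker_residue h1 hn one_le_two) ha (hψ.derivation_of_two_le h2 hn b h1 fun _ => rfl).2

/-- **Krull's intersection theorem**: an ideal of a Noetherian ring is closed in the adic topologies
of all maximal ideals together. -/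
lemma mem_of_forall_mem_sup_pow {R : Type*} [CommRing R] [IsNoetherianRing R] {J : Ideal R} {x : R}
    (h : ∀ M : Ideal R, M.IsMaximal → ∀ N, x ∈ J ⊔ M ^ N) : x ∈ J := by
  rw [← Ideal.Quotient.eq_zero_iff_mem]
  set y := Ideal.Quotient.mk J x with hy
  by_contra hne
  have h1 : Ideal.span {y} ≠ ⊥ := by rwa [ne_eq, Ideal.span_singleton_eq_bot]
  have h2 : LinearMap.ker (LinearMap.toSpanSingleton R (R ⧸ J) y) ≠ ⊤ := by
    intro h3
    apply hne
    have : (1 : R) ∈ LinearMap.ker (LinearMap.toSpanSingleton R (R ⧸ J) y) := h3 ▸ trivial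
    simpa using this
  obtain ⟨M, hM, hle⟩ := Ideal.exists_le_maximal _ h2
  have h4 : y ∈ (⨅ i : ℕ, M ^ i • ⊤ : Submodule R (R ⧸ J)) := by
    rw [Submodule.mem_iInf]
    intro N
    obtain ⟨j, hj, m, hm, hjm⟩ := Submodule.mem_sup.1 (h M hM N)
    have h5 : y = m • (1 : R ⧸ J) := by
      rw [hy, ← hjm, map_add, Ideal.Quotient.eq_zero_iff_mem.2 hj, zero_add, Algebra.smul_def,
        mul_one]
      rfl
    rw [h5]
    exact Submodule.smul_mem_smul hm trivial
  rw [Ideal.mem_iInf_smul_pow_eq_bot_iff] at h4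
  obtain ⟨r, hr⟩ := h4
  have h5 : (1 - r.1) ∈ M := hle (by simp [sub_smul, hr])
  exact hM.ne_top ((Ideal.eq_top_iff_one _).2 (by simpa using add_mem h5 r.2))

/-- At a point of multiplicity at least two, there are approximate coordinates up to any order in
which the derivatives of the equation generate the Jacobian ideal of `T₁ ⋯ T_l`. The map `φ` is a
set-theoretic lift to `K[T]` of a homomorphism to `K[T]/(T)ᴺ`. -/
lemma IsCrossing.exists_coordinates [Algebra.FiniteType k B] [Algebra.FormallySmooth k B]
    (h : IsCrossing.{u} k n l a M) (ha : a ∈ M)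
    (h2 : 2 ≤ l) (b : Module.Basis (Fin n) B (Ω[B⁄k])) :
    ∃ (K : Type u) (_ : Field K), ∀ N, l ≤ N → ∃ φ : B → MvPolynomial (Fin n) K,
      φ 1 - 1 ∈ idealOfVars (Fin n) K ^ N ∧
      (∀ x y, φ (x * y) - φ x * φ y ∈ idealOfVars (Fin n) K ^ N) ∧
      (∀ x ∈ derivIdeal k a ⊔ M ^ N, φ x ∈ coordJacobian K n l ⊔ idealOfVars (Fin n) K ^ N) ∧
      ∀ t ≤ N, ∀ x, φ x ∈ coordJacobian K n l ⊔ idealOfVars (Fin n) K ^ t →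
        x ∈ derivIdeal k a ⊔ M ^ t := by
  have := Module.Projective.of_basis b
  have : IsNoetherianRing B := Algebra.FiniteType.isNoetherianRing k B
  have h3 := (h.of_two_le h2 b).1
  have haM := h.mem_sq ha h2 b
  obtain ⟨h1, hn, K, _, _, h⟩ := h
  refine ⟨K, ‹_›, fun N hN => ?_⟩
  obtain ⟨ψ, hψ⟩ := h (N + 1)
  obtain ⟨e, he⟩ := hψ.exists_algEquiv h1 hn (by omega)
  have : Algebra.FormallyEtale k K := Algebra.FormallyEtale.of_equiv e
  obtain ⟨φ, hφ, hker, hM, w, hw, hw0⟩ := hψ.exists_lift h2 hn (by omega) haM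
  choose r hr using fun x => Ideal.Quotient.mk_surjective (φ x)
  have hle : idealOfVars (Fin n) K ^ (N + 1) ≤ idealOfVars (Fin n) K ^ N :=
    Ideal.pow_le_pow_right (Nat.le_succ N)
  have key (x : B) (g : MvPolynomial (Fin n) K) (hx : φ x = Ideal.Quotient.mk _ g) :=
    derivIdeal_sup_pow h1 hn hφ hker hM hw hw0 x g hx
  refine ⟨r, ?_, fun x y => ?_, fun x => (key x _ (hr x).symm).1, fun t ht x hx => ?_⟩
  · exact hle (Ideal.Quotient.eq.1 (by rw [hr, map_one, map_one]))
  · exact hle (Ideal.Quotient.eq.1 (by rw [map_mul, hr, hr, hr, map_mul]))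
  · obtain ⟨g, hg, y, hy, hgy⟩ := Submodule.mem_sup.1 hx
    have h5 := Ideal.mem_map_of_mem (Ideal.Quotient.mk (idealOfVars (Fin n) K ^ (N + 1))) hy
    rw [Ideal.map_pow, ← hM, ← Ideal.map_pow, Ideal.mem_map_iff_of_surjective
      (φ : B →+* MvPolynomial (Fin n) K ⧸ idealOfVars (Fin n) K ^ (N + 1)) hφ] at h5
    obtain ⟨z, hz, hzy⟩ := h5
    have h6 : x - z ∈ derivIdeal k a ⊔ M ^ N := by
      refine (key (x - z) g ?_).2 (Ideal.mem_sup_left hg)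
      rw [map_sub, ← hr x, ← hgy, map_add, sub_eq_iff_eq_add]
      exact congrArg _ hzy.symm
    have h8 : derivIdeal k a ⊔ M ^ N ≤ derivIdeal k a ⊔ M ^ t :=
      sup_le_sup_left (Ideal.pow_le_pow_right ht) _
    have h7 := add_mem (h8 h6)
      (Ideal.mem_sup_right (S := derivIdeal k a) hz)
    rwa [sub_add_cancel] at h7

/-- The equation and its derivatives vanish at the points of multiplicity at least two. -/
lemma IsCrossing.derivIdeal_le [Algebra.FiniteType k B] [Algebra.FormallySmooth k B]
    (h : IsCrossing.{u} k n l a M) (ha : a ∈ M)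
    (h2 : 2 ≤ l) (b : Module.Basis (Fin n) B (Ω[B⁄k])) : derivIdeal k a ≤ M := by
  obtain ⟨K, _, key⟩ := h.exists_coordinates ha h2 b
  obtain ⟨φ, hφ1, -, hφJ, -⟩ := key l le_rfl
  by_contra hJ
  have h5 : derivIdeal k a ⊔ M ^ l = ⊤ := by
    refine Ideal.sup_pow_eq_top ?_
    by_contra h6
    have h7 := Ideal.IsMaximal.eq_of_le ‹M.IsMaximal› h6 le_sup_right
    exact hJ (h7 ▸ le_sup_left)
  have h6 := hφJ 1 (h5 ▸ Submodule.mem_top)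
  have h7 : idealOfVars (Fin n) K ^ l ≤ idealOfVars (Fin n) K := Ideal.pow_le_self (by omega)
  have h8 := sub_mem (sup_le (coordJacobian_le h2 h.2.1) h7 h6) (h7 hφ1)
  rw [sub_sub_cancel, mem_idealOfVars_iff, map_one] at h8
  exact one_ne_zero h8

lemma IsCrossing.mem_derivIdeal_of_sq_mem [Algebra.FiniteType k B] [Algebra.FormallySmooth k B]
    (h : IsCrossing.{u} k n l a M) (ha : a ∈ M)
    (h2 : 2 ≤ l) (b : Module.Basis (Fin n) B (Ω[B⁄k])) {x : B} (hx : x ^ 2 ∈ derivIdeal k a)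
    (N : ℕ) : x ∈ derivIdeal k a ⊔ M ^ N := by
  obtain ⟨K, _, key⟩ := h.exists_coordinates ha h2 b
  -- taking square roots halves the order
  obtain ⟨φ, -, hφ, hφJ, hφN⟩ := key (2 * (N + l)) (by omega)
  have h5 : derivIdeal k a ⊔ M ^ (N + l) ≤ derivIdeal k a ⊔ M ^ N :=
    sup_le_sup_left (Ideal.pow_le_pow_right (by omega)) _
  refine h5 (hφN _ (by omega) _ (mem_coordJacobian_sup_of_sq_mem h.1 h.2.1 ?_))
  have h6 := sub_mem (hφJ _ (Ideal.mem_sup_left hx)) (Ideal.mem_sup_right (S := coordJacobian K n l)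
    ((pow_two x).symm ▸ hφ x x))
  rwa [pow_two x, sub_sub_cancel, ← pow_two] at h6

/-- If `B` is smooth with normal crossing points of étale residue fields on `a = 0`, then the ideal
generated by `a` and its derivatives is radical. By Krull's theorem this can be checked modulo all
powers of the maximal ideals, where it follows from the case of `T₁ ⋯ T_l`. -/
lemma isRadical_derivIdeal [Algebra.FiniteType k B] [Algebra.FormallySmooth k B]
    (b : Module.Basis (Fin n) B (Ω[B⁄k]))
    (h : ∀ M : Ideal B, M.IsMaximal → a ∈ M → ∃ l, IsCrossing.{u} k n l a M)
    (h1 : ∀ M : Ideal B, M.IsMaximal → a ∈ M → IsCrossing.{u} k n 1 a M →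
      Algebra.FormallyEtale k (B ⧸ M)) : (derivIdeal k a).IsRadical := by
  have : IsNoetherianRing B := Algebra.FiniteType.isNoetherianRing k B
  rw [Ideal.isRadical_iff_pow_one_lt 2 one_lt_two]
  intro x hx
  have key (M : Ideal B) (hM : M.IsMaximal) (N : ℕ) : x ∈ derivIdeal k a ⊔ M ^ N := by
    by_cases ha : a ∈ M
    · obtain ⟨l, hl⟩ := h M hM ha
      by_cases h2 : 2 ≤ l
      · exact hl.mem_derivIdeal_of_sq_mem ha h2 b hx N
      obtain rfl : l = 1 := by have := hl.1; omega
      have := h1 M hM ha hl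
      obtain ⟨D, hD⟩ := hl.exists_derivation_notMem ha b
      have h3 : derivIdeal k a ⊔ M = ⊤ := by
        by_contra h6
        have h7 := hM.eq_of_le h6 le_sup_right
        exact hD (h7 ▸ Ideal.mem_sup_left (derivation_mem_derivIdeal D))
      rw [Ideal.sup_pow_eq_top h3]
      trivial
    · have h3 : derivIdeal k a ⊔ M = ⊤ := by
        by_contra h6
        have h7 := hM.eq_of_le h6 le_sup_right
        exact ha (h7 ▸ Ideal.mem_sup_left self_mem_derivIdeal)
      rw [Ideal.sup_pow_eq_top h3]
      trivial
  exact mem_of_forall_mem_sup_pow key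

end

end NormalCrossing

/-! ### Residue fields of geometrically reduced algebras -/

namespace NormalCrossing

open TensorProduct

section

variable (k : Type u) [Field k]

/-- If `L ⊗ k̄` is reduced, then linear independence over `k` is preserved under taking `p`-th
powers. -/
lemma linearIndepOn_pow_of_isReduced (p : ℕ) [hp : Fact p.Prime] [CharP k p] {L : Type*} [Field L]
    [Algebra k L] [_root_.IsReduced (AlgebraicClosure k ⊗[k] L)] (s : Finset L)
    (hs : LinearIndepOn k id (s : Set L)) : LinearIndepOn k (· ^ p) (s : Set L) := by
  classical
  have : CharP (AlgebraicClosure k ⊗[k] L) p :=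
    charP_of_injective_algebraMap (algebraMap k (AlgebraicClosure k ⊗[k] L)).injective p
  have : ExpChar (AlgebraicClosure k ⊗[k] L) p := .prime hp.out
  rw [linearIndepOn_finset_iff]
  intro c hc i hi
  choose γ hγ using fun x : k =>
    IsAlgClosed.exists_pow_nat_eq (algebraMap k (AlgebraicClosure k) x) hp.out.pos
  -- the `p`-th root in `k̄ ⊗ L` of a relation between `p`-th powers is nilpotent
  let z : AlgebraicClosure k ⊗[k] L := ∑ j ∈ s, γ (c j) ⊗ₜ j
  have hz : z ^ p = 0 := by
    rw [sum_pow_char p]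
    simp_rw [Algebra.TensorProduct.tmul_pow, hγ]
    have h1 (j : L) : algebraMap k (AlgebraicClosure k) (c j) ⊗ₜ[k] (j ^ p) =
        (1 : AlgebraicClosure k) ⊗ₜ[k] (c j • j ^ p) := by
      rw [Algebra.algebraMap_eq_smul_one, smul_tmul]
    simp_rw [h1]
    rw [← tmul_sum, hc, tmul_zero]
  have hz0 : z = 0 := pow_eq_zero_iff hp.out.ne_zero |>.1 hz
  let b := Module.Basis.extend hs
  let f : L →ₗ[k] k := b.coord ⟨i, hs.subset_extend _ hi⟩
  have hf (j : L) (hj : j ∈ s) : f j = if j = i then 1 else 0 := by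
    have h1 : b ⟨j, hs.subset_extend _ hj⟩ = j := Module.Basis.extend_apply_self hs _
    conv_lhs => rw [← h1]
    rw [Module.Basis.coord_apply, Module.Basis.repr_self, Finsupp.single_apply]
    simp only [Subtype.mk.injEq]
  have h2 := congrArg ((TensorProduct.rid k _).toLinearMap ∘ₗ f.lTensor (AlgebraicClosure k)) hz0
  simp only [z, map_sum, LinearMap.comp_apply, LinearMap.lTensor_tmul, LinearEquiv.coe_coe,
    TensorProduct.rid_tmul, map_zero] at h2
  rw [Finset.sum_congr rfl fun j hj => by rw [hf j hj], Finset.sum_eq_single i] at h2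
  · have h3 : γ (c i) = 0 := by simpa using h2
    have h4 := hγ (c i)
    rw [h3, zero_pow hp.out.ne_zero] at h4
    exact (map_eq_zero _).1 h4.symm
  · intro j _ hji
    simp [hji]
  · exact fun h => absurd hi h

/-- Geometric reducedness passes to localizations. -/
lemma isReduced_tensorProduct_of_isLocalization {A : Type u} (S : Type u) [CommRing A] [CommRing S]
    [Algebra k A] [Algebra k S] [Algebra A S] [IsScalarTower k A S] (M : Submonoid A)
    [IsLocalization M S] (E : Type u) [CommRing E] [Algebra k E] [_root_.IsReduced (E ⊗[k] A)] :
    _root_.IsReduced (E ⊗[k] S) := by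
  let φ : E ⊗[k] A →ₐ[E] E ⊗[k] S :=
    Algebra.TensorProduct.map (AlgHom.id E E) (IsScalarTower.toAlgHom k A S)
  let := φ.toRingHom.toAlgebra
  have : IsScalarTower E (E ⊗[k] A) (E ⊗[k] S) := .of_algebraMap_eq fun x => (φ.commutes x).symm
  have := IsLocalization.tensorProduct_tensorProduct_right k E M S (by
    ext x
    exact (Algebra.TensorProduct.map_tmul _ _ _ _).trans (by simp))
  exact isReduced_localizationPreserves
    (M.map (Algebra.TensorProduct.includeRight (R := k) (A := E))) (E ⊗[k] S)
    ‹_root_.IsReduced (E ⊗[k] A)›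

/-- A separable extension of `k` does not contain new `p`-th roots of elements of `k`. -/
lemma not_isSeparable_of_pow_eq {p : ℕ} [hp : Fact p.Prime] [CharP k p] {α : k}
    (hα : ∀ β, β ^ p ≠ α) {K : Type*} [Field K] [Algebra k K] {θ : K}
    (hθ : θ ^ p = algebraMap k K α) : ¬ Algebra.IsSeparable k K := by
  intro h
  have : ExpChar k p := .prime hp.out
  have h1 : θ ∈ perfectClosure k K :=
    (mem_perfectClosure_iff_pow_mem p).2 ⟨1, by rw [pow_one, hθ]; exact ⟨α, rfl⟩⟩
  rw [perfectClosure.eq_bot_of_isSeparable] at h1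
  obtain ⟨β, hβ⟩ := IntermediateField.mem_bot.1 h1
  refine hα β ((algebraMap k K).injective ?_)
  rw [map_pow, hβ, hθ]

variable {k} {A : Type u} [CommRing A] [Algebra k A]

/-- A geometrically reduced algebra is smooth at its generic points: the local ring is the residue
field, which is separably generated. -/
lemma isSmoothAt_of_mem_minimalPrimes [Algebra.FiniteType k A]
    [_root_.IsReduced A] [_root_.IsReduced (AlgebraicClosure k ⊗[k] A)]
    (p : ℕ) [hp : Fact p.Prime] [CharP k p] (η : Ideal A) [η.IsPrime] (hη : η ∈ minimalPrimes A) :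
    Algebra.IsSmoothAt k η ∧ (Algebra.IsAlgebraic k η.ResidueField →
      Algebra.IsSeparable k η.ResidueField) := by
  let S := Localization.AtPrime η
  have h1 : IsLocalRing.maximalIdeal S = ⊥ := by
    rw [← IsLocalization.AtPrime.map_eq_maximalIdeal η S,
      ← IsLocalization.AtPrime.radical_map_of_mem_minimalPrimes S η ⊥ hη, Ideal.map_bot]
    exact nilradical_eq_zero S
  let e : S ≃ₐ[k] η.ResidueField := AlgEquiv.ofBijective (IsScalarTower.toAlgHom k S _) <| by
    refine ⟨(injective_iff_map_eq_zero _).2 fun x hx => ?_, IsLocalRing.residue_surjective⟩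
    rw [← Ideal.mem_bot, ← h1]
    exact (IsLocalRing.residue_eq_zero_iff x).1 hx
  have h2 : _root_.IsReduced (AlgebraicClosure k ⊗[k] S) :=
    isReduced_tensorProduct_of_isLocalization k S η.primeCompl _
  have h3 : _root_.IsReduced (AlgebraicClosure k ⊗[k] η.ResidueField) :=
    isReduced_of_injective (Algebra.TensorProduct.congr (AlgEquiv.refl (R := k)) e).symm
      (AlgEquiv.injective _)
  have : ExpChar k p := .prime hp.out
  have : Algebra.EssFiniteType k η.ResidueField := .comp _ A _
  obtain ⟨s, hs, hsep⟩ :=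
    exists_isTranscendenceBasis_and_isSeparable_of_linearIndepOn_pow_of_essFiniteType p hp.out
      (linearIndepOn_pow_of_isReduced k p (L := η.ResidueField))
  have h4 : Algebra.IsSeparable (IntermediateField.adjoin k
      (Set.range ((↑) : s → η.ResidueField))) η.ResidueField := by
    rw [show Set.range ((↑) : s → η.ResidueField) = s from Subtype.range_coe]
    exact hsep
  constructor
  · have := Algebra.FormallySmooth.of_algebraicIndependent_of_isSeparable hs.1
    exact Algebra.FormallySmooth.of_equiv e.symm
  · intro halg
    have h5 := hs.isEmpty_iff_isAlgebraic.2 halg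
    rw [Set.range_eq_empty, IntermediateField.adjoin_empty] at h4
    exact Algebra.IsSeparable.trans k (⊥ : IntermediateField k η.ResidueField) η.ResidueField

/-- Let `k` be a field with an element `α` which is not a `p`-th power. If a closed point of a
geometrically reduced algebra has a residue field which is not étale over `k`, then there is such a
point in the smooth locus, too. -/
lemma exists_smooth_of_not_formallyEtale [Algebra.FiniteType k A]
    [_root_.IsReduced A] [_root_.IsReduced (AlgebraicClosure k ⊗[k] A)]
    {p : ℕ} [hp : Fact p.Prime] [CharP k p] {α : k} (hα : ∀ β, β ^ p ≠ α) (M : Ideal A)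
    [M.IsMaximal] (hM : ¬ Algebra.FormallyEtale k (A ⧸ M)) :
    ∃ f : A, Algebra.Smooth k (Localization.Away f) ∧
      ∃ M' : Ideal A, M'.IsMaximal ∧ f ∉ M' ∧ ¬ Algebra.FormallyEtale k (A ⧸ M') := by
  obtain ⟨η, hη, hηM⟩ := Ideal.exists_minimalPrimes_le (bot_le (a := M))
  have : η.IsPrime := hη.1.1
  obtain ⟨hsm, hsep⟩ := isSmoothAt_of_mem_minimalPrimes (k := k) p η hη
  have : IsNoetherianRing A := Algebra.FiniteType.isNoetherianRing k A
  have : Algebra.FinitePresentation k A := Algebra.FinitePresentation.of_finiteType.1 ‹_›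
  obtain ⟨f, hf, hfs⟩ := Algebra.IsSmoothAt.exists_notMem_smooth k η
  refine ⟨f, hfs, ?_⟩
  let R := Localization.Away f
  have hηR : ∀ y : Submonoid.powers f, IsUnit (algebraMap A η.ResidueField y) := by
    rintro ⟨_, m, rfl⟩
    rw [map_pow]
    refine (IsUnit.mk0 _ ?_).pow m
    rwa [ne_eq, Ideal.algebraMap_residueField_eq_zero]
  let ρ : R →+* η.ResidueField := IsLocalization.lift hηR
  have hρ (x : A) : ρ (algebraMap A R x) = algebraMap A _ x := IsLocalization.lift_eq hηR x
  have : Nontrivial R := ρ.domain_nontrivial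
  obtain ⟨s, g, hg, hgi⟩ := exists_integral_inj_algHom_of_fg k R
  obtain _ | s := s
  · -- the generic point is closed
    exfalso
    have h1 : ∀ x : R, IsIntegral k x := by
      have h2 := RingHom.IsIntegral.trans (MvPolynomial.C : k →+* MvPolynomial (Fin 0) k)
        g.toRingHom
        (RingHom.isIntegral_of_surjective _ (MvPolynomial.C_surjective (Fin 0))) hgi
      have h3 : g.toRingHom.comp MvPolynomial.C = algebraMap k R := g.comp_algebraMap
      rw [h3] at h2
      exact h2
    let ρ' : R →ₐ[k] η.ResidueField := ⟨ρ, fun c => by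
      change ρ (algebraMap k R c) = _
      rw [IsScalarTower.algebraMap_apply k A R, hρ, ← IsScalarTower.algebraMap_apply]⟩
    have h2 : Algebra.IsIntegral k (A ⧸ η) := by
      refine ⟨fun x => ?_⟩
      obtain ⟨x, rfl⟩ := Ideal.Quotient.mk_surjective x
      refine (isIntegral_algHom_iff (IsScalarTower.toAlgHom k (A ⧸ η) η.ResidueField)
        η.injective_algebraMap_quotient_residueField).1 ?_
      have h3 := (h1 (algebraMap A R x)).map ρ'
      rw [show ρ' (algebraMap A R x) = algebraMap A _ x from hρ x] at h3
      exact h3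
    have h3 : η.IsMaximal := Ideal.Quotient.maximal_of_isField _
      (isField_of_isIntegral_of_isField' (Field.toIsField k))
    obtain rfl := h3.eq_of_le (Ideal.IsMaximal.ne_top ‹M.IsMaximal›) hηM
    let e : (A ⧸ η) ≃ₐ[k] η.ResidueField := AlgEquiv.ofBijective
      (IsScalarTower.toAlgHom k _ _) η.bijective_algebraMap_quotient_residueField
    have h4 : Algebra.IsIntegral k η.ResidueField :=
      ⟨fun x => by
        obtain ⟨y, rfl⟩ := e.surjective x
        exact (Algebra.IsIntegral.isIntegral (R := k) y).map e⟩
    have := hsep h4.isAlgebraic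
    have : Algebra.FormallyEtale k η.ResidueField := Algebra.FormallyEtale.of_isSeparable k _
    exact hM (Algebra.FormallyEtale.of_equiv e.symm)
  · -- a point of the smooth locus with a residue field containing a `p`-th root of `α`
    let t : MvPolynomial (Fin (s + 1)) k := MvPolynomial.X 0 ^ p - MvPolynomial.C α
    have ht : Ideal.span {t} ≠ ⊤ := by
      obtain ⟨β, hβ⟩ :=
        IsAlgClosed.exists_pow_nat_eq (algebraMap k (AlgebraicClosure k) α) hp.out.pos
      intro h
      have h1 : (1 : MvPolynomial (Fin (s + 1)) k) ∈ Ideal.span {t} := h ▸ trivial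
      obtain ⟨c, hc⟩ := Ideal.mem_span_singleton'.1 h1
      have h2 := congrArg (MvPolynomial.aeval fun _ => β) hc
      simp [t, hβ] at h2
    obtain ⟨q, hq, htq⟩ := Ideal.exists_le_maximal _ ht
    obtain ⟨P, hP, hPq⟩ : ∃ P : Ideal R, P.IsMaximal ∧ P.comap g = q := by
      let := g.toRingHom.toAlgebra
      have : Algebra.IsIntegral (MvPolynomial (Fin (s + 1)) k) R := ⟨hgi⟩
      refine Ideal.exists_ideal_over_maximal_of_isIntegral q ?_
      rw [(RingHom.injective_iff_ker_eq_bot (algebraMap (MvPolynomial (Fin (s + 1)) k) R)).1 hg]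
      exact bot_le
    have hθ : Ideal.Quotient.mk P (g (MvPolynomial.X 0)) ^ p = algebraMap k (R ⧸ P) α := by
      have h1 : g t ∈ P := hPq.ge (htq (Ideal.mem_span_singleton_self t))
      rw [← map_pow, ← map_pow]
      refine Ideal.Quotient.eq.2 ?_
      rwa [map_sub, ← MvPolynomial.algebraMap_eq, g.commutes] at h1
    let M' := P.comap (algebraMap A R)
    let φ : (A ⧸ M') →ₐ[k] R ⧸ P := Ideal.quotientMapₐ P (IsScalarTower.toAlgHom k A R) le_rfl
    have hφi : Function.Injective φ := Ideal.quotientMap_injective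
    let := Ideal.Quotient.field P
    have : Algebra.FiniteType k R := inferInstance
    have hfin : Module.Finite k (R ⧸ P) := finite_of_finite_type_of_isJacobsonRing k (R ⧸ P)
    have hM'p : M'.IsPrime := Ideal.comap_isPrime _ _
    have hint : Algebra.IsIntegral k (A ⧸ M') :=
      ⟨fun x => (isIntegral_algHom_iff φ hφi).1 (Algebra.IsIntegral.isIntegral _)⟩
    have hM' : M'.IsMaximal := Ideal.Quotient.maximal_of_isField _
      (isField_of_isIntegral_of_isField' (Field.toIsField k))
    have hfM' : f ∉ M' := fun h => hP.ne_top (Ideal.eq_top_of_isUnit_mem _ h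
      (IsLocalization.Away.algebraMap_isUnit f))
    refine ⟨M', hM', hfM', fun hE => ?_⟩
    let := Ideal.Quotient.field M'
    have hφs : Function.Surjective φ := by
      intro x
      obtain ⟨x, rfl⟩ := Ideal.Quotient.mk_surjective x
      obtain ⟨m, y, hy⟩ := IsLocalization.Away.surj f x
      have hf0 : Ideal.Quotient.mk M' f ≠ 0 := fun h => hfM' (Ideal.Quotient.eq_zero_iff_mem.1 h)
      have h1 : φ (Ideal.Quotient.mk M' y) =
          Ideal.Quotient.mk P x * φ (Ideal.Quotient.mk M' f) ^ m := by
        refine (congrArg (Ideal.Quotient.mk P) hy.symm).trans ?_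
        rw [map_mul, map_pow]
        rfl
      refine ⟨Ideal.Quotient.mk M' y * (Ideal.Quotient.mk M' f)⁻¹ ^ m, ?_⟩
      rw [map_mul, h1, mul_assoc, map_pow, ← mul_pow, ← map_mul, mul_inv_cancel₀ hf0, map_one,
        one_pow, mul_one]
    have h6 := Algebra.FormallyEtale.of_equiv (AlgEquiv.ofBijective φ ⟨hφi, hφs⟩)
    have : Algebra.EssFiniteType k (R ⧸ P) := inferInstance
    exact not_isSeparable_of_pow_eq k hα hθ ((Algebra.FormallyEtale.iff_isSeparable k _).1 h6)

/-- A semilinear map `I → A` over `f : B → A` factors through `I/I²`, if `f` kills `I`. -/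
lemma exists_cotangent_map {A B : Type*} [CommRing A] [CommRing B] (f : B →+* A) {I : Ideal B}
    (hf : ∀ x ∈ I, f x = 0) (v : I → A) (hadd : ∀ x y, v (x + y) = v x + v y)
    (hsmul : ∀ (b : B) x, v (b • x) = f b * v x) :
    ∃ l : I.Cotangent →ₛₗ[f] A, ∀ x, l (I.toCotangent x) = v x := by
  let g : I →ₛₗ[f] A := ⟨⟨v, hadd⟩, hsmul⟩
  refine ⟨Submodule.liftQ (I • ⊤ : Submodule B I) g ?_, fun x => rfl⟩
  rw [Submodule.smul_le]
  intro c hc x _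
  rw [LinearMap.mem_ker, map_smulₛₗ, hf c hc, zero_smul]

/-- If `I` is generated by a nonzerodivisor `a`, then `I/I²` is freely generated by the class
of `a`. -/
lemma exists_normal_functional {A B : Type*} [CommRing A] [CommRing B] (f : B →+* A) {I : Ideal B}
    {a : B} (ha : a ∈ nonZeroDivisors B) (hI : I = Ideal.span {a}) (hf : ∀ x ∈ I, f x = 0) :
    ∃ l : I.Cotangent →ₛₗ[f] A, ∀ (b : B) (h : b * a ∈ I), l (I.toCotangent ⟨b * a, h⟩) = f b := by
  have hex (x : I) : ∃ b, b * a = x := Ideal.mem_span_singleton'.1 (hI.le x.2)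
  choose r hr using hex
  have key (x : I) (b : B) (h : b * a = x) : r x = b :=
    (mul_cancel_right_mem_nonZeroDivisors ha).1 ((hr x).trans h.symm)
  obtain ⟨l, hl⟩ := exists_cotangent_map f hf (fun x => f (r x))
    (fun x y => by rw [key (x + y) (r x + r y) (by rw [add_mul, hr, hr]; rfl), map_add])
    (fun c x => by rw [key (c • x) (c * r x) (by rw [mul_assoc, hr]; rfl), map_mul])
  exact ⟨l, fun b h => (hl _).trans (congrArg f (key ⟨b * a, h⟩ b rfl))⟩

/-- If the quotient by `a` is formally smooth, then some derivation into the quotient maps the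
nonzerodivisor `a` to one. -/
lemma exists_derivation_of_formallySmooth {k B : Type u} [Field k] [CommRing B] [Algebra k B]
    [Algebra.FormallySmooth k B] {a : B} (ha : a ∈ nonZeroDivisors B)
    [Algebra.FormallySmooth k (B ⧸ Ideal.span {a})] :
    ∃ D : Derivation k B (B ⧸ Ideal.span {a}), D a = 1 := by
  let f := Ideal.Quotient.mkₐ k (Ideal.span {a})
  have hf : Function.Surjective f := Ideal.Quotient.mk_surjective
  have hI : RingHom.ker f = Ideal.span {a} := Ideal.mk_ker
  obtain ⟨l, hl⟩ := exists_normal_functional f.toRingHom ha rfl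
    fun x hx => Ideal.Quotient.eq_zero_iff_mem.2 hx
  have hT : ∀ t : TangentCohomology.T1 k (B ⧸ Ideal.span {a}) (B ⧸ Ideal.span {a}), t = 0 := by
    intro t
    have hid : RingHom.ker (AlgHom.id k (B ⧸ Ideal.span {a})) = ⊥ :=
      (RingHom.injective_iff_ker_eq_bot (RingHom.id _)).1 Function.injective_id
    obtain ⟨m, rfl⟩ := TangentCohomology.T1.ofNormal_surjective (AlgHom.id k _)
      Function.surjective_id hid t
    have : m = 0 := by
      ext x
      obtain ⟨⟨x, hx⟩, rfl⟩ := Ideal.toCotangent_surjective _ x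
      obtain rfl := (Submodule.mem_bot _).1 hx
      exact (congrArg m (map_zero (Ideal.toCotangent _))).trans ((map_zero m).trans rfl)
    rw [this, map_zero]
  obtain ⟨D, hD, h⟩ := TangentCohomology.T1.exists_derivation_of_ofNormal_eq_zero f hf hI
    (hT (TangentCohomology.T1.ofNormal f hf hI l))
  refine ⟨Derivation.mk' D fun x y => hD x y, ?_⟩
  have h1 := hl 1 ((one_mul a).symm ▸ Ideal.mem_span_singleton_self a)
  simp only [one_mul, map_one] at h1
  exact (h ⟨a, Ideal.mem_span_singleton_self a⟩).symm.trans h1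

/-- At a point of the smooth locus of the divisor `a = 0`, some derivation into the residue field
does not kill the equation. -/
lemma exists_derivation_of_smooth_localization {k B : Type u} [Field k] [CommRing B] [Algebra k B]
    [Algebra.FormallySmooth k B] {a : B} (ha : a ∈ nonZeroDivisors B) (f : B)
    [Algebra.FormallySmooth k (Localization.Away (Ideal.Quotient.mk (Ideal.span {a}) f))]
    {M : Ideal B} [M.IsMaximal] (haM : a ∈ M) (hfM : f ∉ M) :
    ∃ Z : Derivation k B (B ⧸ M), Z a ≠ 0 := by
  let B' := Localization.Away f
  let a' := algebraMap B B' a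
  have : Algebra.FormallySmooth k B' :=
    have : Algebra.FormallySmooth B B' := .of_isLocalization (Submonoid.powers f)
    .comp k B B'
  have ha' : a' ∈ nonZeroDivisors B' :=
    IsLocalization.map_nonZeroDivisors_le (Submonoid.powers f) B' ⟨a, ha, rfl⟩
  have : Algebra.FormallySmooth k (B' ⧸ Ideal.span {a'}) := by
    let I := Ideal.span {a}
    have hmap : I.map (algebraMap B B') = Ideal.span {a'} := by
      rw [Ideal.map_span, Set.image_singleton]
    have : IsLocalization (Algebra.algebraMapSubmonoid (B ⧸ I) (Submonoid.powers f))
        (Localization.Away (Ideal.Quotient.mk I f)) := by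
      rw [Algebra.algebraMapSubmonoid, Submonoid.map_powers]
      exact Localization.isLocalization
    let e := IsLocalization.algEquiv (Algebra.algebraMapSubmonoid (B ⧸ I) (Submonoid.powers f))
      (Localization.Away (Ideal.Quotient.mk I f)) (B' ⧸ I.map (algebraMap B B'))
    have : IsScalarTower k (B ⧸ I) (B' ⧸ I.map (algebraMap B B')) :=
      .of_algebraMap_eq fun x => by
        change Ideal.Quotient.mk _ (algebraMap k B' x) = _
        rw [IsScalarTower.algebraMap_apply k B B']
        rfl
    rw [← hmap]
    exact Algebra.FormallySmooth.of_equiv (e.restrictScalars k)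
  obtain ⟨D, hD⟩ := exists_derivation_of_formallySmooth (k := k) ha'
  have hfu : ∀ y : Submonoid.powers f, IsUnit (Ideal.Quotient.mk M (y : B)) := by
    rintro ⟨_, m, rfl⟩
    let := Ideal.Quotient.field M
    change IsUnit (Ideal.Quotient.mk M (f ^ m))
    rw [map_pow]
    exact (IsUnit.mk0 _ fun h => hfM (Ideal.Quotient.eq_zero_iff_mem.1 h)).pow m
  let π' : B' →+* B ⧸ M := IsLocalization.lift hfu
  have hπ' (x : B) : π' (algebraMap B B' x) = Ideal.Quotient.mk M x := IsLocalization.lift_eq hfu x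
  let π : B' ⧸ Ideal.span {a'} →+* B ⧸ M := Ideal.Quotient.lift _ π' fun x hx => by
    obtain ⟨c, rfl⟩ := Ideal.mem_span_singleton'.1 hx
    rw [map_mul, hπ', Ideal.Quotient.eq_zero_iff_mem.2 haM, mul_zero]
  have hπ (x : B') : π (Ideal.Quotient.mk _ x) = π' x := rfl
  let Z : Derivation k B (B ⧸ M) := Derivation.mk'
    ⟨⟨fun x => π (D (algebraMap B B' x)), fun x y => by
      rw [map_add, map_add, map_add]⟩, fun c x => by
      change π (D (algebraMap B B' (c • x))) = c • π (D (algebraMap B B' x))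
      rw [show algebraMap B B' (c • x) = c • algebraMap B B' x from
        map_smul (IsScalarTower.toAlgHom k B B') c x, D.map_smul, Algebra.smul_def, map_mul,
        Algebra.smul_def]
      congr 1
      change π (Ideal.Quotient.mk _ (algebraMap k B' c)) = _
      rw [hπ, IsScalarTower.algebraMap_apply k B B', hπ']
      rfl⟩ fun x y => by
      change π (D (algebraMap B B' (x * y))) = x • π (D (algebraMap B B' y)) +
        y • π (D (algebraMap B B' x))
      rw [map_mul, D.leibniz, map_add, Algebra.smul_def, Algebra.smul_def, Algebra.smul_def,
        Algebra.smul_def, map_mul, map_mul]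
      change π (Ideal.Quotient.mk _ _) * _ + π (Ideal.Quotient.mk _ _) * _ = _
      rw [hπ, hπ, hπ', hπ']
      rfl
  refine ⟨Z, ?_⟩
  change π (D a') ≠ 0
  let := Ideal.Quotient.field M
  rw [hD, map_one]
  exact one_ne_zero

/-- The residue fields of the closed points of the divisor `a = 0` are étale over `k`, if the
divisor is geometrically reduced with normal crossings. Otherwise `k` is imperfect, and there is a
closed point in the smooth locus of the divisor whose residue field is not étale. Some derivation
does not kill the equation there, which is impossible at such a normal crossing point. -/
lemma IsCrossing.formallyEtale {k B : Type u} [Field k] [CommRing B] [Algebra k B] {n : ℕ}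
    [Algebra.FormallySmooth k B] [Algebra.FiniteType k B] {a : B} (ha : a ∈ nonZeroDivisors B)
    (b : Module.Basis (Fin n) B (Ω[B⁄k]))
    (h : ∀ M : Ideal B, M.IsMaximal → a ∈ M → ∃ l, IsCrossing.{u} k n l a M)
    [_root_.IsReduced (B ⧸ Ideal.span {a})]
    [_root_.IsReduced (AlgebraicClosure k ⊗[k] (B ⧸ Ideal.span {a}))]
    (M : Ideal B) [hM : M.IsMaximal] (haM : a ∈ M) : Algebra.FormallyEtale k (B ⧸ M) := by
  by_cases hk : PerfectField k
  · let := Ideal.Quotient.field M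
    have : Algebra.FiniteType k (B ⧸ M) := inferInstance
    have := finite_of_finite_type_of_isJacobsonRing k (B ⧸ M)
    exact Algebra.FormallyEtale.of_isSeparable k _
  obtain _ | ⟨p, hp, hpk⟩ := CharP.exists' k
  · exact (hk inferInstance).elim
  have : ExpChar k p := .prime hp.out
  obtain ⟨α, hα⟩ : ∃ α : k, ∀ β, β ^ p ≠ α := by
    by_contra! h1
    have := PerfectRing.ofSurjective k p h1
    exact hk (PerfectRing.toPerfectField k p)
  have hspan {M : Ideal B} (haM : a ∈ M) : Ideal.span {a} ≤ M := by
    rwa [Ideal.span_singleton_le_iff_mem]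
  have hmap (M : Ideal B) [hM : M.IsMaximal] (haM : a ∈ M) :
      (M.map (Ideal.Quotient.mk (Ideal.span {a}))).IsMaximal := by
    refine (Ideal.map_eq_top_or_isMaximal_of_surjective _ Ideal.Quotient.mk_surjective
      hM).resolve_left fun h => hM.ne_top ?_
    have := Ideal.comap_map_of_surjective' (Ideal.Quotient.mk (Ideal.span {a}))
      Ideal.Quotient.mk_surjective M
    rw [h, Ideal.comap_top, Ideal.mk_ker, sup_eq_left.2 (hspan haM)] at this
    exact this.symm
  by_contra hE
  have hMmax := hmap M haM
  let e : ((B ⧸ Ideal.span {a}) ⧸ M.map (Ideal.Quotient.mk (Ideal.span {a}))) ≃ₐ[k] B ⧸ M :=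
    DoubleQuot.quotQuotEquivQuotOfLEₐ k (hspan haM)
  obtain ⟨f, hf, M', hM', hfM', hE'⟩ := exists_smooth_of_not_formallyEtale (k := k) hα
    (M.map (Ideal.Quotient.mk (Ideal.span {a}))) fun h => hE (Algebra.FormallyEtale.of_equiv e)
  obtain ⟨f, rfl⟩ := Ideal.Quotient.mk_surjective f
  let N := M'.comap (Ideal.Quotient.mk (Ideal.span {a}))
  have hN : N.IsMaximal := Ideal.comap_isMaximal_of_surjective _ Ideal.Quotient.mk_surjective
  have haN : a ∈ N := by
    rw [Ideal.mem_comap, Ideal.Quotient.eq_zero_iff_mem.2 (Ideal.mem_span_singleton_self a)]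
    exact zero_mem _
  obtain ⟨Z, hZ⟩ := exists_derivation_of_smooth_localization (k := k) ha f haN hfM'
  obtain ⟨l, hl⟩ := h N hN haN
  have h6 := hl.formallyEtale_of_derivation_ne_zero b hZ
  have e' : (B ⧸ N) ≃ₐ[k] (B ⧸ Ideal.span {a}) ⧸ M' := by
    refine AlgEquiv.ofBijective (Ideal.quotientMapₐ M' (Ideal.Quotient.mkₐ k (Ideal.span {a}))
      le_rfl) ⟨Ideal.quotientMap_injective, fun x => ?_⟩
    obtain ⟨x, rfl⟩ := Ideal.Quotient.mk_surjective x
    obtain ⟨x, rfl⟩ := Ideal.Quotient.mk_surjective x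
    exact ⟨Ideal.Quotient.mk _ x, rfl⟩
  exact hE' (Algebra.FormallyEtale.of_equiv e')

end

end NormalCrossing

/-! ### From completed local rings to truncations -/

namespace NormalCrossing

open MvPolynomial

section powerSeries

variable {K : Type*} [Field K] {n l N : ℕ}

/-- Power series of order at least `N` lie in the `N`-th power of the ideal of the variables. -/
lemma mem_map_pow_of_truncTotal_eq_zero {x : MvPowerSeries (Fin n) K}
    (hx : MvPowerSeries.truncTotalAlgHom (Fin n) K N x = 0) :
    x ∈ ((idealOfVars (Fin n) K).map (algebraMap _ (MvPowerSeries (Fin n) K))) ^ N := by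
  let e := MvPowerSeries.toAdicCompletionAlgEquiv (Fin n) K
  have hfg : (idealOfVars (Fin n) K).FG := Submodule.fg_span (Set.finite_range _)
  have h1 : e x ∈ (idealOfVars (Fin n) K ^ N • ⊤ : Submodule (MvPolynomial (Fin n) K) _) := by
    rw [AdicCompletion.pow_smul_top_eq_ker_eval hfg, LinearMap.mem_ker]
    refine (Submodule.Quotient.mk_eq_zero _).2 ?_
    rw [smul_eq_mul, Ideal.mul_top]
    exact Ideal.Quotient.eq_zero_iff_mem.1 hx
  have h2 := Submodule.mem_map_of_mem (f := e.symm.toLinearMap) h1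
  rw [Submodule.map_smul''] at h2
  have h3 : x ∈ (idealOfVars (Fin n) K ^ N • ⊤ :
      Submodule (MvPolynomial (Fin n) K) (MvPowerSeries (Fin n) K)) := by
    have h4 := Submodule.smul_mono (le_refl (idealOfVars (Fin n) K ^ N))
      (le_top (a := Submodule.map e.symm.toLinearMap ⊤)) h2
    rwa [show e.symm.toLinearMap (e x) = x from e.symm_apply_apply x] at h4
  rw [Ideal.smul_top_eq_map] at h3
  rwa [← Ideal.map_pow]

/-- The truncation of `K[[T]]/(T₁ ⋯ T_l)` at order `N`. -/
def truncNCRing (K : Type u) [Field K] (n l N : ℕ) :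
    NCRing K n l →+* MvPolynomial (Fin n) K ⧸ truncIdeal K n l N :=
  Ideal.Quotient.lift _ ((Ideal.Quotient.factor
      (show idealOfVars (Fin n) K ^ N ≤ truncIdeal K n l N from le_sup_right)).comp
    (MvPowerSeries.truncTotalAlgHom (Fin n) K N).toRingHom) fun x hx => by
      obtain ⟨c, rfl⟩ := Ideal.mem_span_singleton'.1 hx
      have h : (∏ i : Fin n with i.val < l, (MvPowerSeries.X i : MvPowerSeries (Fin n) K)) =
          algebraMap (MvPolynomial (Fin n) K) _ (coordProd K n l) := by
        rw [coordProd, map_prod]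
        refine Finset.prod_congr rfl fun i _ => ?_
        exact (MvPolynomial.coe_X i).symm
      rw [map_mul, h]
      have h2 : ((Ideal.Quotient.factor (show idealOfVars (Fin n) K ^ N ≤ truncIdeal K n l N from
          le_sup_right)).comp (MvPowerSeries.truncTotalAlgHom (Fin n) K N).toRingHom)
          (algebraMap (MvPolynomial (Fin n) K) _ (coordProd K n l)) = 0 := by
        rw [RingHom.comp_apply]
        erw [(MvPowerSeries.truncTotalAlgHom (Fin n) K N).commutes]
        exact Ideal.Quotient.eq_zero_iff_mem.2
          (Ideal.mem_sup_left (Ideal.mem_span_singleton_self _))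
      rw [h2, mul_zero]

end powerSeries

section truncNCRing

variable {K : Type u} [Field K] {n l N : ℕ}

lemma truncNCRing_mk (g : MvPolynomial (Fin n) K) :
    truncNCRing K n l N (Ideal.Quotient.mk _ (g : MvPowerSeries (Fin n) K)) =
      Ideal.Quotient.mk _ g := by
  have hle : idealOfVars (Fin n) K ^ N ≤ truncIdeal K n l N := le_sup_right
  change Ideal.Quotient.factor hle (MvPowerSeries.truncTotalAlgHom (Fin n) K N
    (algebraMap (MvPolynomial (Fin n) K) _ g)) = _
  rw [(MvPowerSeries.truncTotalAlgHom (Fin n) K N).commutes]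
  rfl

lemma truncNCRing_surjective : Function.Surjective (truncNCRing K n l N) := fun x => by
  obtain ⟨g, rfl⟩ := Ideal.Quotient.mk_surjective x
  exact ⟨_, truncNCRing_mk g⟩

lemma mem_span_pow_of_truncNCRing_eq_zero {x : NCRing K n l} (hx : truncNCRing K n l N x = 0) :
    x ∈ (Ideal.span (Set.range fun i : Fin n => (Ideal.Quotient.mk _
      (MvPowerSeries.X i) : NCRing K n l))) ^ N := by
  obtain ⟨x, rfl⟩ := Ideal.Quotient.mk_surjective x
  obtain ⟨g, hg⟩ := Ideal.Quotient.mk_surjective (MvPowerSeries.truncTotalAlgHom (Fin n) K N x)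
  have h1 : Ideal.Quotient.mk (truncIdeal K n l N) g = 0 := by
    rw [← hx]
    have hle : idealOfVars (Fin n) K ^ N ≤ truncIdeal K n l N := le_sup_right
    change _ = Ideal.Quotient.factor hle (MvPowerSeries.truncTotalAlgHom (Fin n) K N x)
    rw [← hg]
    rfl
  obtain ⟨y, hy, z, hz, rfl⟩ := Submodule.mem_sup.1 (Ideal.Quotient.eq_zero_iff_mem.1 h1)
  have h2 : MvPowerSeries.truncTotalAlgHom (Fin n) K N (x - algebraMap _ _ y) = 0 := by
    rw [map_sub, ← hg, (MvPowerSeries.truncTotalAlgHom (Fin n) K N).commutes, map_add,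
      Ideal.Quotient.eq_zero_iff_mem.2 hz, add_zero]
    exact sub_self _
  have h3 := Ideal.mem_map_of_mem (Ideal.Quotient.mk (Ideal.span
    {∏ i : Fin n with i.val < l, (MvPowerSeries.X i : MvPowerSeries (Fin n) K)}))
    (mem_map_pow_of_truncTotal_eq_zero h2)
  rw [Ideal.map_pow, Ideal.map_map, idealOfVars, Ideal.map_span, ← Set.range_comp, map_sub] at h3
  have h4 : (Ideal.Quotient.mk (Ideal.span
      {∏ i : Fin n with i.val < l, (MvPowerSeries.X i : MvPowerSeries (Fin n) K)}))
      (algebraMap (MvPolynomial (Fin n) K) _ y) = 0 := by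
    obtain ⟨c, rfl⟩ := Ideal.mem_span_singleton'.1 hy
    rw [map_mul, Ideal.Quotient.eq_zero_iff_mem]
    refine Ideal.mul_mem_left _ _ (Ideal.subset_span ?_)
    rw [coordProd, map_prod]
    exact Finset.prod_congr rfl fun i _ => MvPolynomial.coe_X i
  rw [h4, sub_zero] at h3
  rw [show (fun i : Fin n => (Ideal.Quotient.mk _ (MvPowerSeries.X i) : NCRing K n l)) = _ from
    funext fun i => congrArg _ (MvPolynomial.coe_X i).symm]
  exact h3

end truncNCRing

section completion

variable {R : Type u} [CommRing R] [IsLocalRing R] [IsNoetherianRing R] {K : Type u} [Field K]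
  {n l : ℕ}

open IsLocalRing

/-- The kernel of the projection of the completion to `R/𝔪ᴺ` is the `N`-th power of the maximal
ideal, because `R` is Noetherian. -/
lemma evalₐ_eq_zero_iff {N : ℕ} (x : AdicCompletion (maximalIdeal R) R) :
    AdicCompletion.evalₐ (maximalIdeal R) N x = 0 ↔
      x ∈ maximalIdeal (AdicCompletion (maximalIdeal R) R) ^ N := by
  have h1 : AdicCompletion.evalₐ (maximalIdeal R) N x = 0 ↔
      AdicCompletion.eval (maximalIdeal R) R N x = 0 := by
    constructor <;> intro h
    · rw [← AdicCompletion.factor_evalₐ_eq_eval _ x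
        (by rw [smul_eq_mul, Ideal.mul_top]), h, map_zero]
    · rw [← AdicCompletion.factor_eval_eq_evalₐ _ x
        (by rw [smul_eq_mul, Ideal.mul_top]), h, map_zero]
  rw [h1, ← LinearMap.mem_ker, ← AdicCompletion.pow_smul_top_eq_ker_eval
    (maximalIdeal R).fg_of_isNoetherianRing, Ideal.smul_top_eq_map,
    AdicCompletion.maximalIdeal_eq_map, ← Ideal.map_pow]
  rfl

omit [IsNoetherianRing R] in
lemma evalₐ_algebraMap {N : ℕ} (r : R) : AdicCompletion.evalₐ (maximalIdeal R) N
    (algebraMap R _ r) = Ideal.Quotient.mk _ r :=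
  (AdicCompletion.evalₐ (maximalIdeal R) N).commutes r

/-- An isomorphism of the completion of `R` with `K[[T]]/(T₁ ⋯ T_l)` identifies `R/𝔪ᴺ` with the
truncation at order `N`. -/
lemma ker_truncNCRing_comp {N : ℕ} (h1 : 1 ≤ l) (hn : l ≤ n) (hN : 1 ≤ N)
    (e : AdicCompletion (maximalIdeal R) R ≃+* NCRing K n l) :
    Function.Surjective (((truncNCRing K n l N).comp e.toRingHom).comp (algebraMap R _)) ∧
      RingHom.ker (((truncNCRing K n l N).comp e.toRingHom).comp (algebraMap R _)) =
        maximalIdeal R ^ N := by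
  let Q := MvPolynomial (Fin n) K ⧸ truncIdeal K n l N
  let σ : AdicCompletion (maximalIdeal R) R →+* Q := (truncNCRing K n l N).comp e.toRingHom
  have hσ : Function.Surjective σ := truncNCRing_surjective.comp e.surjective
  let q : Ideal Q := (idealOfVars (Fin n) K).map (Ideal.Quotient.mk _)
  have hq : q.IsMaximal := isMaximal_map_mk h1 hn hN
  have hqN : q ^ N = ⊥ := by
    rw [← Ideal.map_pow, Ideal.map_eq_bot_iff_le_ker, Ideal.mk_ker]
    exact le_sup_right
  have hm : q.comap σ = maximalIdeal _ :=
    eq_maximalIdeal (Ideal.comap_isMaximal_of_surjective _ hσ)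
  have hker : RingHom.ker σ = maximalIdeal (AdicCompletion (maximalIdeal R) R) ^ N := by
    refine le_antisymm (fun x hx => ?_) fun x hx => ?_
    · have h2 := mem_span_pow_of_truncNCRing_eq_zero (x := e x) hx
      have h3 := Ideal.mem_map_of_mem e.symm.toRingHom h2
      rw [Ideal.map_pow, Ideal.map_span] at h3
      rw [show x = e.symm (e x) from (e.symm_apply_apply x).symm]
      refine Ideal.pow_right_mono ?_ N h3
      rw [Ideal.span_le]
      rintro _ ⟨_, ⟨i, rfl⟩, rfl⟩
      rw [SetLike.mem_coe, ← hm, Ideal.mem_comap]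
      change truncNCRing K n l N (e (e.symm _)) ∈ _
      rw [e.apply_symm_apply]
      change truncNCRing K n l N (Ideal.Quotient.mk _ (MvPowerSeries.X i)) ∈ _
      rw [← MvPolynomial.coe_X, truncNCRing_mk]
      exact Ideal.mem_map_of_mem _ (mem_idealOfVars_iff.2 (by simp))
    · rw [RingHom.mem_ker, ← Ideal.mem_bot, ← hqN]
      have h2 := Ideal.mem_map_of_mem σ hx
      rw [Ideal.map_pow] at h2
      exact Ideal.pow_right_mono (Ideal.map_le_iff_le_comap.2 hm.ge) N h2
  constructor
  · intro y
    obtain ⟨x, rfl⟩ := hσ y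
    obtain ⟨r, hr⟩ := Ideal.Quotient.mk_surjective (AdicCompletion.evalₐ (maximalIdeal R) N x)
    refine ⟨r, ?_⟩
    change σ (algebraMap R _ r) = σ x
    rw [← sub_eq_zero, ← map_sub, ← RingHom.mem_ker, hker, ← evalₐ_eq_zero_iff, map_sub,
      evalₐ_algebraMap, hr, sub_self]
  · ext r
    change σ (algebraMap R _ r) = 0 ↔ _
    rw [← RingHom.mem_ker, hker, ← evalₐ_eq_zero_iff, evalₐ_algebraMap,
      Ideal.Quotient.eq_zero_iff_mem]

end completion

section crossing

variable {k B A R K : Type u} [Field k] [CommRing B] [Algebra k B] [CommRing A] [CommRing R]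
  [IsLocalRing R] [IsNoetherianRing R] [Field K] {n l : ℕ} {a : B}

open IsLocalRing

/-- A closed point of `A = B/(a)` whose completed local ring is `K[[T]]/(T₁ ⋯ T_l)` is a normal
crossing point of multiplicity `l`. -/
lemma isCrossing_of_adicCompletion {f : B →+* A} (hf : Function.Surjective f)
    (ha : RingHom.ker f = Ideal.span {a}) (m : Ideal A) [m.IsMaximal] [Algebra A R]
    [IsLocalization.AtPrime R m] (h1 : 1 ≤ l) (hn : l ≤ n) (χ : k →+* K)
    (e : AdicCompletion (maximalIdeal R) R ≃+* NCRing K n l)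
    (he : ∀ c : k, e (algebraMap R _ (algebraMap A R (f (algebraMap k B c)))) =
      Ideal.Quotient.mk _ (MvPowerSeries.C (χ c))) : IsCrossing.{u} k n l a (m.comap f) := by
  let := χ.toAlgebra
  have hM : (m.comap f).IsMaximal := Ideal.comap_isMaximal_of_surjective _ hf
  have haM : a ∈ m.comap f := by
    rw [Ideal.mem_comap, show f a = 0 from ha.ge (Ideal.mem_span_singleton_self a)]
    exact zero_mem m
  have key (N : ℕ) (hN : 1 ≤ N) : ∃ ψ : B →ₐ[k] MvPolynomial (Fin n) K ⧸ truncIdeal K n l N,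
      IsTruncation a (m.comap f) ψ := by
    obtain ⟨hs, hk⟩ := ker_truncNCRing_comp (N := N) h1 hn hN e
    let σ := ((truncNCRing K n l N).comp e.toRingHom).comp (algebraMap R _)
    let ψ : B →ₐ[k] MvPolynomial (Fin n) K ⧸ truncIdeal K n l N :=
      ⟨(σ.comp (algebraMap A R)).comp f, fun c => by
        change truncNCRing K n l N (e _) = _
        rw [he, ← MvPolynomial.coe_C, truncNCRing_mk]
        rfl⟩
    let E := IsLocalization.AtPrime.equivQuotMaximalIdealPow m R N
    have hE (x : A) : E (Ideal.Quotient.mk _ x) = Ideal.Quotient.mk _ (algebraMap A R x) := by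
      exact IsLocalization.AtPrime.equivQuotMaximalIdealPow_apply_mk m R N x
    refine ⟨ψ, fun y => ?_, ?_⟩
    · obtain ⟨r, rfl⟩ := hs y
      obtain ⟨x, hx⟩ := E.surjective (Ideal.Quotient.mk _ r)
      obtain ⟨x, rfl⟩ := Ideal.Quotient.mk_surjective x
      obtain ⟨b, rfl⟩ := hf x
      rw [hE] at hx
      refine ⟨b, ?_⟩
      change σ _ = σ r
      rw [← sub_eq_zero, ← map_sub, ← RingHom.mem_ker, hk]
      exact Ideal.Quotient.eq.1 hx
    · have h2 := Ideal.comap_map_of_surjective' f hf ((m.comap f) ^ N)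
      rw [Ideal.map_pow, Ideal.map_comap_of_surjective f hf, ha, sup_comm] at h2
      rw [← h2]
      ext b
      change σ (algebraMap A R (f b)) = 0 ↔ _
      rw [← RingHom.mem_ker, hk, Ideal.mem_comap, ← Ideal.Quotient.eq_zero_iff_mem, ← hE,
        EmbeddingLike.map_eq_zero_iff, Ideal.Quotient.eq_zero_iff_mem]
  refine ⟨h1, hn, K, ‹_›, ‹_›, fun N => ?_⟩
  obtain _ | N := N
  · obtain ⟨ψ, hψ⟩ := key 1 le_rfl
    exact ⟨_, hψ.factor haM h1 hn le_rfl (Nat.zero_le 1)⟩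
  · exact key (N + 1) (by omega)

end crossing

end NormalCrossing

/-! ### The ideal of the singular locus in an affine piece -/

namespace NormalCrossing

open TangentCohomology TensorProduct

/-- The ideal of the points of multiplicity greater than one consists of the values `D a` of the
derivations `D : B → A`, where `A = B/(a)`: these values form a radical ideal, and the maximal
ideals containing it are the points of multiplicity greater than one. Here `H m l` says that `m` is
a point of multiplicity `l`. -/
lemma mem_singularIdeal_iff_exists_derivation {k A B : Type u} [Field k] [CommRing A] [CommRing B]
    [Algebra k A] [Algebra k B] {n : ℕ} [Algebra.FormallySmooth k B] [Algebra.FiniteType k B]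
    (f : B →ₐ[k] A) (hf : Function.Surjective f) {a : B} (ha : a ∈ nonZeroDivisors B)
    (hI : RingHom.ker f = Ideal.span {a}) (b : Module.Basis (Fin n) B (Ω[B⁄k]))
    (hA : _root_.IsReduced A) (hA' : _root_.IsReduced (AlgebraicClosure k ⊗[k] A))
    (H : Ideal A → ℕ → Prop)
    (hH : ∀ m l, m.IsMaximal → H m l → IsCrossing.{u} k n l a (m.comap f))
    (hH' : ∀ m, m.IsMaximal → ∃ l, H m l) (c : A) :
    (∀ m, m.IsMaximal → (∃ l, 1 < l ∧ H m l) → c ∈ m) ↔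
      ∃ D : B →ₗ[k] A, IsDerivationAlong f D ∧ D a = c := by
  have hfa : f a = 0 := by
    rw [← RingHom.mem_ker, hI]
    exact Ideal.mem_span_singleton_self a
  have hmax (M : Ideal B) (hM : M.IsMaximal) (haM : a ∈ M) :
      (M.map f).IsMaximal ∧ (M.map f).comap f = M := by
    have h1 : (M.map f).comap f = M := by
      have := Ideal.comap_map_of_surjective' (f : B →+* A) hf M
      refine this.trans (sup_eq_left.2 ?_)
      refine (le_of_eq hI).trans ?_
      rwa [Ideal.span_singleton_le_iff_mem]
    refine ⟨(Ideal.map_eq_top_or_isMaximal_of_surjective f hf hM).resolve_left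
      fun h => hM.ne_top ?_, h1⟩
    rw [← h1, h, Ideal.comap_top]
  let e₀ : (B ⧸ RingHom.ker f) ≃ₐ[k] A := Ideal.quotientKerAlgEquivOfSurjective hf
  let e : (B ⧸ Ideal.span {a}) ≃ₐ[k] A := (Ideal.quotientEquivAlgOfEq k hI).symm.trans e₀
  have : _root_.IsReduced (B ⧸ Ideal.span {a}) := isReduced_of_injective e e.injective
  have : _root_.IsReduced (AlgebraicClosure k ⊗[k] (B ⧸ Ideal.span {a})) := by
    let e' := Algebra.TensorProduct.congr (AlgEquiv.refl (R := k) (A₁ := AlgebraicClosure k)) e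
    exact isReduced_of_injective e' e'.injective
  have hl (M : Ideal B) (hM : M.IsMaximal) (haM : a ∈ M) : ∃ l, IsCrossing.{u} k n l a M := by
    obtain ⟨h1, h2⟩ := hmax M hM haM
    obtain ⟨l, hl⟩ := hH' _ h1
    exact ⟨l, by simpa only [h2] using hH _ _ h1 hl⟩
  have het (M : Ideal B) (hM : M.IsMaximal) (haM : a ∈ M) : Algebra.FormallyEtale k (B ⧸ M) :=
    IsCrossing.formallyEtale ha b hl M haM
  have hrad := isRadical_derivIdeal b hl fun M hM haM _ => het M hM haM
  constructor
  · intro hc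
    obtain ⟨c, rfl⟩ := hf c
    have hcJ : c ∈ derivIdeal k a := by
      have : IsJacobsonRing B := isJacobsonRing_of_finiteType (A := k)
      rw [← IsJacobsonRing.out ‹_› hrad, Ideal.jacobson, Submodule.mem_sInf]
      rintro M ⟨hJM, hM⟩
      have haM := hJM self_mem_derivIdeal
      obtain ⟨h1, h2⟩ := hmax M hM haM
      obtain ⟨l, hl⟩ := hH' _ h1
      have hlM : IsCrossing.{u} k n l a M := by simpa only [h2] using hH _ _ h1 hl
      obtain rfl | hl2 : l = 1 ∨ 1 < l := by have := hlM.1; omega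
      · have := hM
        have := het M hM haM
        obtain ⟨D, hD⟩ := hlM.exists_derivation_notMem haM b
        exact (hD (hJM (derivation_mem_derivIdeal D))).elim
      · have := hc _ h1 ⟨l, hl2, hl⟩
        rw [← h2]
        exact this
    obtain ⟨D, hD⟩ := mem_derivIdeal_iff.1 hcJ
    refine ⟨f.toLinearMap ∘ₗ (D : B →ₗ[k] B), fun x y => ?_, ?_⟩
    · change f (D (x * y)) = f x * f (D y) + f y * f (D x)
      rw [D.leibniz, map_add, smul_eq_mul, smul_eq_mul, map_mul, map_mul]
    · rw [← hI, RingHom.mem_ker, map_sub, sub_eq_zero] at hD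
      exact hD.symm
  · rintro ⟨D, hD, rfl⟩ m hm ⟨l, hl2, hl⟩
    let := f.toRingHom.toAlgebra
    have : IsScalarTower k B A := .of_algebraMap_eq fun x => (f.commutes x).symm
    let D' : Derivation k B A := Derivation.mk' D fun x y => by
      rw [Algebra.smul_def, Algebra.smul_def]
      exact hD x y
    have : Module.Free B (Ω[B⁄k]) := .of_basis b
    obtain ⟨δ, hδ⟩ := exists_derivation_lift (Algebra.linearMap B A) hf D'
    have hm' : (m.comap f).IsMaximal := Ideal.comap_isMaximal_of_surjective f hf
    have haM : a ∈ m.comap f := by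
      rw [Ideal.mem_comap, hfa]
      exact zero_mem _
    have h1 := (hH m l hm hl).derivIdeal_le haM hl2 b (derivation_mem_derivIdeal δ)
    have h2 : f (δ a) = D a := hδ a
    rw [← h2]
    exact h1

end NormalCrossing

/-! ### Algebras of sections over affine open subsets -/

namespace NormalCrossing

open TangentCohomology AlgebraicGeometry.Scheme TensorProduct

variable {k : Type u} [Field k] {X V : Scheme.{u}}

lemma toSections_eq (f : X ⟶ Spec (.of k)) (U : X.Opens) :
    toSections f U = ((ΓSpecIso (.of k)).inv ≫ f.appLE ⊤ U le_top).hom := by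
  rfl

lemma etale_resHom {U W : X.affineOpens} (h : W ≤ U) :
    (resHom (X := X) (show W.1 ≤ U.1 from h)).Etale := by
  have h1 := HasRingHomProperty.appLE (P := @Etale) (𝟙 X) inferInstance U W h
  have h2 : (𝟙 X : X ⟶ X).appLE U.1 W.1 h = X.presheaf.map (homOfLE h).op := by
    simp only [Hom.appLE, Hom.id_app]
    exact Category.id_comp _
  rw [h2] at h1
  exact h1

lemma etale_res (f : X ⟶ Spec (.of k)) {U W : X.Opens} (hU : IsAffineOpen U) (hW : IsAffineOpen W)
    (h : W ≤ U) : (Sec.res f h).toRingHom.Etale :=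
  etale_resHom (U := ⟨U, hU⟩) (W := ⟨W, hW⟩) h

lemma resHom_mem_nonZeroDivisors {U W : X.affineOpens} (h : W ≤ U) {a : Γ(X, U.1)}
    (ha : a ∈ nonZeroDivisors Γ(X, U.1)) :
    resHom (X := X) (show W.1 ≤ U.1 from h) a ∈ nonZeroDivisors Γ(X, W.1) := by
  have h1 := etale_resHom h
  algebraize [resHom (X := X) (show W.1 ≤ U.1 from h)]
  have := Algebra.Smooth.flat Γ(X, U.1) Γ(X, W.1)
  have h2 := Module.Flat.isSMulRegular_of_nonZeroDivisors (M := Γ(X, W.1)) ha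
  rw [mem_nonZeroDivisors_iff_right]
  intro x hx
  refine h2 ?_
  change a • x = a • 0
  rw [smul_zero, Algebra.smul_def, mul_comm]
  exact hx

lemma finiteType_sec (f : X ⟶ Spec (.of k)) [LocallyOfFiniteType f] {U : X.Opens}
    (hU : IsAffineOpen U) : Algebra.FiniteType k (Sec f U) := by
  have h1 := HasRingHomProperty.appLE (P := @LocallyOfFiniteType) f inferInstance
    ⟨⊤, isAffineOpen_top _⟩ ⟨U, hU⟩ le_top
  have h2 : (toSections f U).FiniteType := by
    rw [toSections_eq, CommRingCat.hom_comp]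
    exact h1.comp (.of_surjective _ ((ConcreteCategory.isIso_iff_bijective _).1 inferInstance).2)
  exact h2

lemma fromSpec_comp (f : X ⟶ Spec (.of k)) {U : X.Opens} (hU : IsAffineOpen U) :
    hU.fromSpec ≫ f = Spec.map (CommRingCat.ofHom (algebraMap k (Sec f U))) := by
  have h1 := (isAffineOpen_top (Spec (.of k))).SpecMap_appLE_fromSpec f hU
    (show U ≤ f ⁻¹ᵁ ⊤ from le_top)
  rw [← h1, IsAffineOpen.fromSpec_top, isoSpec_Spec_inv, ← Spec.map_comp]
  exact congrArg Spec.map (congrArg CommRingCat.ofHom (toSections_eq f U)).symm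

lemma isReduced_tensorProduct_sec (f : X ⟶ Spec (.of k)) [GeometricallyReduced f] {U : X.Opens}
    (hU : IsAffineOpen U) (K : Type u) [Field K] [Algebra k K] :
    _root_.IsReduced (K ⊗[k] Sec f U) := by
  have h1 := isPullback_SpecMap_of_isPushout _ _ _ _
    (CommRingCat.isPushout_tensorProduct k K (Sec f U))
  obtain ⟨ι, hι, hf⟩ : ∃ ι : Spec (.of (Sec f U)) ⟶ X, IsOpenImmersion ι ∧
      ι ≫ f = Spec.map (CommRingCat.ofHom (algebraMap k (Sec f U))) :=
    ⟨hU.fromSpec, hU.isOpenImmersion_fromSpec, fromSpec_comp f hU⟩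
  rw [← hf] at h1
  have h2 := IsPullback.of_hasPullback f (Spec.map (CommRingCat.ofHom (algebraMap k K)))
  let p : Spec (.of (K ⊗[k] Sec f U)) ⟶
      Limits.pullback f (Spec.map (CommRingCat.ofHom (algebraMap k K))) :=
    Limits.pullback.lift (Spec.map (CommRingCat.ofHom
      (Algebra.TensorProduct.includeRight : Sec f U →ₐ[k] K ⊗[k] Sec f U).toRingHom) ≫ ι)
      (Spec.map (CommRingCat.ofHom Algebra.TensorProduct.includeLeftRingHom)) (by
        rw [Category.assoc]
        exact h1.w.symm)
  have h3 := IsPullback.of_right (h₁₁ := p) (v₁₁ := Spec.map (CommRingCat.ofHom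
      (Algebra.TensorProduct.includeRight : Sec f U →ₐ[k] K ⊗[k] Sec f U).toRingHom))
      (h₂₁ := ι)
      (by
        rw [Limits.pullback.lift_snd]
        exact h1) (Limits.pullback.lift_fst _ _ _) h2.flip
  have : IsOpenImmersion p := MorphismProperty.of_isPullback h3.flip inferInstance
  have : AlgebraicGeometry.IsReduced
      (Limits.pullback f (Spec.map (CommRingCat.ofHom (algebraMap k K)))) :=
    GeometricallyReduced.geometrically_isReduced _ _ _ h2
  have h4 : AlgebraicGeometry.IsReduced (Spec (.of (K ⊗[k] Sec f U))) :=
    isReduced_of_isOpenImmersion p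
  exact (affine_isReduced_iff _).1 h4

lemma isReduced_sec (f : X ⟶ Spec (.of k)) [GeometricallyReduced f] {U : X.Opens}
    (hU : IsAffineOpen U) :
    _root_.IsReduced (Sec f U) := by
  have := isReduced_tensorProduct_sec f hU k
  let e := Algebra.TensorProduct.lid k (Sec f U)
  exact isReduced_of_injective e.symm e.symm.injective

end NormalCrossing

/-! ### Affine charts of the ambient variety -/

namespace NormalCrossing

open TangentCohomology AlgebraicGeometry.Scheme TensorProduct

variable {k : Type u} [Field k] {X V : Scheme.{u}} {f : X ⟶ Spec (.of k)} {g : V ⟶ Spec (.of k)}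
  {j : X ⟶ V}

/-- The pullback of sections along a morphism over `k`. -/
def pullSec (h : j ≫ g = f) (W : V.Opens) : Sec g W →ₐ[k] Sec f (j ⁻¹ᵁ W) where
  __ := ((j.app W).hom : Γ(V, W) →+* Γ(X, j ⁻¹ᵁ W))
  commutes' c := by
    subst h
    have h1 : (j ≫ g).appLE ⊤ (j ⁻¹ᵁ W) (show _ ≤ (j ≫ g) ⁻¹ᵁ ⊤ from le_top) =
        g.appLE ⊤ W (show _ ≤ g ⁻¹ᵁ ⊤ from le_top) ≫ j.app W := by
      rw [Hom.app_eq_appLE, Hom.appLE_comp_appLE]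
    have h2 : toSections (j ≫ g) (j ⁻¹ᵁ W) = (j.app W).hom.comp (toSections g W) := by
      rw [toSections_eq, toSections_eq, h1]
      rfl
    exact (RingHom.congr_fun h2 c).symm

lemma pullSec_surjective [IsClosedImmersion j] (h : j ≫ g = f) {W : V.Opens}
    (hW : IsAffineOpen W) : Function.Surjective (pullSec h W) :=
  j.app_surjective W hW

lemma ker_pullSec [QuasiCompact j] (h : j ≫ g = f) (W : V.affineOpens) :
    RingHom.ker (pullSec h W.1) = j.ker.ideal W :=
  (j.ker_apply W).symm

lemma pullSec_res (h : j ≫ g = f) {W W' : V.Opens} (hW : W' ≤ W) (b : Sec g W) :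
    Sec.res f (j.preimage_mono hW) (pullSec h W b) = pullSec h W' (Sec.res g hW b) :=
  (CategoryTheory.ConcreteCategory.congr_hom (j.naturality (homOfLE hW).op) b).symm

/-- The ideal of the singular locus in an affine open subset. -/
def singularIdeal (f : X ⟶ Spec (.of k)) (d : ℕ) (U : X.affineOpens) : Ideal (Sec f U.1) :=
  (IdealSheafData.vanishingIdeal (singularLocus f d)).ideal U

lemma mem_singularIdeal_iff {d : ℕ} (U : X.affineOpens) (c : Sec f U.1) :
    c ∈ singularIdeal f d U ↔ ∀ p : Spec Γ(X, U.1), IsClosed {U.2.fromSpec p} →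
      (∃ l, 1 < l ∧ HasMultiplicity f (d + 1) (U.2.fromSpec p) l) → c ∈ p.asIdeal := by
  have := U.2.isOpenImmersion_fromSpec
  have h1 : (IdealSheafData.vanishingIdeal (singularLocus f d)).ideal U =
      PrimeSpectrum.vanishingIdeal (U.2.fromSpec ⁻¹'
        {x : X | IsClosed {x} ∧ ∃ l, 1 < l ∧ HasMultiplicity f (d + 1) x l}) := by
    refine (congrArg PrimeSpectrum.vanishingIdeal
      (U.2.fromSpec.isOpenEmbedding.isOpenMap.preimage_closure_eq_closure_preimage
        U.2.fromSpec.continuous _)).trans ?_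
    exact PrimeSpectrum.vanishingIdeal_closure _
  refine (SetLike.ext_iff.1 h1 c).trans ((PrimeSpectrum.mem_vanishingIdeal _ _).trans ?_)
  exact forall_congr' fun p => ⟨fun h h1 h2 => h ⟨h1, h2⟩, fun h h1 => h h1.1 h1.2⟩

/-- An affine open subset of `V` is a good chart if the ideal of `X` is generated by a
nonzerodivisor `a`, and the ideal of the singular locus of `X` consists of the values at `a` of the
derivations into `𝒪_X`. -/
structure IsGoodChart (h : j ≫ g = f) (d : ℕ) (W : V.affineOpens) (hU : IsAffineOpen (j ⁻¹ᵁ W.1)) :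
    Prop where
  formallySmooth : Algebra.FormallySmooth k (Sec g W.1)
  exists_equation : ∃ a ∈ nonZeroDivisors (Sec g W.1), j.ker.ideal W = Ideal.span {a} ∧
    ∀ c : Sec f (j ⁻¹ᵁ W.1), c ∈ singularIdeal f d ⟨j ⁻¹ᵁ W.1, hU⟩ ↔
      ∃ D : Sec g W.1 →ₗ[k] Sec f (j ⁻¹ᵁ W.1), IsDerivationAlong (pullSec h W.1) D ∧ D a = c

/-- On a normal crossing divisor in a smooth variety, the charts with free `Ω` and one equation are
good. -/
lemma isGoodChart [IsClosedImmersion j] (h : j ≫ g = f) {d : ℕ} (hX : IsNormalCrossingVariety f d)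
    (W : V.affineOpens)
    (hU : IsAffineOpen (j ⁻¹ᵁ W.1)) {a : Sec g W.1} (ha : a ∈ nonZeroDivisors (Sec g W.1))
    (hI : j.ker.ideal W = Ideal.span {a}) [Algebra.FormallySmooth k (Sec g W.1)]
    [Algebra.FiniteType k (Sec g W.1)]
    (b : Module.Basis (Fin (d + 1)) (Sec g W.1) (Ω[Sec g W.1⁄k])) : IsGoodChart h d W hU := by
  refine ⟨inferInstance, a, ha, hI, fun c => ?_⟩
  have := hX.locallyOfFiniteType
  have := hX.geometricallyReduced
  have : JacobsonSpace X := LocallyOfFiniteType.jacobsonSpace f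
  let H (m : Ideal (Sec f (j ⁻¹ᵁ W.1))) (l : ℕ) : Prop :=
    ∃ p : Spec Γ(X, j ⁻¹ᵁ W.1), p.asIdeal = m ∧ IsClosed {hU.fromSpec p} ∧
      HasMultiplicity f (d + 1) (hU.fromSpec p) l
  have hker : RingHom.ker (pullSec h W.1) = Ideal.span {a} := (ker_pullSec h W).trans hI
  have hsurj := pullSec_surjective h W.2
  have key := mem_singularIdeal_iff_exists_derivation (pullSec h W.1)
    hsurj ha hker b (isReduced_sec f hU)
    (isReduced_tensorProduct_sec f hU _) H ?_ ?_ c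
  · rw [← key, mem_singularIdeal_iff]
    constructor
    · rintro h1 m hm ⟨l, hl, p, rfl, hp, hpl⟩
      exact h1 p hp ⟨l, hl, hpl⟩
    · rintro h1 (p : Spec Γ(X, j ⁻¹ᵁ W.1)) (hp : IsClosed {hU.fromSpec p}) ⟨l, hl, hpl⟩
      by_cases hm : p.asIdeal.IsMaximal
      · exact h1 _ hm ⟨l, hl, p, rfl, hp, hpl⟩
      · refine (hm ?_).elim
        refine (PrimeSpectrum.isClosed_singleton_iff_isMaximal _).1 ?_
        have := hp.preimage hU.fromSpec.continuous
        rwa [← Set.image_singleton, Set.preimage_image_eq _ hU.fromSpec.isOpenEmbedding.injective]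
          at this
  · rintro m l hm ⟨p, rfl, -, h1, hn, e, he⟩
    let x := hU.fromSpec p
    have hx : x ∈ j ⁻¹ᵁ W.1 := by
      have : x ∈ hU.fromSpec.opensRange := ⟨p, rfl⟩
      rwa [hU.opensRange_fromSpec] at this
    let I₁ : Algebra Γ(X, j ⁻¹ᵁ W.1) (X.presheaf.stalk x) :=
      (X.presheaf.germ (j ⁻¹ᵁ W.1) x hx).hom.toAlgebra
    have h2 : @IsLocalization.AtPrime Γ(X, j ⁻¹ᵁ W.1) _ (X.presheaf.stalk x) _ I₁ p.asIdeal
        (PrimeSpectrum.isPrime p) :=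
      hU.isLocalization_stalk' p hx
    let I₂ : Algebra (Sec f (j ⁻¹ᵁ W.1)) (X.presheaf.stalk x) := I₁
    let m : Ideal (Sec f (j ⁻¹ᵁ W.1)) := p.asIdeal
    have : m.IsMaximal := hm
    have : IsLocalization.AtPrime (X.presheaf.stalk x) m := h2
    have : Algebra.FiniteType k (Sec f (j ⁻¹ᵁ W.1)) := finiteType_sec f hU
    have : IsNoetherianRing (Sec f (j ⁻¹ᵁ W.1)) := Algebra.FiniteType.isNoetherianRing k _
    have : IsNoetherianRing (X.presheaf.stalk x) :=
      IsLocalization.isNoetherianRing m.primeCompl _ inferInstance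
    refine isCrossing_of_adicCompletion (R := X.presheaf.stalk x) (f := (pullSec h W.1).toRingHom)
      hsurj hker m h1 hn ((X.residue x).hom.comp (toStalk f x)) e fun c => ?_
    refine (congrArg (fun r => e (algebraMap (X.presheaf.stalk x) _ r)) ?_).trans (he c)
    refine (congrArg (algebraMap (Sec f (j ⁻¹ᵁ W.1)) (X.presheaf.stalk x))
      (((pullSec h W.1).commutes c).trans
        (resHom_resHom (X := X) le_rfl (le_top : j ⁻¹ᵁ W.1 ≤ ⊤) _).symm)).trans ?_
    exact X.presheaf.germ_res_apply (homOfLE le_top) x hx (toSections f ⊤ c)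
  · intro m hm
    let p : Spec Γ(X, j ⁻¹ᵁ W.1) := ⟨m, hm.isPrime⟩
    have hp : IsClosed {hU.fromSpec p} := by
      refine isClosed_singleton_of_isLocallyClosed_singleton ?_
      rw [← Set.image_singleton]
      exact ((PrimeSpectrum.isClosed_singleton_iff_isMaximal p).2 hm).isLocallyClosed.image
        hU.fromSpec.isOpenEmbedding.isInducing
        hU.fromSpec.isOpenEmbedding.isOpen_range.isLocallyClosed
    obtain ⟨l, hl⟩ := hX.hasMultiplicity _ hp
    exact ⟨l, p, rfl, hp, hl⟩

end NormalCrossing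

namespace NormalCrossing

open TangentCohomology AlgebraicGeometry.Scheme TensorProduct

variable {k : Type u} [Field k] {X V : Scheme.{u}} {f : X ⟶ Spec (.of k)} {g : V ⟶ Spec (.of k)}
  {j : X ⟶ V}

lemma isStandardSmooth_sec (g : V ⟶ Spec (.of k)) {n : ℕ} {U : (Spec (.of k)).Opens}
    {W W' : V.Opens}
    (hW : IsAffineOpen W) (x : W) (e : W ≤ g ⁻¹ᵁ U)
    (h : RingHom.IsStandardSmoothOfRelativeDimension n (g.appLE U W e).hom) (s : Γ(V, W))
    (hs : W' = V.basicOpen s) : Algebra.IsStandardSmoothOfRelativeDimension n k (Sec g W') := by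
  have hU : U = ⊤ := by
    refine eq_top_iff.2 fun y _ => ?_
    obtain rfl : y = g x := Subsingleton.elim (α := PrimeSpectrum k) _ _
    exact e x.2
  subst hU hs
  have h1 : (toSections g W).IsStandardSmoothOfRelativeDimension n := by
    rw [toSections_eq, CommRingCat.hom_comp]
    have h2 := RingHom.IsStandardSmoothOfRelativeDimension.equiv
      (ΓSpecIso (.of k)).symm.commRingCatIsoToRingEquiv
    have h3 := h.comp h2
    rw [add_zero] at h3
    exact h3
  have := hW.isLocalization_basicOpen s
  have h2 := RingHom.IsStandardSmoothOfRelativeDimension.algebraMap_isLocalizationAway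
    (R := Γ(V, W)) (Rᵣ := Γ(V, V.basicOpen s)) s
  have h3 := h2.comp h1
  rw [Nat.zero_add] at h3
  have h4 : (algebraMap Γ(V, W) Γ(V, V.basicOpen s)).comp (toSections g W) =
      toSections g (V.basicOpen s) := by
    ext c
    exact resHom_resHom (X := V) le_top (V.basicOpen_le s) _
  rw [h4] at h3
  exact h3

/-- The good charts form a basis of the topology of `V`. -/
lemma exists_isGoodChart {d : ℕ} (hj : IsNCDEmbedding f g j d) {x : V} {O : V.Opens} (hx : x ∈ O) :
    ∃ (W : V.affineOpens) (hU : IsAffineOpen (j ⁻¹ᵁ W.1)),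
      x ∈ W.1 ∧ W.1 ≤ O ∧ IsGoodChart hj.comp_eq d W hU := by
  have := hj.isClosedImmersion
  obtain ⟨W₁, hx₁, a, ha, hI⟩ := hj.isDivisor x
  obtain ⟨U, -, W, hW, hxW, e, h⟩ := hj.smooth.exists_isStandardSmoothOfRelativeDimension x
  obtain ⟨s, hs, hxs⟩ := hW.exists_basicOpen_le (V := W₁.1 ⊓ O) ⟨x, hx₁, hx⟩ hxW
  let W' : V.affineOpens := ⟨V.basicOpen s, hW.basicOpen s⟩
  have hW₁ : W' ≤ W₁ := hs.trans inf_le_left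
  have hU : IsAffineOpen (j ⁻¹ᵁ W'.1) := W'.2.preimage j
  refine ⟨W', hU, hxs, hs.trans inf_le_right, ?_⟩
  have h1 : Algebra.IsStandardSmoothOfRelativeDimension (d + 1) k (Sec g W'.1) :=
    isStandardSmooth_sec g hW ⟨x, hxW⟩ e h s rfl
  have : Nontrivial (Sec g W'.1) := by
    have : Nonempty W'.1 := ⟨x, hxs⟩
    exact inferInstanceAs (Nontrivial Γ(V, W'.1))
  have h2 : Algebra.IsStandardSmooth k (Sec g W'.1) := h1.isStandardSmooth
  have h3 := h1.rank_kaehlerDifferential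
  have b : Module.Basis (Fin (d + 1)) (Sec g W'.1) (Ω[Sec g W'.1⁄k]) :=
    (Module.finBasisOfFinrankEq _ _ (Module.finrank_eq_of_rank_eq h3))
  have : Algebra.FormallySmooth k (Sec g W'.1) := inferInstance
  refine isGoodChart hj.comp_eq hj.isNormalCrossingVariety W' hU
    (a := resHom (X := V) hW₁ a) (resHom_mem_nonZeroDivisors hW₁ ha) ?_ b
  rw [← j.ker.map_ideal hW₁, hI, Ideal.map_span, Set.image_singleton]
  rfl

end NormalCrossing

/-! ### Locally bijective morphisms of presheaves of modules -/

namespace NormalCrossing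

open AlgebraicGeometry.Scheme

variable {X : Scheme.{u}}

lemma isLocallyInjective_of_forall {M N : X.PresheafOfModules} (φ : M ⟶ N)
    (h : ∀ (U : X.Opens) (m : M.obj (.op U)), φ.app (.op U) m = 0 → ∀ x ∈ U,
      ∃ (U' : X.Opens) (i : U' ≤ U), x ∈ U' ∧ M.map (homOfLE i).op m = 0) :
    Presheaf.IsLocallyInjective (Opens.grothendieckTopology X)
      ((PresheafOfModules.toPresheaf _).map φ) := by
  constructor
  intro U m m' hm x hx
  obtain ⟨U', i, hx', hU'⟩ := h U.unop (m - m')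
    ((map_sub (φ.app U).hom m m').trans (sub_eq_zero.2 hm)) x hx
  exact ⟨U', homOfLE i, sub_eq_zero.1 ((map_sub (M.map (homOfLE i).op).hom m m').symm.trans hU'),
    hx'⟩

lemma isLocallySurjective_of_forall {M N : X.PresheafOfModules} (φ : M ⟶ N)
    (h : ∀ (U : X.Opens) (n : N.obj (.op U)), ∀ x ∈ U,
      ∃ (U' : X.Opens) (i : U' ≤ U), x ∈ U' ∧
        ∃ m : M.obj (.op U'), φ.app (.op U') m = N.map (homOfLE i).op n) :
    Presheaf.IsLocallySurjective (Opens.grothendieckTopology X)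
      ((PresheafOfModules.toPresheaf _).map φ) := by
  constructor
  intro U n x hx
  obtain ⟨U', i, hx', m, hm⟩ := h U n x hx
  exact ⟨U', homOfLE i, ⟨m, hm⟩, hx'⟩

lemma isIso_sheafification_map {M N : X.PresheafOfModules} (φ : M ⟶ N)
    (hinj : ∀ (U : X.Opens) (m : M.obj (.op U)), φ.app (.op U) m = 0 → ∀ x ∈ U,
      ∃ (U' : X.Opens) (i : U' ≤ U), x ∈ U' ∧ M.map (homOfLE i).op m = 0)
    (hsurj : ∀ (U : X.Opens) (n : N.obj (.op U)), ∀ x ∈ U,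
      ∃ (U' : X.Opens) (i : U' ≤ U), x ∈ U' ∧
        ∃ m : M.obj (.op U'), φ.app (.op U') m = N.map (homOfLE i).op n) :
    IsIso ((PresheafOfModules.sheafification (𝟙 X.ringCatSheaf.obj)).map φ) := by
  have h1 := isLocallyInjective_of_forall φ hinj
  have h2 := isLocallySurjective_of_forall φ hsurj
  have h3 : ((Opens.grothendieckTopology X).W.inverseImage
      (PresheafOfModules.toPresheaf X.ringCatSheaf.obj)) φ :=
    (Opens.grothendieckTopology X).W_of_isLocallyBijective _
  rw [PresheafOfModules.inverseImage_W_toPresheaf_eq_inverseImage_isomorphisms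
    (𝟙 X.ringCatSheaf.obj)] at h3
  exact h3

/-- A locally bijective morphism of presheaves of modules becomes an isomorphism after
sheafification. -/
def sheafifyIsoOfLocallyBijective {M N : X.PresheafOfModules} (φ : M ⟶ N)
    (hinj : ∀ (U : X.Opens) (m : M.obj (.op U)), φ.app (.op U) m = 0 → ∀ x ∈ U,
      ∃ (U' : X.Opens) (i : U' ≤ U), x ∈ U' ∧ M.map (homOfLE i).op m = 0)
    (hsurj : ∀ (U : X.Opens) (n : N.obj (.op U)), ∀ x ∈ U,
      ∃ (U' : X.Opens) (i : U' ≤ U), x ∈ U' ∧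
        ∃ m : M.obj (.op U'), φ.app (.op U') m = N.map (homOfLE i).op n) :
    sheafify M ≅ sheafify N :=
  let e := @asIso _ _ _ _ _ (isIso_sheafification_map φ hinj hsurj)
  { hom := e.hom
    inv := e.inv
    hom_inv_id := e.hom_inv_id
    inv_hom_id := e.inv_hom_id }

/-- The sheafification of a sheaf of modules is the sheaf itself. -/
def sheafifyValIso (L : X.Modules) : sheafify L.val ≅ L :=
  let e := (asIso (PresheafOfModules.sheafificationAdjunction (𝟙 X.ringCatSheaf.obj)).counit).app L
  { hom := e.hom
    inv := e.inv
    hom_inv_id := e.hom_inv_id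
    inv_hom_id := e.inv_hom_id }

/-- A locally bijective morphism of sheaves of modules is an isomorphism. -/
lemma isIso_of_locallyBijective {M N : X.Modules} (φ : M ⟶ N)
    (hinj : ∀ (U : X.Opens) (m : M.val.obj (.op U)), φ.val.app (.op U) m = 0 → ∀ x ∈ U,
      ∃ (U' : X.Opens) (i : U' ≤ U), x ∈ U' ∧ M.val.map (homOfLE i).op m = 0)
    (hsurj : ∀ (U : X.Opens) (n : N.val.obj (.op U)), ∀ x ∈ U,
      ∃ (U' : X.Opens) (i : U' ≤ U), x ∈ U' ∧
        ∃ m : M.val.obj (.op U'), φ.val.app (.op U') m = N.val.map (homOfLE i).op n) :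
    IsIso φ := by
  let F := PresheafOfModules.sheafificationAdjunction (𝟙 X.ringCatSheaf.obj)
  have h1 : IsIso ((PresheafOfModules.sheafification (𝟙 X.ringCatSheaf.obj)).map φ.val) :=
    isIso_sheafification_map φ.val hinj hsurj
  have h2 := F.counit.naturality (X := M) (Y := N) φ
  have hF : IsIso F.counit := inferInstanceAs
    (IsIso (PresheafOfModules.sheafificationAdjunction (𝟙 X.ringCatSheaf.obj)).counit)
  have hF' (L) : IsIso (F.counit.app L) := NatTrans.isIso_iff_isIso_app F.counit |>.1 hF L
  have h3 : IsIso (F.counit.app M ≫ (𝟭 _).map φ) := by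
    rw [← h2]
    exact @IsIso.comp_isIso _ _ _ _ _ _ _ h1 (hF' N)
  have h4 : @IsIso (SheafOfModules X.ringCatSheaf) _ M N φ :=
    @IsIso.of_isIso_comp_left _ _ _ _ _ (F.counit.app M) φ (hF' M) h3
  obtain ⟨i, h5, h6⟩ := h4
  exact ⟨i, h5, h6⟩

end NormalCrossing

/-! ### The normal presheaf is a sheaf -/

namespace NormalCrossing

open AlgebraicGeometry.Scheme

variable {X V : Scheme.{u}} {j : X ⟶ V}

/-- Sections of the structure sheaf which agree locally are equal. -/
lemma resHom_ext {U : X.Opens} {a b : Γ(X, U)}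
    (h : ∀ x ∈ U, ∃ (U' : X.Opens) (i : U' ≤ U), x ∈ U' ∧ resHom i a = resHom i b) : a = b := by
  choose U' i hx hU' using h
  refine X.sheaf.eq_of_locally_eq' (fun x : U => U' x.1 x.2) U (fun x => homOfLE (i x.1 x.2))
    (fun x hx' => ?_) a b fun x => hU' x.1 x.2
  exact Opens.mem_iSup.2 ⟨⟨x, hx'⟩, hx x hx'⟩

/-- Sections of the structure sheaf which agree locally on overlaps can be glued. -/
lemma exists_resHom_eq {U : X.Opens} {ι : Type*} {O : ι → X.Opens} (hO : ∀ i, O i ≤ U)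
    (hU : ∀ x ∈ U, ∃ i, x ∈ O i) (s : ∀ i, Γ(X, O i))
    (h : ∀ i i', ∀ x ∈ O i, x ∈ O i' → ∃ (U' : X.Opens) (h : U' ≤ O i) (h' : U' ≤ O i'),
      x ∈ U' ∧ resHom h (s i) = resHom h' (s i')) :
    ∃ a : Γ(X, U), ∀ i, resHom (hO i) a = s i := by
  obtain ⟨a, ha, -⟩ := X.sheaf.existsUnique_gluing' O U (fun i => homOfLE (hO i))
    (fun x hx => Opens.mem_iSup.2 (hU x hx)) s fun i i' => by
      refine resHom_ext (X := X) (U := O i ⊓ O i') fun x hx => ?_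
      obtain ⟨U', h1, h2, hxU', h3⟩ := h i i' x hx.1 hx.2
      refine ⟨U', le_inf h1 h2, hxU', ?_⟩
      exact ((resHom_resHom (X := X) inf_le_left (le_inf h1 h2) (s i)).trans h3).trans
        (resHom_resHom (X := X) inf_le_right (le_inf h1 h2) (s i')).symm
  exact ⟨a, ha⟩

/-- The restriction of sections of the ideal sheaf of `j`. -/
def kerRes (j : X ⟶ V) {W W' : V.affineOpens} (h : W' ≤ W) (x : j.ker.ideal W) : j.ker.ideal W' :=
  ⟨resHom (X := V) h x.1, j.ker.ideal_le_comap_ideal h x.2⟩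

lemma kerRes_kerRes {W W' W'' : V.affineOpens} (h : W' ≤ W) (h' : W'' ≤ W') (x : j.ker.ideal W) :
    kerRes j h' (kerRes j h x) = kerRes j (h'.trans h) x :=
  Subtype.ext (resHom_resHom (X := V) h h' x.1)

lemma app_resHom {W W' : V.Opens} (h : W' ≤ W) (b : Γ(V, W)) :
    resHom (j.preimage_mono h) ((j.app W).hom b) = (j.app W').hom (resHom h b) :=
  (ConcreteCategory.congr_hom (j.naturality (homOfLE h).op) b).symm

/-- An open subset of `X` containing `x` contains the preimage of an affine open neighbourhood of
`j x`, which may be taken inside a given neighbourhood `O`. -/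
lemma exists_affine_preimage_le [IsClosedImmersion j] {x : X} {U : X.Opens} (hx : x ∈ U)
    {O : V.Opens} (hO : j x ∈ O) :
    ∃ W : V.affineOpens, j x ∈ W.1 ∧ W.1 ≤ O ∧ j ⁻¹ᵁ W.1 ≤ U := by
  obtain ⟨T, hT, hTU⟩ := j.isClosedEmbedding.isInducing.isOpen_iff.1 U.2
  have hxT : j x ∈ T := by
    have : x ∈ j ⁻¹' T := hTU ▸ hx
    exact this
  obtain ⟨_, ⟨W, hW, rfl⟩, hxW, hWO⟩ := V.isBasis_affineOpens.exists_subset_of_mem_open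
    (show j x ∈ T ∩ O from ⟨hxT, hO⟩) (hT.inter O.2)
  refine ⟨⟨W, hW⟩, hxW, fun y hy => (hWO hy).2, fun y hy => ?_⟩
  have : y ∈ j ⁻¹' T := (hWO hy).1
  rw [hTU] at this
  exact this

set_option maxHeartbeats 400000 in
/-- Compatible families on the members of an open cover glue: on a chart `W`, a homomorphism
`I/I² → 𝒪_X` can be defined locally on `j⁻¹ W`, as `𝒪_X` is a sheaf. -/
lemma NormalFamily.existsUnique_gluing [IsClosedImmersion j] {ι : Type*} {U : ι → X.Opens}
    (sf : ∀ i, NormalFamily j (U i))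
    (hsf' : ∀ (i i' : ι) (W : V.affineOpens) (h : j ⁻¹ᵁ W.1 ≤ U i) (h' : j ⁻¹ᵁ W.1 ≤ U i'),
      (sf i).1 ⟨W, h⟩ = (sf i').1 ⟨W, h'⟩) :
    ∃! t : NormalFamily j (iSup U), ∀ i, restrict j (le_iSup U i) t = sf i := by
  -- the sections of `I/I²` are evaluated on the charts lying over one of the `U i`
  let Idx (W : V.affineOpens) := Σ i : ι, {W' : V.affineOpens // W' ≤ W ∧ j ⁻¹ᵁ W'.1 ≤ U i}
  have hcov (W : V.affineOpens) (hW : j ⁻¹ᵁ W.1 ≤ iSup U) (x : X) (hx : x ∈ j ⁻¹ᵁ W.1) :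
      ∃ p : Idx W, x ∈ j ⁻¹ᵁ p.2.1.1 := by
    obtain ⟨i, hi⟩ := Opens.mem_iSup.1 (hW hx)
    obtain ⟨W', h1, h2, h3⟩ := exists_affine_preimage_le hi hx
    exact ⟨⟨i, W', h2, h3⟩, h1⟩
  have hglue (W : V.affineOpens) (hW : j ⁻¹ᵁ W.1 ≤ iSup U) (x : j.ker.ideal W) :
      ∃ a : Γ(X, j ⁻¹ᵁ W.1), ∀ p : Idx W, resHom (j.preimage_mono p.2.2.1) a =
        (sf p.1).1 ⟨p.2.1, p.2.2.2⟩ (Ideal.toCotangent _ (kerRes j p.2.2.1 x)) := by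
    refine exists_resHom_eq (fun p : Idx W => j.preimage_mono p.2.2.1) (hcov W hW) _ ?_
    rintro ⟨i, W₁, h₁, h₁'⟩ ⟨i', W₂, h₂, h₂'⟩ y hy hy'
    obtain ⟨W₃, h3, h4, -⟩ := exists_affine_preimage_le (U := ⊤) trivial
      (show j y ∈ W₁.1 ⊓ W₂.1 from ⟨hy, hy'⟩)
    have h31 : W₃ ≤ W₁ := h4.trans inf_le_left
    have h32 : W₃ ≤ W₂ := h4.trans inf_le_right
    refine ⟨j ⁻¹ᵁ W₃.1, j.preimage_mono h31, j.preimage_mono h32, h3, ?_⟩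
    refine ((sf i).2 ⟨W₁, h₁'⟩ ⟨W₃, (j.preimage_mono h31).trans h₁'⟩ h31 _).trans ?_
    refine Eq.trans ?_ ((sf i').2 ⟨W₂, h₂'⟩ ⟨W₃, (j.preimage_mono h32).trans h₂'⟩ h32 _).symm
    rw [hsf' i i' W₃ _ ((j.preimage_mono h32).trans h₂')]
    congr 2
    exact (kerRes_kerRes h₁ h31 x).trans (kerRes_kerRes h₂ h32 x).symm
  choose v hv using hglue
  have hext {W : V.affineOpens} (hW : j ⁻¹ᵁ W.1 ≤ iSup U) {a b : Γ(X, j ⁻¹ᵁ W.1)}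
      (h : ∀ p : Idx W, resHom (j.preimage_mono p.2.2.1) a = resHom (j.preimage_mono p.2.2.1) b) :
      a = b := by
    refine resHom_ext fun x hx => ?_
    obtain ⟨p, hp⟩ := hcov W hW x hx
    exact ⟨_, _, hp, h p⟩
  have hl (W : AffineOver j (iSup U)) : ∃ l : NormalModule j W.1,
      ∀ x, l (Ideal.toCotangent _ x) = v W.1 W.2 x := by
    refine exists_cotangent_map _ (fun x hx => j.ideal_ker_le W.1 hx) _ (fun x y => ?_)
      fun b x => ?_
    · refine hext W.2 fun p => ?_
      rw [map_add, hv, hv, hv, ← map_add, ← map_add]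
      congr 2
      exact Subtype.ext (map_add (resHom (X := V) p.2.2.1) x.1 y.1)
    · refine hext W.2 fun p => ?_
      refine (hv W.1 W.2 (b • x) p).trans (Eq.trans ?_ (map_mul (resHom _) _ _).symm)
      refine Eq.trans ?_ (congrArg₂ (· * ·) (app_resHom p.2.2.1 b).symm (hv W.1 W.2 x p).symm)
      have h1 : kerRes j p.2.2.1 (b • x) = resHom (X := V) p.2.2.1 b • kerRes j p.2.2.1 x :=
        Subtype.ext (map_mul (resHom (X := V) p.2.2.1) b x.1)
      refine (congrArg (fun y => (sf p.1).1 ⟨p.2.1, p.2.2.2⟩ (Ideal.toCotangent _ y)) h1).trans ?_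
      refine (congrArg ((sf p.1).1 ⟨p.2.1, p.2.2.2⟩) (map_smul (Ideal.toCotangent _) _ _)).trans ?_
      exact map_smulₛₗ ((sf p.1).1 ⟨p.2.1, p.2.2.2⟩) _ _
  choose l hl using hl
  have hmem : l ∈ NormalFamily j (iSup U) := by
    intro W W' h x
    refine (congrArg (resHom (j.preimage_mono h)) (hl W x)).trans (Eq.trans ?_ (hl W' _).symm)
    refine hext W'.2 fun p => ?_
    refine (resHom_resHom _ _ _).trans ?_
    refine (hv W.1 W.2 x ⟨p.1, p.2.1, p.2.2.1.trans h, p.2.2.2⟩).trans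
      (Eq.trans ?_ (hv W'.1 W'.2 _ p).symm)
    congr 2
    exact (kerRes_kerRes h p.2.2.1 x).symm
  refine ⟨⟨l, hmem⟩, fun i => ?_, fun t' ht' => ?_⟩
  · refine Subtype.ext (funext fun W => LinearMap.ext fun y => ?_)
    obtain ⟨x, rfl⟩ := Ideal.toCotangent_surjective _ y
    have h1 : j ⁻¹ᵁ W.1.1 ≤ iSup U := W.2.trans (le_iSup U i)
    refine (hl ⟨W.1, h1⟩ x).trans (hext h1 fun p => ?_)
    refine (hv W.1 h1 x p).trans ?_
    refine Eq.trans ?_ ((sf i).2 W ⟨p.2.1, (j.preimage_mono p.2.2.1).trans W.2⟩ p.2.2.1 x).symm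
    exact LinearMap.congr_fun
      (hsf' p.1 i p.2.1 p.2.2.2 ((j.preimage_mono p.2.2.1).trans W.2)) _
  · refine Subtype.ext (funext fun W => LinearMap.ext fun y => ?_)
    obtain ⟨x, rfl⟩ := Ideal.toCotangent_surjective _ y
    refine Eq.trans (hext W.2 fun p => ?_) (hl W x).symm
    refine Eq.trans ?_ (hv W.1 W.2 x p).symm
    refine (t'.2 W ⟨p.2.1, (j.preimage_mono p.2.2.1).trans W.2⟩ p.2.2.1 x).trans ?_
    exact LinearMap.congr_fun (congrFun (congrArg Subtype.val (ht' p.1)) ⟨p.2.1, p.2.2.2⟩) _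

variable (j) in
theorem isSheaf_normalPresheaf [IsClosedImmersion j] :
    TopCat.Presheaf.IsSheaf (normalPresheaf j).presheaf := by
  rw [TopCat.Presheaf.isSheaf_iff_isSheafUniqueGluing]
  intro ι U (sf : ∀ i, NormalFamily j (U i)) hsf
  obtain ⟨t, ht, h⟩ := NormalFamily.existsUnique_gluing sf fun i i' W h h' => by
    have := hsf i i'
    exact congrFun (congrArg (Subtype.val (p := fun t => t ∈ NormalFamily j (U i ⊓ U i'))) this)
      ⟨W, le_inf h h'⟩
  exact ⟨t, ht, h⟩

variable (j) in
/-- The normal sheaf, described by the families of homomorphisms on the affine charts. -/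
def normalModules [IsClosedImmersion j] : X.Modules := ⟨normalPresheaf j, isSheaf_normalPresheaf j⟩

end NormalCrossing

/-! ### The normal sheaf is a line bundle -/

namespace NormalCrossing

open AlgebraicGeometry.Scheme

variable {X V : Scheme.{u}} {j : X ⟶ V}

lemma isAffineOpen_inf_of_isSeparated {S : Scheme.{u}} [IsAffine S] (g : V ⟶ S) [IsSeparated g]
    (W W' : V.affineOpens) : IsAffineOpen (W.1 ⊓ W'.1) :=
  isAffineHom_diagonal_iff.1 (show IsAffineHom (Limits.pullback.diagonal g) from inferInstance) ⊤
    (isAffineOpen_top S) W.1 le_top W'.1 le_top W.2 W'.2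

lemma ideal_ker_eq_span_of_le {W W' : V.affineOpens} (h : W' ≤ W) {a : Γ(V, W.1)}
    (hI : j.ker.ideal W = Ideal.span {a}) :
    j.ker.ideal W' = Ideal.span {resHom (X := V) h a} := by
  rw [← j.ker.map_ideal h, hI, Ideal.map_span, Set.image_singleton]
  rfl

lemma resHom_self {U : X.Opens} (h : U ≤ U) (a : Γ(X, U)) : resHom h a = a :=
  resHom_ext fun _ hx => ⟨U, le_rfl, hx, resHom_resHom _ _ _⟩

namespace NormalFamily

lemma apply_eq_resHom {U : X.Opens} (t : NormalFamily j U) {W W' : V.affineOpens}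
    (hW : j ⁻¹ᵁ W.1 ≤ U) (hW' : j ⁻¹ᵁ W'.1 ≤ U) (h : W' ≤ W) (h' : j ⁻¹ᵁ W.1 ≤ j ⁻¹ᵁ W'.1)
    (x : j.ker.ideal W) : t.1 ⟨W, hW⟩ (Ideal.toCotangent _ x) =
      resHom h' (t.1 ⟨W', hW'⟩ (Ideal.toCotangent _ (kerRes j h x))) := by
  refine Eq.trans ?_ (congrArg (resHom h') (t.2 ⟨W, hW⟩ ⟨W', hW'⟩ h x))
  rw [resHom_resHom, resHom_self]

lemma apply_mul {U : X.Opens} (t : NormalFamily j U) {W : V.affineOpens} (hW : j ⁻¹ᵁ W.1 ≤ U)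
    (b : Γ(V, W.1)) (x : j.ker.ideal W) : t.1 ⟨W, hW⟩ (Ideal.toCotangent _ (b • x)) =
      (j.app W.1).hom b * t.1 ⟨W, hW⟩ (Ideal.toCotangent _ x) :=
  (congrArg (t.1 ⟨W, hW⟩) (map_smul (Ideal.toCotangent _) b x)).trans
    (map_smulₛₗ (t.1 ⟨W, hW⟩) b _)

/-- The sections of the normal presheaf over `j⁻¹ W` are determined by their value at a generator
of `I(W)`. -/
lemma ext_of_generator (hV : ∀ W W' : V.affineOpens, IsAffineOpen (W.1 ⊓ W'.1)) {W : V.affineOpens}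
    {a : j.ker.ideal W} (hI : j.ker.ideal W = Ideal.span {a.1})
    {t t' : NormalFamily j (j ⁻¹ᵁ W.1)} (h : t.1 ⟨W, le_rfl⟩ (Ideal.toCotangent _ a) =
      t'.1 ⟨W, le_rfl⟩ (Ideal.toCotangent _ a)) : t = t' := by
  refine Subtype.ext (funext fun ⟨W', hW'⟩ => LinearMap.ext fun y => ?_)
  obtain ⟨x, rfl⟩ := Ideal.toCotangent_surjective _ y
  let W'' : V.affineOpens := ⟨W'.1 ⊓ W.1, hV W' W⟩
  have h1 : W'' ≤ W' := inf_le_left (a := W'.1)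
  have h2 : W'' ≤ W := inf_le_right (a := W'.1)
  have h3 : j ⁻¹ᵁ W'.1 ≤ j ⁻¹ᵁ W''.1 := le_inf le_rfl hW'
  obtain ⟨b, hb⟩ : ∃ b, b • kerRes j h2 a = kerRes j h1 x := by
    obtain ⟨b, hb⟩ := Ideal.mem_span_singleton'.1
      ((ideal_ker_eq_span_of_le h2 hI).le (kerRes j h1 x).2)
    exact ⟨b, Subtype.ext hb⟩
  have key (t : NormalFamily j (j ⁻¹ᵁ W.1)) : t.1 ⟨W', hW'⟩ (Ideal.toCotangent _ x) =
      resHom h3 ((j.app W''.1).hom b * resHom (j.preimage_mono h2)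
        (t.1 ⟨W, le_rfl⟩ (Ideal.toCotangent _ a))) := by
    refine (apply_eq_resHom t hW' (j.preimage_mono h2) h1 h3 x).trans (congrArg (resHom h3) ?_)
    rw [← hb]
    refine (apply_mul t (j.preimage_mono h2) b _).trans (congrArg _ ?_)
    exact (t.2 ⟨W, le_rfl⟩ ⟨W'', j.preimage_mono h2⟩ h2 a).symm
  rw [key t, key t', h]

end NormalFamily

/-- A section of the normal presheaf over `j⁻¹ W` taking the value one at the generator `a` of
`I(W)` and its restrictions. -/
def IsDual {W : V.affineOpens} (a : j.ker.ideal W) (t : NormalFamily j (j ⁻¹ᵁ W.1)) : Prop :=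
  ∀ (W' : V.affineOpens) (h : W' ≤ W),
    t.1 ⟨W', j.preimage_mono h⟩ (Ideal.toCotangent _ (kerRes j h a)) = 1

/-- On a chart where `I(W)` is generated by the nonzerodivisor `a`, the normal presheaf has a
section with the value one at `a`. -/
lemma exists_dual (hV : ∀ W W' : V.affineOpens, IsAffineOpen (W.1 ⊓ W'.1)) {W : V.affineOpens}
    {a : j.ker.ideal W} (ha : a.1 ∈ nonZeroDivisors Γ(V, W.1))
    (hI : j.ker.ideal W = Ideal.span {a.1}) :
    ∃ t : NormalFamily j (j ⁻¹ᵁ W.1), IsDual a t := by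
  have hl (W' : V.affineOpens) (h : W' ≤ W) := exists_normal_functional (j.app W'.1).hom
    (resHom_mem_nonZeroDivisors h ha) (ideal_ker_eq_span_of_le h hI)
    (fun x hx => j.ideal_ker_le W' hx)
  choose l hl using hl
  have hgen {W' : V.affineOpens} (h : W' ≤ W) (x : j.ker.ideal W') :
      ∃ b, b * resHom (X := V) h a.1 = x.1 :=
    Ideal.mem_span_singleton'.1 ((ideal_ker_eq_span_of_le h hI).le x.2)
  have hl' {W' : V.affineOpens} (h : W' ≤ W) {x : j.ker.ideal W'} {b : Γ(V, W'.1)}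
      (hb : b * resHom (X := V) h a.1 = x.1) :
      l W' h (Ideal.toCotangent _ x) = (j.app W'.1).hom b := by
    obtain ⟨x, hx⟩ := x
    obtain rfl : b * resHom (X := V) h a.1 = x := hb
    exact hl W' h b hx
  have hcompat {W' W'' : V.affineOpens} (h : W' ≤ W) (h' : W'' ≤ W') (x : j.ker.ideal W') :
      resHom (j.preimage_mono h') (l W' h (Ideal.toCotangent _ x)) =
        l W'' (h'.trans h) (Ideal.toCotangent _ (kerRes j h' x)) := by
    obtain ⟨b, hb⟩ := hgen h x
    refine (congrArg _ (hl' h hb)).trans ((app_resHom h' b).trans (hl' (h'.trans h) ?_).symm)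
    change _ = resHom (X := V) h' x.1
    rw [← hb, map_mul, resHom_resHom]
  -- on an arbitrary chart `W'` over `j⁻¹ W`, the section is determined on `W' ∩ W`, which has the
  -- same trace on `X`
  let In (W' : V.affineOpens) : V.affineOpens := ⟨W'.1 ⊓ W.1, hV W' W⟩
  have h1 (W' : V.affineOpens) : In W' ≤ W' := inf_le_left (a := W'.1)
  have h2 (W' : V.affineOpens) : In W' ≤ W := inf_le_right (a := W'.1)
  have h5 (W' : AffineOver j (j ⁻¹ᵁ W.1)) : j ⁻¹ᵁ W'.1.1 ≤ j ⁻¹ᵁ (In W'.1).1 := le_inf le_rfl W'.2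
  have ht (W' : AffineOver j (j ⁻¹ᵁ W.1)) : ∃ t : NormalModule j W'.1, ∀ x,
      t (Ideal.toCotangent _ x) = resHom (h5 W')
        (l (In W'.1) (h2 W'.1) (Ideal.toCotangent _ (kerRes j (h1 W'.1) x))) := by
    refine exists_cotangent_map _ (fun x hx => j.ideal_ker_le W'.1 hx) _ (fun x y => ?_)
      fun b x => ?_
    · rw [← map_add, ← map_add, ← map_add]
      congr 3
      exact Subtype.ext (map_add (resHom (X := V) (h1 W'.1)) x.1 y.1)
    · obtain ⟨c, hc⟩ := hgen (h2 W'.1) (kerRes j (h1 W'.1) x)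
      have h3 : resHom (X := V) (h1 W'.1) b * c * resHom (X := V) (h2 W'.1) a.1 =
          (kerRes j (h1 W'.1) (b • x)).1 := by
        rw [mul_assoc, hc]
        exact (map_mul (resHom (X := V) (h1 W'.1)) b x.1).symm
      rw [hl' (h2 W'.1) hc, hl' (h2 W'.1) h3, map_mul, map_mul, ← app_resHom (h1 W'.1),
        resHom_resHom, resHom_self]
  choose t ht using ht
  have htl {W' : V.affineOpens} (h : W' ≤ W) (x : j.ker.ideal W') :
      t ⟨W', j.preimage_mono h⟩ (Ideal.toCotangent _ x) = l W' h (Ideal.toCotangent _ x) := by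
    refine (ht ⟨W', j.preimage_mono h⟩ x).trans ?_
    refine (congrArg (resHom _) (hcompat h (h1 W') x).symm).trans ?_
    rw [resHom_resHom, resHom_self]
  refine ⟨⟨t, fun W₁ W₂ h x => ?_⟩, fun W' h => ?_⟩
  · have h12 : In W₂.1 ≤ In W₁.1 := inf_le_inf_right W.1 h
    refine (congrArg (resHom (j.preimage_mono h)) (ht W₁ x)).trans (Eq.trans ?_ (ht W₂ _).symm)
    rw [resHom_resHom]
    have h3 := hcompat (h2 W₁.1) h12 (kerRes j (h1 W₁.1) x)
    have h4 : kerRes j h12 (kerRes j (h1 W₁.1) x) = kerRes j (h1 W₂.1) (kerRes j h x) :=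
      (kerRes_kerRes _ _ x).trans (kerRes_kerRes h (h1 W₂.1) x).symm
    rw [h4] at h3
    refine Eq.trans ?_ (congrArg (resHom _) h3)
    rw [resHom_resHom]
  · refine (htl h _).trans ((hl' h (b := 1) (one_mul _)).trans (map_one _))

end NormalCrossing

namespace NormalCrossing

open AlgebraicGeometry.Scheme

variable {X V : Scheme.{u}} {j : X ⟶ V}

lemma NormalFamily.smul_restrict_apply {U U' : X.Opens} (h : U' ≤ U) (c : Γ(X, U'))
    (t : NormalFamily j U) {W : V.affineOpens} (hW : j ⁻¹ᵁ W.1 ≤ U') (x : j.ker.ideal W) :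
    (c • restrict j h t).1 ⟨W, hW⟩ (Ideal.toCotangent _ x) =
      resHom hW c * t.1 ⟨W, hW.trans h⟩ (Ideal.toCotangent _ x) := rfl

lemma IsDual.exists_smul_eq (hV : ∀ W W' : V.affineOpens, IsAffineOpen (W.1 ⊓ W'.1))
    {W : V.affineOpens} {a : j.ker.ideal W} {t : NormalFamily j (j ⁻¹ᵁ W.1)} (ht : IsDual a t)
    (hI : j.ker.ideal W = Ideal.span {a.1}) {W' : V.affineOpens} (h : W' ≤ W) {U : X.Opens}
    (hU : U = j ⁻¹ᵁ W'.1) (hU' : U ≤ j ⁻¹ᵁ W.1) (n : NormalFamily j U) :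
    ∃ c : Γ(X, U), c • NormalFamily.restrict j hU' t = n := by
  subst hU
  refine ⟨n.1 ⟨W', le_rfl⟩ (Ideal.toCotangent _ (kerRes j h a)),
    NormalFamily.ext_of_generator hV (a := kerRes j h a) (ideal_ker_eq_span_of_le h hI) ?_⟩
  rw [NormalFamily.smul_restrict_apply, ht W' h, mul_one, resHom_self]

lemma IsDual.eq_zero_of_smul [IsClosedImmersion j] {W : V.affineOpens} {a : j.ker.ideal W}
    {t : NormalFamily j (j ⁻¹ᵁ W.1)} (ht : IsDual a t) {U : X.Opens} (hU : U ≤ j ⁻¹ᵁ W.1)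
    (c : Γ(X, U)) (hc : c • NormalFamily.restrict j hU t = 0) : c = 0 := by
  refine resHom_ext fun x hx => ?_
  obtain ⟨W', h1, h2, h3⟩ := exists_affine_preimage_le (j := j) hx (hU hx : j x ∈ W.1)
  refine ⟨_, h3, h1, ?_⟩
  have h4 := LinearMap.congr_fun (congrFun (congrArg Subtype.val hc) ⟨W', h3⟩)
    (Ideal.toCotangent _ (kerRes j h2 a))
  rw [NormalFamily.smul_restrict_apply, ht W' h2, mul_one] at h4
  exact h4.trans (map_zero (resHom h3)).symm

/-- If `X` is an effective Cartier divisor on `V`, its normal sheaf is a line bundle: it is freely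
generated by the dual of a local equation. -/
theorem isLineBundle_normalModules [IsClosedImmersion j]
    (hV : ∀ W W' : V.affineOpens, IsAffineOpen (W.1 ⊓ W'.1))
    (hdiv : ∀ x : V, ∃ W : V.affineOpens, x ∈ W.1 ∧
      ∃ a ∈ nonZeroDivisors Γ(V, W.1), j.ker.ideal W = Ideal.span {a}) :
    IsLineBundle (normalModules j) := by
  intro x
  obtain ⟨W, hx, a, ha, hI⟩ := hdiv (j x)
  have haI : a ∈ j.ker.ideal W := by
    rw [hI]
    exact Ideal.mem_span_singleton_self a
  obtain ⟨t, ht⟩ := exists_dual hV (a := ⟨a, haI⟩) ha hI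
  let U : X.Opens := j ⁻¹ᵁ W.1
  refine ⟨U, hx, ?_⟩
  have hle (O : (U : Scheme).Opens) : U.ι ''ᵁ O ≤ j ⁻¹ᵁ W.1 := U.ι_image_le O
  let N : SheafOfModules (U : Scheme).ringCatSheaf := (normalModules j).restrict U.ι
  let s : N.sections := PresheafOfModules.sectionsMk
    (fun O => (NormalFamily.restrict j (hle O.unop) t : NormalFamily j (U.ι ''ᵁ O.unop)))
    fun _ _ _ => rfl
  let φ : structureSheaf (U : Scheme) ⟶ (normalModules j).restrict U.ι := N.unitHomEquiv.symm s
  have hφ (O : (U : Scheme).Opens) (r : Γ(U, O)) :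
      (φ.val.app (.op O) r : NormalFamily j (U.ι ''ᵁ O)) =
        ((U.ι.appIso O).inv r : Γ(X, U.ι ''ᵁ O)) • NormalFamily.restrict j (hle O) t := by
    rfl
  have hinv (O : (U : Scheme).Opens) (r : Γ(U, O)) :
      (U.ι.appIso O).hom ((U.ι.appIso O).inv r) = r :=
    ConcreteCategory.congr_hom (U.ι.appIso O).inv_hom_id r
  have hhom (O : (U : Scheme).Opens) (r : Γ(X, U.ι ''ᵁ O)) :
      (U.ι.appIso O).inv ((U.ι.appIso O).hom r) = r :=
    ConcreteCategory.congr_hom (U.ι.appIso O).hom_inv_id r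
  have : IsIso φ := by
    refine isIso_of_locallyBijective φ (fun O r hr y hy => ⟨O, le_rfl, hy, ?_⟩)
      fun O n y hy => ?_
    · have h1 : ((U.ι.appIso O).inv r : Γ(X, U.ι ''ᵁ O)) = 0 :=
        IsDual.eq_zero_of_smul ht (hle O) _ ((hφ O r).symm.trans hr)
      have h2 : r = (0 : Γ(U, O)) := by
        rw [← hinv O r, h1]
        exact map_zero (U.ι.appIso O).hom.hom
      rw [h2]
      exact map_zero _
    · obtain ⟨W', h1, h2, h3⟩ := exists_affine_preimage_le (j := j) (U := U.ι ''ᵁ O) (x := y.1)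
        ⟨y, hy, rfl⟩ (O := W.1) y.2
      have h4 : U.ι ''ᵁ (U.ι ⁻¹ᵁ (j ⁻¹ᵁ W'.1)) = j ⁻¹ᵁ W'.1 := by
        rw [Hom.image_preimage_eq_opensRange_inf, Opens.opensRange_ι]
        exact inf_eq_right.2 (h3.trans (hle O))
      have h5 : U.ι ⁻¹ᵁ (j ⁻¹ᵁ W'.1) ≤ O := by
        rw [← U.ι.image_le_image_iff, h4]
        exact h3
      obtain ⟨c, hc⟩ := IsDual.exists_smul_eq hV ht hI h2 h4 (hle _)
        (NormalFamily.restrict j (U.ι.image_mono h5) n)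
      refine ⟨U.ι ⁻¹ᵁ (j ⁻¹ᵁ W'.1), h5, h1, (U.ι.appIso _).hom c, ?_⟩
      refine (hφ _ _).trans (Eq.trans ?_ hc)
      rw [hhom]
  exact ⟨(asIso φ).symm⟩

end NormalCrossing

/-! ### The class of a normal vector field -/

namespace TangentCohomology

/-- If the ideal `I` is generated by `a`, the values at `a` of derivations annihilate the classes
of homomorphisms `l : I/I² → A`: if `D` is a derivation, `D(a) l` is induced by `l(a) D`. -/
lemma T1.smul_ofNormal_eq_zero {k A B : Type u} [CommRing k] [CommRing A] [Algebra k A]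
    [CommRing B] [Algebra k B] (f : B →ₐ[k] A) (hf : Function.Surjective f) {I : Ideal B}
    (hI : RingHom.ker f = I) {a : B} (ha : I = Ideal.span {a}) {D : B →ₗ[k] A}
    (hD : IsDerivationAlong f D) (l : I.Cotangent →ₛₗ[f.toRingHom] A) :
    D a • T1.ofNormal f hf hI l = 0 := by
  have haI : a ∈ I := ha ▸ Ideal.mem_span_singleton_self a
  rw [← map_smul]
  refine T1.ofNormal_eq_zero_of_derivation f hf hI (D := l (I.toCotangent ⟨a, haI⟩) • D)
    (fun b b' => ?_) fun x => ?_
  · simp only [LinearMap.smul_apply, smul_eq_mul, hD b b']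
    ring
  · obtain ⟨x, hx⟩ := x
    obtain ⟨b, rfl⟩ := Ideal.mem_span_singleton'.1 (ha.le hx)
    have h1 : l (I.toCotangent ⟨b * a, hx⟩) = f b * l (I.toCotangent ⟨a, haI⟩) :=
      (congrArg l (map_smul I.toCotangent b ⟨a, haI⟩)).trans (map_smulₛₗ l _ _)
    have h2 : f a = 0 := (RingHom.mem_ker (f := f)).1 (hI.symm ▸ haI)
    rw [LinearMap.smul_apply, LinearMap.smul_apply, hD b a, h1, h2, smul_eq_mul, smul_eq_mul]
    ring

end TangentCohomology

namespace NormalCrossing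

open TangentCohomology AlgebraicGeometry.Scheme

variable {k : Type u} [Field k] {X V : Scheme.{u}} {f : X ⟶ Spec (.of k)} {g : V ⟶ Spec (.of k)}
  {j : X ⟶ V} [IsClosedImmersion j] {d : ℕ}

/-- The class in `T¹` of a section of the normal sheaf over the preimage of an affine open subset
of `V`. -/
def normalClass (h : j ≫ g = f) (W : V.affineOpens) (l : NormalModule j W) :
    T1 k (Sec f (j ⁻¹ᵁ W.1)) (Sec f (j ⁻¹ᵁ W.1)) :=
  T1.ofNormal (pullSec h W.1) (pullSec_surjective h W.2) (ker_pullSec h W) l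

lemma normalClass_add (h : j ≫ g = f) (W : V.affineOpens) (l l' : NormalModule j W) :
    normalClass h W (l + l') = normalClass h W l + normalClass h W l' :=
  map_add (T1.ofNormal (pullSec h W.1) (pullSec_surjective h W.2) (ker_pullSec h W)) l l'

lemma normalClass_smul (h : j ≫ g = f) (W : V.affineOpens) (c : Γ(X, j ⁻¹ᵁ W.1))
    (l : NormalModule j W) :
    normalClass h W (c • l) = HSMul.hSMul (α := Sec f (j ⁻¹ᵁ W.1)) c (normalClass h W l) :=
  (T1.ofNormal (pullSec h W.1) (pullSec_surjective h W.2) (ker_pullSec h W)).map_smul c l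

lemma compatible_normalClass_of_le (h : j ≫ g = f) {W W' : V.affineOpens} (hW : W' ≤ W)
    (l : NormalModule j W) (l' : NormalModule j W')
    (hl : ∀ x : j.ker.ideal W, resHom (j.preimage_mono hW) (l (Ideal.toCotangent _ x)) =
      l' (Ideal.toCotangent _ (kerRes j hW x))) :
    T1.Compatible (Sec.res f (j.preimage_mono hW)) (normalClass h W l) (normalClass h W' l') :=
  T1.Compatible.ofNormal (pullSec h W.1) (pullSec_surjective h W.2) (ker_pullSec h W)
    (pullSec_surjective h W'.2) (ker_pullSec h W') (g := Sec.res g hW) (fun b => pullSec_res h hW b)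
    fun x _ => (hl x).symm

/-- The classes of a section of the normal sheaf are compatible with restriction. -/
lemma compatible_normalClass (h : j ≫ g = f)
    (hV : ∀ W W' : V.affineOpens, IsAffineOpen (W.1 ⊓ W'.1)) {U : X.Opens} (n : NormalFamily j U)
    {W W' : V.affineOpens} (hW : j ⁻¹ᵁ W.1 ≤ U) (hW' : j ⁻¹ᵁ W'.1 ≤ U)
    (hWW' : j ⁻¹ᵁ W'.1 ≤ j ⁻¹ᵁ W.1) :
    T1.Compatible (Sec.res f hWW') (normalClass h W (n.1 ⟨W, hW⟩))
      (normalClass h W' (n.1 ⟨W', hW'⟩)) := by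
  -- `W ∩ W'` has the same trace on `X` as `W'`
  let W'' : V.affineOpens := ⟨W.1 ⊓ W'.1, hV W W'⟩
  have h1 : W'' ≤ W := inf_le_left (a := W.1)
  have h2 : W'' ≤ W' := inf_le_right (a := W.1)
  have h3 : j ⁻¹ᵁ W'.1 ≤ j ⁻¹ᵁ W''.1 := le_inf hWW' le_rfl
  have h4 : j ⁻¹ᵁ W''.1 ≤ U := (j.preimage_mono h2).trans hW'
  have h5 := compatible_normalClass_of_le h h1 _ _ (n.2 ⟨W, hW⟩ ⟨W'', h4⟩ h1)
  have h6 := compatible_normalClass_of_le h h2 _ _ (n.2 ⟨W', hW'⟩ ⟨W'', h4⟩ h2)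
  have h7 := compatible_normalClass_of_le h (le_refl W') _ _ (n.2 ⟨W', hW'⟩ ⟨W', hW'⟩ le_rfl)
  refine T1.Compatible.trans (φ := Sec.res f (j.preimage_mono h1)) (ψ := Sec.res f h3)
    (AlgHom.ext fun c => (resHom_resHom _ _ c).symm) h5 ?_
  exact T1.Compatible.cancel (φ := Sec.res f (j.preimage_mono h2)) (ψ := Sec.res f h3)
    (etale_res f (W'.2.preimage j) (W''.2.preimage j) _)
    (χ := Sec.res f le_rfl) (AlgHom.ext fun c => (resHom_resHom _ _ c).symm) h6 h7

omit [IsClosedImmersion j] in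
lemma NormalModule.ext_of_generator {W : V.affineOpens} {a : j.ker.ideal W}
    (hI : j.ker.ideal W = Ideal.span {a.1}) {l l' : NormalModule j W}
    (h : l (Ideal.toCotangent _ a) = l' (Ideal.toCotangent _ a)) : l = l' := by
  ext x
  obtain ⟨x, rfl⟩ := Ideal.toCotangent_surjective _ x
  obtain ⟨b, hb⟩ := Ideal.mem_span_singleton'.1 (hI.le x.2)
  obtain rfl : x = b • a := Subtype.ext hb.symm
  rw [map_smul, map_smulₛₗ, map_smulₛₗ, h]

/-- On a good chart, `T¹` is annihilated by the ideal of the singular locus. -/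
lemma IsGoodChart.smul_eq_zero {h : j ≫ g = f} {W : V.affineOpens} {hU : IsAffineOpen (j ⁻¹ᵁ W.1)}
    (hW : IsGoodChart h d W hU) {c : Sec f (j ⁻¹ᵁ W.1)}
    (hc : c ∈ singularIdeal f d ⟨j ⁻¹ᵁ W.1, hU⟩)
    (t : T1 k (Sec f (j ⁻¹ᵁ W.1)) (Sec f (j ⁻¹ᵁ W.1))) : c • t = 0 := by
  obtain ⟨_, a, ha, hI, H⟩ := hW
  obtain ⟨l, rfl⟩ := T1.ofNormal_surjective (pullSec h W.1) (pullSec_surjective h W.2)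
    (ker_pullSec h W) t
  obtain ⟨D, hD, rfl⟩ := (H c).1 hc
  exact T1.smul_ofNormal_eq_zero (B := Sec g W.1) (pullSec h W.1) (pullSec_surjective h W.2)
    (ker_pullSec h W) hI hD l

/-- On a good chart, the annihilator of the class of a generator of the normal sheaf is contained
in the ideal of the singular locus. -/
lemma IsGoodChart.mem_singularIdeal {h : j ≫ g = f} {W : V.affineOpens}
    {hU : IsAffineOpen (j ⁻¹ᵁ W.1)} (hW : IsGoodChart h d W hU) :
    ∃ a : j.ker.ideal W, a.1 ∈ nonZeroDivisors Γ(V, W.1) ∧ j.ker.ideal W = Ideal.span {a.1} ∧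
      ∀ l : NormalModule j W, l (Ideal.toCotangent _ a) = 1 → ∀ c : Sec f (j ⁻¹ᵁ W.1),
        c • normalClass h W l = 0 → c ∈ singularIdeal f d ⟨j ⁻¹ᵁ W.1, hU⟩ := by
  obtain ⟨_, a, ha, hI, H⟩ := hW
  have haI : a ∈ j.ker.ideal W := hI ▸ Ideal.mem_span_singleton_self a
  refine ⟨⟨a, haI⟩, ha, hI, fun l hl c hc => (H c).2 ?_⟩
  obtain ⟨D, hD, h1⟩ := T1.exists_derivation_of_ofNormal_eq_zero _ _ _
    ((normalClass_smul h W c l).trans hc)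
  refine ⟨D, hD, (h1 ⟨a, haI⟩).symm.trans ?_⟩
  refine (congrArg (fun y => c * y) hl).trans (mul_one c)

lemma IsGoodChart.normalClass_surjective {h : j ≫ g = f} {W : V.affineOpens}
    {hU : IsAffineOpen (j ⁻¹ᵁ W.1)} (hW : IsGoodChart h d W hU) :
    Function.Surjective (normalClass h W) :=
  have := hW.formallySmooth
  T1.ofNormal_surjective (pullSec h W.1) (pullSec_surjective h W.2) (ker_pullSec h W)

end NormalCrossing

/-! ### The sheaf `T¹` on good charts -/

namespace NormalCrossing

open TangentCohomology AlgebraicGeometry.Scheme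

variable {k : Type u} [Field k] {X V : Scheme.{u}} {f : X ⟶ Spec (.of k)} {g : V ⟶ Spec (.of k)}
  {j : X ⟶ V}

/-- The good charts whose trace on `X` lies in `U`. -/
abbrev ChartIn (h : j ≫ g = f) (d : ℕ) (U : X.Opens) : Type u :=
  {W : V.affineOpens // (∃ hU, IsGoodChart h d W hU) ∧ j ⁻¹ᵁ W.1 ≤ U}

/-- The families `(t_W)`, `t_W ∈ T¹(Γ(X, j⁻¹ W)/k)`, indexed by the good charts `W` over `U`,
which are compatible with restriction. Compatibility is also required for charts `W`, `W'` with
`j⁻¹ W' ⊆ j⁻¹ W` but not `W' ⊆ W`. -/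
def ChartFamily (h : j ≫ g = f) (d : ℕ) (U : X.Opens) :
    AddSubgroup (∀ W : ChartIn h d U, T1 k (Sec f (j ⁻¹ᵁ W.1.1)) (Sec f (j ⁻¹ᵁ W.1.1))) where
  carrier := {t | ∀ (W W' : ChartIn h d U) (h : j ⁻¹ᵁ W'.1.1 ≤ j ⁻¹ᵁ W.1.1),
    T1.Compatible (Sec.res f h) (t W) (t W')}
  zero_mem' _ _ _ := T1.Compatible.zero
  add_mem' ht ht' W W' h := (ht W W' h).add (ht' W W' h)
  neg_mem' ht W W' h := (ht W W' h).neg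

namespace ChartFamily

variable (h : j ≫ g = f) {d : ℕ} {U : X.Opens}

instance : SMul Γ(X, U) (ChartFamily h d U) where
  smul a t := ⟨fun W => toSec f W.2.2 a • t.1 W, fun W W' h => by
    have := (t.2 W W' h).smul (toSec f W.2.2 a)
    rwa [show Sec.res f h (toSec f W.2.2 a) = toSec f W'.2.2 a from resHom_resHom _ _ _] at this⟩

lemma smul_val (a : Γ(X, U)) (t : ChartFamily h d U) (W : ChartIn h d U) :
    (a • t).1 W = toSec f W.2.2 a • t.1 W := rfl

instance : Module Γ(X, U) (ChartFamily h d U) where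
  one_smul t := Subtype.ext (funext fun W => by rw [smul_val, map_one, one_smul])
  mul_smul a b t := Subtype.ext (funext fun W => by simp only [smul_val, map_mul, mul_smul])
  smul_zero a := Subtype.ext (funext fun W => smul_zero (toSec f W.2.2 a))
  smul_add a s t := Subtype.ext (funext fun W => smul_add (toSec f W.2.2 a) _ _)
  add_smul a b t := Subtype.ext (funext fun W => by
    rw [smul_val, map_add, add_smul]
    rfl)
  zero_smul t := Subtype.ext (funext fun W => by
    rw [smul_val, map_zero, zero_smul]
    rfl)

/-- Restriction of families to a smaller open subset. -/
def restrict {U U' : X.Opens} (hU : U' ≤ U) : ChartFamily h d U →+ ChartFamily h d U' where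
  toFun t := ⟨fun W => t.1 ⟨W.1, W.2.1, W.2.2.trans hU⟩, fun W W' h' =>
    t.2 ⟨W.1, W.2.1, W.2.2.trans hU⟩ ⟨W'.1, W'.2.1, W'.2.2.trans hU⟩ h'⟩
  map_zero' := rfl
  map_add' _ _ := rfl

/-- A family on `U` whose value at a chart with trace `U` vanishes is zero, since `T¹` of an étale
algebra is determined by `T¹` of the base. -/
lemma eq_zero_of_apply_eq_zero [IsAffineHom j] (t : ChartFamily h d U) {W : V.affineOpens}
    (hW : (∃ hU, IsGoodChart h d W hU) ∧ j ⁻¹ᵁ W.1 ≤ U) (hU : U ≤ j ⁻¹ᵁ W.1)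
    (ht : t.1 ⟨W, hW⟩ = 0) : t = 0 := by
  refine Subtype.ext (funext fun W' => ?_)
  have h1 := t.2 ⟨W, hW⟩ W' (W'.2.2.trans hU)
  rw [ht] at h1
  exact (T1.Compatible.existsUnique (etale_res f (W.2.preimage j) (W'.1.2.preimage j) _) 0).unique
    h1 T1.Compatible.zero

end ChartFamily

/-- The presheaf of modules `U ↦ ChartFamily h d U`. -/
def chartPresheaf (h : j ≫ g = f) (d : ℕ) : X.PresheafOfModules :=
  letI F : X.Opensᵒᵖ ⥤ Ab.{u} :=
    { obj := fun U => AddCommGrpCat.of (ChartFamily h d U.unop)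
      map := fun i => AddCommGrpCat.ofHom (ChartFamily.restrict h i.unop.le) }
  letI : ∀ U, Module (X.ringCatSheaf.obj.obj U) (F.obj U) := fun U =>
    inferInstanceAs (Module Γ(X, U.unop) (ChartFamily h d U.unop))
  PresheafOfModules.ofPresheaf F (fun U U' i a t => by
    refine Subtype.ext (funext fun W => ?_)
    exact congrArg (fun c : Sec f (j ⁻¹ᵁ W.1.1) => c • t.1 ⟨W.1, W.2.1, W.2.2.trans i.unop.le⟩)
      (resHom_resHom i.unop.le W.2.2 a).symm)

/-- The restriction of families indexed by all affine open subsets of `U` to the traces of good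
charts. -/
def chartFamilyOfT1Family (h : j ≫ g = f) (d : ℕ) (U : X.Opens) :
    T1Family f U →ₗ[Γ(X, U)] ChartFamily h d U where
  toFun t := ⟨fun W => t.1 ⟨⟨j ⁻¹ᵁ W.1.1, W.2.1.1⟩, W.2.2⟩, fun W W' h' =>
    t.2 ⟨⟨j ⁻¹ᵁ W.1.1, W.2.1.1⟩, W.2.2⟩ ⟨⟨j ⁻¹ᵁ W'.1.1, W'.2.1.1⟩, W'.2.2⟩ h'⟩
  map_add' _ _ := rfl
  map_smul' _ _ := rfl

/-- The restriction of families to the traces of good charts, as a morphism of presheaves. -/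
def chartPresheafOfT1Presheaf (h : j ≫ g = f) (d : ℕ) : T1Presheaf f ⟶ chartPresheaf h d where
  app U := ModuleCat.ofHom (R := Γ(X, U.unop)) (X := T1Family f U.unop)
    (Y := ChartFamily h d U.unop) (chartFamilyOfT1Family h d U.unop)
  naturality _ := rfl

/-- If `X` is covered by the traces of arbitrarily small good charts, `𝒯¹_X` can be computed from
the good charts. -/
def sheafifyChartPresheafIso [IsAffineHom j] (h : j ≫ g = f) (d : ℕ)
    (hcov : ∀ (U : X.Opens), ∀ x ∈ U, ∃ (W : V.affineOpens) (hU : IsAffineOpen (j ⁻¹ᵁ W.1)),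
      x ∈ j ⁻¹ᵁ W.1 ∧ j ⁻¹ᵁ W.1 ≤ U ∧ IsGoodChart h d W hU) :
    T1Sheaf f ≅ sheafify (chartPresheaf h d) := by
  refine sheafifyIsoOfLocallyBijective (chartPresheafOfT1Presheaf h d) (fun U t ht x hx => ?_)
    fun U (t : ChartFamily h d U) x hx => ?_
  · obtain ⟨W, hU, hxW, hWU, hW⟩ := hcov U x hx
    refine ⟨j ⁻¹ᵁ W.1, hWU, hxW, Subtype.ext (funext fun W' => ?_)⟩
    let t : T1Family f U := t
    have h0 : t.1 ⟨⟨j ⁻¹ᵁ W.1, hU⟩, hWU⟩ = 0 :=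
      congrFun (congrArg Subtype.val (show chartFamilyOfT1Family h d U t = 0 from ht))
        ⟨W, ⟨hU, hW⟩, hWU⟩
    have h1 := t.2 ⟨⟨j ⁻¹ᵁ W.1, hU⟩, hWU⟩ ⟨W'.1, W'.2.trans hWU⟩ W'.2
    rw [h0] at h1
    exact (T1.Compatible.existsUnique (etale_res f hU W'.1.2 W'.2) 0).unique h1 T1.Compatible.zero
  · obtain ⟨W, hU, hxW, hWU, hW⟩ := hcov U x hx
    choose s hs hs' using fun W' : AffineIn (j ⁻¹ᵁ W.1) =>
      T1.Compatible.existsUnique (etale_res f hU W'.1.2 W'.2) (t.1 ⟨W, ⟨hU, hW⟩, hWU⟩)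
    let s' : T1Family f (j ⁻¹ᵁ W.1) := ⟨s, fun W₁ W₂ h' =>
      T1.Compatible.cancel (φ := Sec.res f W₁.2) (ψ := Sec.res f h') (etale_res f hU W₁.1.2 W₁.2)
        (χ := Sec.res f W₂.2) (AlgHom.ext fun c => (resHom_resHom _ _ c).symm) (hs W₁) (hs W₂)⟩
    refine ⟨j ⁻¹ᵁ W.1, hWU, hxW, s', Subtype.ext (funext fun W' => ?_)⟩
    exact (hs' ⟨⟨j ⁻¹ᵁ W'.1.1, W'.2.1.1⟩, W'.2.2⟩ _
      (t.2 ⟨W, ⟨hU, hW⟩, hWU⟩ ⟨W'.1, W'.2.1, W'.2.2.trans hWU⟩ W'.2.2)).symm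

end NormalCrossing

/-! ### Sections of the structure sheaf of the singular locus -/

namespace NormalCrossing

open TangentCohomology AlgebraicGeometry.Scheme TensorProduct

variable {k : Type u} [Field k] {X V : Scheme.{u}} {f : X ⟶ Spec (.of k)} {g : V ⟶ Spec (.of k)}
  {j : X ⟶ V} [IsClosedImmersion j] {d : ℕ}

/-- The inclusion of the singular locus, with its reduced structure. -/
abbrev singularInclusion (f : X ⟶ Spec (.of k)) (d : ℕ) :=
  (IdealSheafData.vanishingIdeal (singularLocus f d)).subschemeι

/-- The sections over `U` of the structure sheaf of the singular locus. -/
def SingularSec (f : X ⟶ Spec (.of k)) (d : ℕ) (U : X.Opens) : Type u :=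
  (singularStructureSheaf f d).val.obj (.op U)

instance (U : X.Opens) : AddCommGroup (SingularSec f d U) :=
  inferInstanceAs (AddCommGroup ((singularStructureSheaf f d).val.obj (.op U)))

instance (U : X.Opens) : Module Γ(X, U) (SingularSec f d U) :=
  inferInstanceAs (Module (X.ringCatSheaf.obj.obj (.op U))
    ((singularStructureSheaf f d).val.obj (.op U)))

/-- The restriction to the singular locus, as a linear map. -/
def singularPull (f : X ⟶ Spec (.of k)) (d : ℕ) (U : X.Opens) :
    Γ(X, U) →ₗ[Γ(X, U)] SingularSec f d U where
  toFun c := ((singularInclusion f d).app U).hom c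
  map_add' c c' := map_add ((singularInclusion f d).app U).hom c c'
  map_smul' c c' := map_mul ((singularInclusion f d).app U).hom c c'

lemma singularPull_surjective {U : X.Opens} (hU : IsAffineOpen U) :
    Function.Surjective (singularPull f d U) :=
  (singularInclusion f d).app_surjective U hU

lemma singularPull_eq_zero_iff (U : X.affineOpens) (c : Γ(X, U.1)) :
    singularPull f d U.1 c = 0 ↔ c ∈ singularIdeal f d U :=
  SetLike.ext_iff.1
    ((IdealSheafData.vanishingIdeal (singularLocus f d)).ker_subschemeι_app U) c

/-- The restriction of sections of the structure sheaf of the singular locus. -/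
def singularRes (f : X ⟶ Spec (.of k)) (d : ℕ) {U U' : X.Opens} (h : U' ≤ U) :
    SingularSec f d U →+ SingularSec f d U' :=
  ((singularStructureSheaf f d).val.map (homOfLE h).op).hom.toAddMonoidHom

lemma singularRes_singularPull {U U' : X.Opens} (h : U' ≤ U) (c : Γ(X, U)) :
    singularRes f d h (singularPull f d U c) = singularPull f d U' (resHom h c) :=
  (ConcreteCategory.congr_hom ((singularInclusion f d).naturality (homOfLE h).op) c).symm

lemma singularRes_singularRes {U U' U'' : X.Opens} (h : U' ≤ U) (h' : U'' ≤ U')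
    (s : SingularSec f d U) :
    singularRes f d h' (singularRes f d h s) = singularRes f d (h'.trans h) s :=
  resHom_resHom _ _ _

lemma singularRes_smul {U U' : X.Opens} (h : U' ≤ U) (c : Γ(X, U)) (s : SingularSec f d U) :
    singularRes f d h (c • s) = (resHom h c : Γ(X, U')) • singularRes f d h s :=
  (singularStructureSheaf f d).val.map_smul (homOfLE h).op c s

/-- Any lift to `Γ(X, U)` of a section of the structure sheaf of the singular locus. -/
def singularLift {U : X.Opens} (hU : IsAffineOpen U) (s : SingularSec f d U) : Sec f U :=
  (singularPull_surjective hU s).choose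

lemma singularPull_singularLift {U : X.Opens} (hU : IsAffineOpen U) (s : SingularSec f d U) :
    singularPull f d U (singularLift hU s) = s :=
  (singularPull_surjective hU s).choose_spec

/-- On a good chart, `T¹` is a module over the structure sheaf of the singular locus. -/
lemma IsGoodChart.singularLift_smul {h : j ≫ g = f} {W : V.affineOpens}
    {hU : IsAffineOpen (j ⁻¹ᵁ W.1)} (hW : IsGoodChart h d W hU) {s : SingularSec f d (j ⁻¹ᵁ W.1)}
    {c : Sec f (j ⁻¹ᵁ W.1)} (hc : singularPull f d _ c = s)
    (t : T1 k (Sec f (j ⁻¹ᵁ W.1)) (Sec f (j ⁻¹ᵁ W.1))) : singularLift hU s • t = c • t := by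
  rw [← sub_eq_zero, ← sub_smul]
  refine hW.smul_eq_zero ((singularPull_eq_zero_iff ⟨_, hU⟩ _).1 ?_) t
  refine (map_sub (singularPull f d (j ⁻¹ᵁ W.1)) (singularLift hU s) c).trans ?_
  exact (congrArg₂ (· - ·) (singularPull_singularLift hU s) hc).trans (sub_self s)

/-! ### The comparison of the normal sheaf with `T¹` -/

/-- The family `(s · [n_W])` attached to a section `n` of the normal sheaf and a section `s` of the
structure sheaf of the singular locus. The product is formed with an arbitrary lift of `s`, on which
it does not depend, as the charts are good. -/
def chartFamilyOfNormal (h : j ≫ g = f) (d : ℕ)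
    (hV : ∀ W W' : V.affineOpens, IsAffineOpen (W.1 ⊓ W'.1)) {U : X.Opens} (n : NormalFamily j U)
    (s : SingularSec f d U) : ChartFamily h d U :=
  ⟨fun W => singularLift W.2.1.1 (singularRes f d W.2.2 s) • normalClass h W.1 (n.1 ⟨W.1, W.2.2⟩),
    fun W W' h' => by
      obtain ⟨hU', hW'⟩ := W'.2.1
      have := (compatible_normalClass h hV n W.2.2 W'.2.2 h').smul
        (singularLift W.2.1.1 (singularRes f d W.2.2 s))
      rwa [← hW'.singularLift_smul (s := singularRes f d W'.2.2 s)] at this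
      refine (singularRes_singularPull h'
        (singularLift W.2.1.1 (singularRes f d W.2.2 s))).symm.trans ?_
      rw [singularPull_singularLift, singularRes_singularRes]⟩

lemma chartFamilyOfNormal_val (h : j ≫ g = f)
    (hV : ∀ W W' : V.affineOpens, IsAffineOpen (W.1 ⊓ W'.1)) {U : X.Opens} (n : NormalFamily j U)
    {s : SingularSec f d U} (W : ChartIn h d U) {c : Sec f (j ⁻¹ᵁ W.1.1)}
    (hc : singularPull f d _ c = singularRes f d W.2.2 s) :
    (chartFamilyOfNormal h d hV n s).1 W = c • normalClass h W.1 (n.1 ⟨W.1, W.2.2⟩) :=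
  W.2.1.2.singularLift_smul hc _

/-- The map `n ⊗ s ↦ (s · [n_W])`. -/
def chartFamilyOfTensor (h : j ≫ g = f) (d : ℕ)
    (hV : ∀ W W' : V.affineOpens, IsAffineOpen (W.1 ⊓ W'.1)) (U : X.Opens) :
    NormalFamily j U ⊗[Γ(X, U)] SingularSec f d U →ₗ[Γ(X, U)] ChartFamily h d U :=
  TensorProduct.lift <| LinearMap.mk₂ _ (chartFamilyOfNormal h d hV)
    (fun n n' s => Subtype.ext (funext fun W =>
      (congrArg _ (normalClass_add h W.1 _ _)).trans (smul_add _ _ _)))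
    (fun c n s => Subtype.ext (funext fun W => by
      refine (congrArg (fun t => singularLift W.2.1.1 (singularRes f d W.2.2 s) • t)
        (normalClass_smul h W.1 (resHom W.2.2 c) (n.1 ⟨W.1, W.2.2⟩))).trans ?_
      exact smul_comm (M := Sec f (j ⁻¹ᵁ W.1.1)) (N := Sec f (j ⁻¹ᵁ W.1.1)) _ _ _))
    (fun n s s' => Subtype.ext (funext fun W => by
      refine (chartFamilyOfNormal_val h hV n W (c := singularLift W.2.1.1
        (singularRes f d W.2.2 s) + singularLift W.2.1.1 (singularRes f d W.2.2 s')) ?_).trans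
        (add_smul _ _ _)
      refine (map_add (singularPull f d _) _ _).trans ?_
      rw [singularPull_singularLift, singularPull_singularLift, map_add]))
    (fun c n s => Subtype.ext (funext fun W => by
      refine (chartFamilyOfNormal_val h hV n W (c := toSec f W.2.2 c * singularLift W.2.1.1
        (singularRes f d W.2.2 s)) ?_).trans (mul_smul _ _ _)
      refine (map_smul (singularPull f d _) _ _).trans ?_
      rw [singularPull_singularLift, singularRes_smul]
      rfl))

/-- The morphism `𝒩 ⊗ 𝒪_D ⟶ 𝒯¹` on the level of presheaves. -/
def chartPresheafOfTensor (h : j ≫ g = f) (d : ℕ)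
    (hV : ∀ W W' : V.affineOpens, IsAffineOpen (W.1 ⊓ W'.1)) :
    PresheafOfModules.Monoidal.tensorObj (R := X.presheaf) (normalPresheaf j)
      (singularStructureSheaf f d).val ⟶ chartPresheaf h d where
  app U := ModuleCat.ofHom (R := Γ(X, U.unop))
    (X := NormalFamily j U.unop ⊗[Γ(X, U.unop)] SingularSec f d U.unop)
    (Y := ChartFamily h d U.unop) (chartFamilyOfTensor h d hV U.unop)
  naturality {U U'} i := ModuleCat.MonoidalCategory.tensor_ext fun n s => by
    refine Subtype.ext (funext fun W => ?_)
    refine congrArg (fun r => singularLift W.2.1.1 r • normalClass h W.1 _) ?_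
    exact singularRes_singularRes i.unop.le W.2.2 s

end NormalCrossing

namespace NormalCrossing

open TangentCohomology AlgebraicGeometry.Scheme TensorProduct

variable {k : Type u} [Field k] {X V : Scheme.{u}} {f : X ⟶ Spec (.of k)} {g : V ⟶ Spec (.of k)}
  {j : X ⟶ V} [IsClosedImmersion j] {d : ℕ}

lemma chartFamilyOfTensor_tmul_val (h : j ≫ g = f)
    (hV : ∀ W W' : V.affineOpens, IsAffineOpen (W.1 ⊓ W'.1)) {W : V.affineOpens}
    (hW : (∃ hU, IsGoodChart h d W hU) ∧ j ⁻¹ᵁ W.1 ≤ j ⁻¹ᵁ W.1)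
    (n : NormalFamily j (j ⁻¹ᵁ W.1)) (c : Sec f (j ⁻¹ᵁ W.1)) :
    (chartFamilyOfTensor h d hV _ (n ⊗ₜ singularPull f d (j ⁻¹ᵁ W.1) c)).1 ⟨W, hW⟩ =
      c • normalClass h W (n.1 ⟨W, le_rfl⟩) :=
  chartFamilyOfNormal_val h hV n ⟨W, hW⟩ ((congrArg _ (resHom_self le_rfl c).symm).trans
    (singularRes_singularPull le_rfl c).symm)

/-- On the trace of a good chart, the map from `𝒩 ⊗ 𝒪_D` to `𝒯¹` is bijective: `𝒩` is free of
rank one, its generator generates `T¹`, and the annihilator of the generator is the ideal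
of `D`. -/
lemma IsGoodChart.bijective_chartFamilyOfTensor {h : j ≫ g = f}
    (hV : ∀ W W' : V.affineOpens, IsAffineOpen (W.1 ⊓ W'.1)) {W : V.affineOpens}
    {hU : IsAffineOpen (j ⁻¹ᵁ W.1)} (hW : IsGoodChart h d W hU) :
    Function.Bijective (chartFamilyOfTensor h d hV (j ⁻¹ᵁ W.1)) := by
  obtain ⟨a, ha, hI, H⟩ := hW.mem_singularIdeal
  obtain ⟨t, ht⟩ := exists_dual hV ha hI
  have hW' : (∃ hU, IsGoodChart h d W hU) ∧ j ⁻¹ᵁ W.1 ≤ j ⁻¹ᵁ W.1 := ⟨⟨hU, hW⟩, le_rfl⟩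
  have ht1 : t.1 ⟨W, le_rfl⟩ (Ideal.toCotangent _ a) = 1 := by
    refine Eq.trans ?_ (ht W le_rfl)
    exact congrArg (fun x => t.1 ⟨W, le_rfl⟩ (Ideal.toCotangent _ x))
      (Subtype.ext (resHom_self (X := V) le_rfl a.1).symm)
  have htmul (m : NormalFamily j (j ⁻¹ᵁ W.1) ⊗[Γ(X, j ⁻¹ᵁ W.1)] SingularSec f d (j ⁻¹ᵁ W.1)) :
      ∃ s, m = t ⊗ₜ s := by
    induction m with
    | zero => exact ⟨0, (tmul_zero _ _).symm⟩
    | tmul n s =>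
      obtain ⟨c, rfl⟩ := IsDual.exists_smul_eq hV ht hI (le_refl W) rfl le_rfl n
      exact ⟨c • s, smul_tmul c t s⟩
    | add m m' h1 h2 =>
      obtain ⟨s, rfl⟩ := h1
      obtain ⟨s', rfl⟩ := h2
      exact ⟨s + s', (tmul_add _ _ _).symm⟩
  refine ⟨(injective_iff_map_eq_zero _).2 fun m hm => ?_, fun r => ?_⟩
  · obtain ⟨s, rfl⟩ := htmul m
    obtain ⟨c, rfl⟩ := singularPull_surjective hU s
    have h1 := (chartFamilyOfTensor_tmul_val h hV hW' t c).symm.trans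
      (congrFun (congrArg Subtype.val hm) ⟨W, hW'⟩)
    rw [(singularPull_eq_zero_iff ⟨_, hU⟩ c).2 (H _ ht1 c h1), tmul_zero]
  · obtain ⟨l, hl⟩ := hW.normalClass_surjective (r.1 ⟨W, hW'⟩)
    let c : Γ(X, j ⁻¹ᵁ W.1) := l (Ideal.toCotangent _ a)
    refine ⟨(c • t) ⊗ₜ singularPull f d (j ⁻¹ᵁ W.1) 1, sub_eq_zero.1 ?_⟩
    refine ChartFamily.eq_zero_of_apply_eq_zero h _ hW' le_rfl
      ((congrArg (· - r.1 ⟨W, hW'⟩) ?_).trans (sub_self _))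
    refine (chartFamilyOfTensor_tmul_val h hV hW' (c • t) 1).trans ?_
    rw [one_smul, ← hl]
    congr 1
    refine NormalModule.ext_of_generator hI ?_
    refine (congrArg₂ (· * ·) (resHom_self le_rfl c) ht1).trans (mul_one c)

/-- If `X` is covered by the traces of arbitrarily small good charts, `𝒩 ⊗ 𝒪_D` is isomorphic to
the sheaf computed from the good charts. -/
def tensorNormalIso (h : j ≫ g = f) (d : ℕ)
    (hV : ∀ W W' : V.affineOpens, IsAffineOpen (W.1 ⊓ W'.1))
    (hcov : ∀ (U : X.Opens), ∀ x ∈ U, ∃ (W : V.affineOpens) (hU : IsAffineOpen (j ⁻¹ᵁ W.1)),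
      x ∈ j ⁻¹ᵁ W.1 ∧ j ⁻¹ᵁ W.1 ≤ U ∧ IsGoodChart h d W hU) :
    tensor (normalModules j) (singularStructureSheaf f d) ≅ sheafify (chartPresheaf h d) := by
  refine sheafifyIsoOfLocallyBijective (chartPresheafOfTensor h d hV) (fun U m hm x hx => ?_)
    fun U r x hx => ?_
  · obtain ⟨W, hU, hxW, hWU, hW⟩ := hcov U x hx
    refine ⟨j ⁻¹ᵁ W.1, hWU, hxW, (hW.bijective_chartFamilyOfTensor hV).1 ?_⟩
    have h1 := PresheafOfModules.naturality_apply (chartPresheafOfTensor h d hV)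
      (homOfLE hWU).op m
    refine (h1.trans ((congrArg _ hm).trans (map_zero
      (ChartFamily.restrict h (d := d) hWU)))).trans ?_
    exact (map_zero (chartFamilyOfTensor h d hV (j ⁻¹ᵁ W.1))).symm
  · obtain ⟨W, hU, hxW, hWU, hW⟩ := hcov U x hx
    exact ⟨j ⁻¹ᵁ W.1, hWU, hxW, (hW.bijective_chartFamilyOfTensor hV).2 _⟩

lemma exists_isGoodChart_preimage_le {h : j ≫ g = f} (hj : IsNCDEmbedding f g j d) (U : X.Opens)
    (x : X) (hx : x ∈ U) : ∃ (W : V.affineOpens) (hU : IsAffineOpen (j ⁻¹ᵁ W.1)),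
      x ∈ j ⁻¹ᵁ W.1 ∧ j ⁻¹ᵁ W.1 ≤ U ∧ IsGoodChart h d W hU := by
  obtain ⟨W₀, h1, -, h2⟩ := exists_affine_preimage_le (j := j) hx (O := ⊤) trivial
  obtain ⟨W, hU, h3, h4, h5⟩ := exists_isGoodChart hj h1
  exact ⟨W, hU, h3, (j.preimage_mono h4).trans h2, h5⟩

end NormalCrossing

end

theorem proposition3 {k : Type u} [Field k] {X V : Scheme.{u}}
    (f : X ⟶ Spec (.of k)) (g : V ⟶ Spec (.of k)) (j : X ⟶ V) (d : ℕ)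
    (hj : NormalCrossing.IsNCDEmbedding f g j d) :
    ∃ L : X.Modules, NormalCrossing.IsLineBundle L ∧
      Nonempty (L ≅ NormalCrossing.normalSheaf j) ∧
      Nonempty (NormalCrossing.tensor L (NormalCrossing.singularStructureSheaf f d) ≅
        NormalCrossing.T1Sheaf f) := by
  have := hj.isClosedImmersion
  have := hj.isSeparated
  have hV := NormalCrossing.isAffineOpen_inf_of_isSeparated g
  have hcov := NormalCrossing.exists_isGoodChart_preimage_le (h := hj.comp_eq) hj
  exact ⟨NormalCrossing.normalModules j,
    NormalCrossing.isLineBundle_normalModules hV hj.isDivisor,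
    ⟨(NormalCrossing.sheafifyValIso (NormalCrossing.normalModules j)).symm⟩,
    ⟨NormalCrossing.tensorNormalIso hj.comp_eq d hV hcov ≪≫
      (NormalCrossing.sheafifyChartPresheafIso hj.comp_eq d hcov).symm⟩⟩
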